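/- Let $\alpha,\beta,\gamma,\eta,\varepsilon_0,\mu_0>0$ and $k\in\mathbb C$ be fixed. For $\omega\in\mathbb C$ put $d(\omega)=\beta-\omega^2+\eta k^2-i\gamma\omega$, $\varepsilon(\omega,k)=\varepsilon_0+\alpha/d(\omega)$, $\xi(\omega,k)=\mu_0(\varepsilon(\omega,k)-\varepsilon_0)$, $k_0=\mu_0\varepsilon_0\omega$, and $G(x,\kappa)=-\frac{e^{i\kappa|x|}}{4\pi|x|}$ on $\mathbb R^3$. For bounded open sets $D,D'\subset\mathbb R^3$ let $K_D^{\kappa}u=-\int_D G(\cdot-y,\kappa)u(y)\,dy\,|_D$ and $R_{DD'}^{\kappa}u=-\int_D G(\cdot-y,\kappa)u(y)\,dy\,|_{D'}$ for $u\in L^2(D)$. Let $B_1,\dots,B_N\subset\mathbb R^3$ be bounded open sets, let $z_1,\dots,z_N\in\mathbb R^3$ be distinct points, and let $D_i=z_i+\rho B_i$ be resonators of size parameter $\rho>0$. With each particle a mode is associated: a nonzero simple eigenvalue $\lambda_i^0\in\mathbb R$ of $K^0_{B_i}$ with eigenfunction $e_i$. It is assumed that whenever $\lambda_i^0$ is an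 eigenvalue of $K^0_{B_j}$, then $\lambda_j^0=\lambda_i^0$ (for example: identical resonators, with the same simple mode chosen on each). The scattering resonance problem at characteristic size $\delta>0$ is to find $\omega\in\mathbb C$ for which there is $(u_1,\dots,u_N)\neq 0$ in $L^2(D_1)\times\cdots\times L^2(D_N)$ with $$(1-\delta^2\omega^2\xi K^{\delta k_0}_{D_i})u_i-\delta^2\omega^2\xi\sum_{j\ne i}R^{\delta k_0}_{D_jD_i}u_j=0,\qquad i=1,\dots,N.$$ Such an $\omega$ is called a resonance. For normalised eigenpairs $(\lambda_i,\varphi_i)$ of $K^{\delta k_0}_{D_i}$ let $\mathcal A_i=\frac{\delta^2\omega^2\xi}{1-\delta^2\omega^2\xi\lambda_i}$ and $$\mathcal K_{ii}=\langle R^{\delta k_0}_{D_iD_{i+1}}\varphi_i,\varphi_{i+1}\rangle,\qquad \mathcal K_{ij}=-\mathcal A_i\,\langle R^{\delta k_0}_{D_jD_i}\varphi_j,\varphi_i\rangle\,\langle R^{\delta k_0}_{D_iD_{i+1}}\varphi_i,\varphi_{i+1}\rangle\quad(i\neq j),$$ where $i+1$ is read cyclically in $\{1,\dots,N\}$ and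 $\langle\cdot,\cdot\rangle$ is the $L^2$ inner product. If $\omega$ is a pole of some $\mathcal A_i$, then $\det\mathcal K=0$ is understood after multiplication of each row $i$ of $\mathcal K$ by $1-\delta^2\omega^2\xi\lambda_i$. **Theorem.** The scattering resonance problem in three dimensions becomes, at leading order as $\delta,\rho\to0$ with $\delta=O(\rho)$ and $\rho=O(\delta)$, finding $\omega$ with $\det\mathcal K=0$, in the following sense. For every $c>0$ there are $r,\rho_0,C>0$ such that for all $0<\rho\le\rho_0$ and all $\delta$ with $\delta\le c\rho$, $\rho\le c\delta$, the following holds, where $\mathcal W$ is the set of all $\omega\in\mathbb C$ with $|\delta^2\omega^2\xi\rho^2\lambda^0_i-1|\le r$ for some $i$. 1. For $\omega\in\mathcal W$ and each $i$ the operator $K^{\delta k_0}_{D_i}$ has exactly one eigenvalue $\lambda_i$ with $|\lambda_i-\rho^2\lambda_i^0|\le r\rho^2$, and its normalised eigenfunction $\varphi_i$ is unique up to a factor of modulus one. The matrix $\mathcal K=\mathcal K(\omega)$ is formed with these eigenpairs. 2. For each resonance $\omega\in\mathcal W$ there is $\omega'\in\mathcal W$ with $\det\mathcal K(\omega')=0$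 and $|\omega-\omega'|\le C\rho^2|\omega-p|$ for every zero $p$ of $d$ (that is, every pole of the permittivity law). 3. For each $\omega'\in\mathcal W$ with $\det\mathcal K(\omega')=0$ and with $\mathcal K_{ii}(\omega')\neq0$ for all $i$ there is a resonance $\omega\in\mathcal W$ with $|\omega-\omega'|\le C\rho^2|\omega'-p|$ for every zero $p$ of $d$. 4. If $\int_{B_i}e_i\,dx\ne0$ for all $i$, then $\mathcal K_{ii}(\omega)\neq0$ for all $\omega\in\mathcal W$ and all $i$. -/

import Mathlib

open MeasureTheory

noncomputable section

namespace Resonators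

/-- Physical three-dimensional space. -/
abbrev E3 : Type := EuclideanSpace ℝ (Fin 3)

/-- Complex square-integrable functions on `D ⊆ ℝ³` (with Lebesgue measure). -/
abbrev L2 (D : Set E3) : Type := Lp ℂ 2 ((volume : Measure E3).restrict D)

/-- The positive constants of the halide perovskite permittivity law, and the background
permittivity and permeability. -/
structure Medium where
  alpha : ℝ
  beta : ℝ
  gamma : ℝ
  eta : ℝ
  eps0 : ℝ
  mu0 : ℝ
  alpha_pos : 0 < alpha
  beta_pos : 0 < beta
  gamma_pos : 0 < gamma
  eta_pos : 0 < eta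
  eps0_pos : 0 < eps0
  mu0_pos : 0 < mu0

/-- The denominator `β - ω² + η k² - i γ ω` of the permittivity law. -/
def Medium.denom (m : Medium) (k ω : ℂ) : ℂ :=
  m.beta - ω ^ 2 + m.eta * k ^ 2 - Complex.I * m.gamma * ω

/-- The permittivity `ε(ω, k) = ε₀ + α / (β - ω² + η k² - i γ ω)`. -/
def Medium.permittivity (m : Medium) (k ω : ℂ) : ℂ :=
  m.eps0 + m.alpha / m.denom k ω

/-- The permittivity contrast `ξ(ω, k) = μ₀ (ε(ω, k) - ε₀)`. -/
def Medium.contrast (m : Medium) (k ω : ℂ) : ℂ :=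
  m.mu0 * (m.permittivity k ω - m.eps0)

/-- The background wavenumber `k₀ = μ₀ ε₀ ω`. -/
def Medium.k0 (m : Medium) (ω : ℂ) : ℂ := m.mu0 * m.eps0 * ω

/-- The factor `δ² ω² ξ(ω, k)`. -/
def Medium.factor (m : Medium) (k : ℂ) (δ : ℝ) (ω : ℂ) : ℂ :=
  (δ : ℂ) ^ 2 * ω ^ 2 * m.contrast k ω

/-- The outgoing Green's function `G(x, κ) = - exp(i κ |x|) / (4 π |x|)` of the
three-dimensional Helmholtz equation. -/
def green (x : E3) (κ : ℂ) : ℂ :=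
  -(Complex.exp (Complex.I * κ * (‖x‖ : ℂ)) / (4 * (Real.pi : ℂ) * (‖x‖ : ℂ)))

/-- The function `x ↦ - ∫_D G(x - y, κ) u(y) dy`. Its restriction to `D` is `K^κ_D u`, and its
restriction to another set `D'` is `R^κ_{D D'} u`. (For bounded `D` and `u ∈ L²(D)` the integral
converges absolutely at every `x`, because `|y|⁻²` is locally integrable in `ℝ³`.) -/
def potential (κ : ℂ) (D : Set E3) (u : L2 D) (x : E3) : ℂ :=
  -∫ y in D, green (x - y) κ * u y

/-- `(lam, φ)` satisfies the eigenvalue equation `K^κ_D φ = lam φ` in `L²(D)`. -/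
def EigenEq (κ : ℂ) (D : Set E3) (lam : ℂ) (φ : L2 D) : Prop :=
  ∀ᵐ x ∂((volume : Measure E3).restrict D), potential κ D φ x = lam * φ x

/-- `lam` is an eigenvalue of `K^κ_D` on `L²(D)`. -/
def IsEigenvalue (κ : ℂ) (D : Set E3) (lam : ℂ) : Prop :=
  ∃ φ : L2 D, φ ≠ 0 ∧ EigenEq κ D lam φ

/-- The number `⟨R^κ_{D D'} u, v⟩` formed with the inner product of `L²(D')`. -/
def pairing (κ : ℂ) (D D' : Set E3) (u : L2 D) (v : L2 D') : ℂ :=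
  ∫ x in D', potential κ D u x * (starRingEnd ℂ) (v x)

variable {N : ℕ}

/-- The particle `D_i = z_i + ρ B_i` of shape `B_i`, centre `z_i` and size parameter `ρ`. -/
def particle (B : Fin N → Set E3) (z : Fin N → E3) (ρ : ℝ) (i : Fin N) : Set E3 :=
  (fun x => z i + ρ • x) '' B i

/-- `ω` solves the scattering resonance problem for the particles `D_1, …, D_N` at characteristic
size `δ`: there is `(u_1, …, u_N) ≠ 0` in `L²(D_1) × ⋯ × L²(D_N)` with
`(1 - δ²ω²ξ K_{D_i}) u_i - δ²ω²ξ ∑_{j ≠ i} R_{D_j D_i} u_j = 0` in `L²(D_i)` for every `i`. -/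
def IsResonance (m : Medium) (k : ℂ) (D : Fin N → Set E3) (δ : ℝ) (ω : ℂ) : Prop :=
  ∃ u : (i : Fin N) → L2 (D i), u ≠ 0 ∧
    ∀ i, ∀ᵐ x ∂((volume : Measure E3).restrict (D i)),
      u i x - m.factor k δ ω * potential (δ * m.k0 ω) (D i) (u i) x
        - m.factor k δ ω *
          ∑ j ∈ Finset.univ.erase i, potential (δ * m.k0 ω) (D j) (u j) x = 0

/-- `𝒜_i = δ²ω²ξ / (1 - δ²ω²ξ λ_i)`. -/
def calA (m : Medium) (k : ℂ) (δ : ℝ) (ω lam : ℂ) : ℂ :=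
  m.factor k δ ω / (1 - m.factor k δ ω * lam)

/-- The matrix `𝒦` formed from the values `λ_i` and the functions `φ_i ∈ L²(D_i)`.
`finRotate N i` is the cyclic successor `i + 1` of `i`. -/
def calK (m : Medium) (k : ℂ) (D : Fin N → Set E3) (δ : ℝ) (ω : ℂ)
    (lam : Fin N → ℂ) (φ : (i : Fin N) → L2 (D i)) : Matrix (Fin N) (Fin N) ℂ :=
  Matrix.of fun i j =>
    if i = j then
      pairing (δ * m.k0 ω) (D i) (D (finRotate N i)) (φ i) (φ (finRotate N i))
    else
      -calA m k δ ω (lam i) * pairing (δ * m.k0 ω) (D j) (D i) (φ j) (φ i) *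
        pairing (δ * m.k0 ω) (D i) (D (finRotate N i)) (φ i) (φ (finRotate N i))

/-- The matrix `𝒦` with its `i`-th row multiplied by the denominator `1 - δ²ω²ξ λ_i` of `𝒜_i`,
for every `i`; it makes sense at the poles of the `𝒜_i` too. -/
def calKCleared (m : Medium) (k : ℂ) (D : Fin N → Set E3) (δ : ℝ) (ω : ℂ)
    (lam : Fin N → ℂ) (φ : (i : Fin N) → L2 (D i)) : Matrix (Fin N) (Fin N) ℂ :=
  Matrix.of fun i j =>
    if i = j then
      (1 - m.factor k δ ω * lam i) *
        pairing (δ * m.k0 ω) (D i) (D (finRotate N i)) (φ i) (φ (finRotate N i))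
    else
      -m.factor k δ ω * pairing (δ * m.k0 ω) (D j) (D i) (φ j) (φ i) *
        pairing (δ * m.k0 ω) (D i) (D (finRotate N i)) (φ i) (φ (finRotate N i))

/-- Away from the poles of the `𝒜_i`, the two determinants have the same zeros. -/
theorem det_calKCleared (m : Medium) (k : ℂ) (D : Fin N → Set E3) (δ : ℝ) (ω : ℂ)
    (lam : Fin N → ℂ) (φ : (i : Fin N) → L2 (D i))
    (h : ∀ i, 1 - m.factor k δ ω * lam i ≠ 0) :
    (calKCleared m k D δ ω lam φ).det =
      (∏ i, (1 - m.factor k δ ω * lam i)) * (calK m k D δ ω lam φ).det := by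
  rw [← Matrix.det_mul_column]
  congr 1
  ext i j
  have hi := h i
  simp only [calKCleared, calK, calA, Matrix.of_apply]
  split_ifs with hij
  · rfl
  · field_simp

/-- `det 𝒦 = 0`. If `ω` is a pole of some `𝒜_i`, where `𝒦` is not defined, the determinant is
taken after multiplication of the rows of `𝒦` by the denominators. -/
def DetVanishes (m : Medium) (k : ℂ) (D : Fin N → Set E3) (δ : ℝ) (ω : ℂ)
    (lam : Fin N → ℂ) (φ : (i : Fin N) → L2 (D i)) : Prop :=
  ((∀ i, 1 - m.factor k δ ω * lam i ≠ 0) ∧ (calK m k D δ ω lam φ).det = 0) ∨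
    ((∃ i, 1 - m.factor k δ ω * lam i = 0) ∧ (calKCleared m k D δ ω lam φ).det = 0)

/-- `(lam, φ)` is a normalised eigenpair of `K^{δ k₀}_D` with `lam` in the disc of radius `r ρ²`
around `ρ² lam0`. -/
def IsEigenpairNear (m : Medium) (r ρ : ℝ) (lam0 : ℝ) (D : Set E3) (δ : ℝ) (ω : ℂ)
    (lam : ℂ) (φ : L2 D) : Prop :=
  ‖φ‖ = 1 ∧ EigenEq (δ * m.k0 ω) D lam φ ∧ ‖lam - (ρ : ℂ) ^ 2 * lam0‖ ≤ r * ρ ^ 2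

/-- The frequencies near the individual resonances of the chosen modes:
`|δ²ω²ξ ρ² lam0_i - 1| ≤ r` for some `i`. -/
def window (m : Medium) (k : ℂ) (r ρ δ : ℝ) (lam0 : Fin N → ℝ) : Set ℂ :=
  {ω | ∃ i, ‖m.factor k δ ω * ((ρ : ℂ) ^ 2 * lam0 i) - 1‖ ≤ r}

end Resonators

end

/-! ### Winding numbers by continuous logarithms, and stability of zeros of determinants. -/

noncomputable section
namespace Resonators
open Complex Set

/-! Dilation carries every particle unitarily to its shape and turns `K^{δk₀}_{D_i}` into `ρ²` times
an operator on `L²(B i)`. With `s = 1/(δ²ω²ξρ²)`, a frequency is a resonance iff `s` is an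
eigenvalue of a block operator `T(ω)` on the Hilbert sum of the `L²(B i)`. In the window `d(ω)/ω²`
is small, so `ω` is bounded and the wavenumber `δk₀` is `O(ρ)`. Hence, up to `O(ρ²)`, the diagonal
blocks of `T` are the static operators, and the others are `ρ R_ij` with `R_ij` of rank one and
constant kernel `1/(4π|z_i - z_j|)` (`exists_isNear`).

Two finite determinants are then compared. Row `i` of `𝒦` is a multiple of `𝒦_ii`, and up to the
factor `∏ 𝒦_ii` the equation `det 𝒦 = 0` says `det(s - 𝓜) = 0`, where `𝓜` has diagonal `λ_i/ρ²` and
off-diagonal entries `⟨φ_i, T_ij φ_j⟩` (`det_calKCleared_eq`). Eliminating the complement of the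
modes turns the eigenvalue equation into `det(s - S(s)) = 0` with a Schur complement `S`
(`exists_eigenvector_iff_det_schurMatrix`). The elimination is possible because simplicity and
separation keep every `λ⁰_i` out of the spectrum of each static operator with its mode removed. Both
`𝓜` and `S` agree up to `O(ρ²)` with one Hermitian matrix, with diagonal `λ⁰_i` and off-diagonal
entries `ρ⟨e_i, R_ij e_j⟩`: in `S` the elimination is of second order in a perturbation of size
`O(ρ)`, and in `𝓜` the eigenpairs have moved by `O(ρ²)` only (`IsGapped.lipschitz`).

Because the reference matrix is Hermitian, perturbations of size `O(ρ²)` move the zeros by `O(ρ²)`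
even if its eigenvalues coincide or cluster. A winding number on a circle avoiding these eigenvalues
carries a zero of one determinant to a zero of the other (`exists_det_eq_zero_near`). Continuity in
`s` is all that is used. `IsModeFamily.exists_constants` sums up this abstract part.

It remains to convert a shift of `s` into a shift of `ω`. For `v = 1/ω` the relation is `b v² - iγ v
- 1 = A s`, with `b = β + ηk²` and `A = O(ρ⁴)`. A continuous branch `v(s)` exists near every
solution, also near a double root. Since `A s = (v - q)(b(v + q) - iγ)` for each root `q = 1/p`, a
relative change `O(ρ²)` of `s` moves `v` by `O(ρ²)|v - q|`, which is the error measured against `|ω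
- p|` (`exists_frequency_branch`). For item 4 with several particles, the leading part of `𝒦_ii` is
`ρ³` times a nonzero multiple of a product of means of two modes. -/

/-- A continuous function on `ℝ` with `exp ∘ c = 1` is constant. -/
theorem eq_of_continuous_of_exp_eq_one {c : ℝ → ℂ} (hc : Continuous c)
    (h : ∀ x, Complex.exp (c x) = 1) (x y : ℝ) : c x = c y := by
  have h1 : ∀ x, ∃ n : ℤ, c x = n * (2 * Real.pi * I) := fun x => Complex.exp_eq_one_iff.1 (h x)
  choose n hn using h1
  have h2 : Continuous (fun x => ((n x : ℤ) : ℝ)) := by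
    have : (fun x => ((n x : ℤ) : ℝ)) = fun x => (c x).im / (2 * Real.pi) := by
      funext x
      have := Real.pi_pos.ne'
      rw [hn x]; simp
    rw [this]; fun_prop
  have h3 : Continuous n := Int.isClosedEmbedding_coe_real.isInducing.continuous_iff.2 h2
  rw [hn x, hn y, PreconnectedSpace.constant inferInstance h3 (x := x) (y := y)]

theorem exists_continuous_log_of_ne_zero {Φ : ℝ × ℝ → ℂ} (hΦ : Continuous Φ)
    (h0 : ∀ p, Φ p ≠ 0) : ∃ L : ℝ × ℝ → ℂ, Continuous L ∧ ∀ p, Complex.exp (L p) = Φ p := by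
  obtain ⟨f, hf, hf'⟩ := Complex.exists_continuousOn_eqOn_exp_comp (X := ℝ × ℝ) (U := univ)
    (by
      have : SimplyConnectedSpace (univ : Set (ℝ × ℝ)) :=
        have := (convex_univ (𝕜 := ℝ) (E := ℝ × ℝ)).contractibleSpace univ_nonempty
        inferInstance
      exact this) isOpen_univ hΦ.continuousOn
    (by rintro ⟨p, -, hp⟩; exact h0 p hp)
  exact ⟨f, continuousOn_univ.1 hf, fun p => hf' (mem_univ p)⟩

/-- `q` has a continuous logarithm on `ℝ` with equal values at `0` and `2π`. -/
def HasClosedLog (q : ℝ → ℂ) : Prop :=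
  ∃ l : ℝ → ℂ, Continuous l ∧ (∀ θ, Complex.exp (l θ) = q θ) ∧ l (2 * Real.pi) = l 0

/-- Homotopy invariance of the winding number. For a logarithm `L` of `Φ` on the plane, `L (τ, 2π) -
L (τ, 0)` has exponential `1` by periodicity, so it does not depend on `τ`. At `τ = 0` it is the
increment of the given closed logarithm. -/
theorem HasClosedLog.of_homotopy {Φ : ℝ × ℝ → ℂ} (hΦ : Continuous Φ) (h0 : ∀ p, Φ p ≠ 0)
    (hper : ∀ τ, Φ (τ, 2 * Real.pi) = Φ (τ, 0)) (h : HasClosedLog fun θ => Φ (0, θ)) :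
    HasClosedLog fun θ => Φ (1, θ) := by
  obtain ⟨L, hL, hLe⟩ := exists_continuous_log_of_ne_zero hΦ h0
  obtain ⟨l, hl, hle, hl0⟩ := h
  refine ⟨fun θ => L (1, θ), by fun_prop, fun θ => hLe _, ?_⟩
  have e1 := eq_of_continuous_of_exp_eq_one (c := fun θ => L (0, θ) - l θ) (by fun_prop)
    (fun θ => by rw [Complex.exp_sub, hLe, hle, div_self (h0 _)]) (2 * Real.pi) 0
  have e2 := eq_of_continuous_of_exp_eq_one (c := fun τ => L (τ, 2 * Real.pi) - L (τ, 0))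
    (by fun_prop) (fun τ => by rw [Complex.exp_sub, hLe, hLe, hper, div_self (h0 _)]) 1 0
  have e3 : L (0, 2 * Real.pi) - L (0, 0) = 0 := by
    simp only [hl0] at e1
    linear_combination e1
  simp only [e3] at e2
  exact sub_eq_zero.1 e2

/-- A continuous logarithm of `θ ↦ R e^{iθ} - w` with its increment. -/
theorem exists_log_circle_sub {R : ℝ} (hR : 0 < R) {w : ℂ} (hw : ‖w‖ ≠ R) :
    ∃ l : ℝ → ℂ, Continuous l ∧ (∀ θ : ℝ, Complex.exp (l θ) = R * Complex.exp (θ * I) - w) ∧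
      l (2 * Real.pi) - l 0 = if ‖w‖ < R then 2 * Real.pi * I else 0 := by
  have key : ∀ z : ℂ, ‖z‖ < 1 → 1 - z ∈ slitPlane := fun z hz => by
    have := Complex.mem_slitPlane_of_norm_lt_one (z := -z) (by simpa using hz)
    simpa [sub_eq_add_neg] using this
  have hRc : (R : ℂ) ≠ 0 := by exact_mod_cast hR.ne'
  split_ifs with h
  -- With `w` inside the circle, factor out `R e^{iθ}`. The cofactor stays in the slit plane, so
  -- only the summand `iθ` has an increment.
  · have hz : ∀ θ : ℝ, ‖w / (R * Complex.exp (θ * I))‖ < 1 := fun θ => by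
      rw [norm_div, norm_mul, Complex.norm_exp_ofReal_mul_I, mul_one, Complex.norm_real,
        Real.norm_of_nonneg hR.le, div_lt_one hR]
      exact h
    refine ⟨fun θ => Complex.log R + θ * I + Complex.log (1 - w / (R * Complex.exp (θ * I))),
      ?_, fun θ => ?_, ?_⟩
    · refine Continuous.add (by fun_prop) (Continuous.clog ?_ fun θ => key _ (hz θ))
      refine continuous_const.sub (continuous_const.div (by fun_prop) fun θ => ?_)
      exact mul_ne_zero hRc (Complex.exp_ne_zero _)
    · have := slitPlane_ne_zero (key _ (hz θ))
      rw [Complex.exp_add, Complex.exp_add, Complex.exp_log hRc, Complex.exp_log this]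
      have := Complex.exp_ne_zero (θ * I)
      field_simp
    · have : Complex.exp (2 * Real.pi * I) = 1 := Complex.exp_two_pi_mul_I
      simp [this]
  -- With `w` outside the circle, factor out `-w` instead. No summand has an increment.
  · have hlt : R < ‖w‖ := lt_of_le_of_ne (not_lt.1 h) (Ne.symm hw)
    have hw0 : w ≠ 0 := norm_pos_iff.1 (hR.trans hlt)
    have hz : ∀ θ : ℝ, ‖R * Complex.exp (θ * I) / w‖ < 1 := fun θ => by
      rw [norm_div, norm_mul, Complex.norm_exp_ofReal_mul_I, mul_one, Complex.norm_real,
        Real.norm_of_nonneg hR.le, div_lt_one (hR.trans hlt)]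
      exact hlt
    refine ⟨fun θ => Complex.log (-w) + Complex.log (1 - R * Complex.exp (θ * I) / w),
      ?_, fun θ => ?_, ?_⟩
    · exact Continuous.add (by fun_prop) (Continuous.clog (by fun_prop) fun θ => key _ (hz θ))
    · have := slitPlane_ne_zero (key _ (hz θ))
      rw [Complex.exp_add, Complex.exp_log (neg_ne_zero.2 hw0), Complex.exp_log this]
      field_simp
      ring
    · have : Complex.exp (2 * Real.pi * I) = 1 := Complex.exp_two_pi_mul_I
      simp [this]

/-- The increments of the logarithms of the factors add up to `2πi` times the number of `w i` inside
the circle, which is not zero. Any other continuous logarithm of the product differs from their sum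
by a constant. -/
theorem not_hasClosedLog_prod {ι : Type*} [Fintype ι] {R : ℝ} (hR : 0 < R) (w : ι → ℂ)
    (hw : ∀ i, ‖w i‖ ≠ R) (hin : ∃ i, ‖w i‖ < R) :
    ¬ HasClosedLog fun θ => ∏ i, (R * Complex.exp (θ * I) - w i) := by
  classical
  rintro ⟨l, hl, hle, hl0⟩
  choose m hm hme hminc using fun i => exists_log_circle_sub hR (hw i)
  have hsum : ∀ θ, Complex.exp (∑ i, m i θ) = ∏ i, (R * Complex.exp (θ * I) - w i) := fun θ => by
    rw [Complex.exp_sum]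
    exact Finset.prod_congr rfl fun i _ => hme i θ
  have e1 := eq_of_continuous_of_exp_eq_one (c := fun θ => ∑ i, m i θ - l θ)
    ((continuous_finsetSum _ fun i _ => hm i).sub hl)
    (fun θ => by 
      have hθ : Complex.exp (l θ) = ∏ i, (R * Complex.exp (θ * I) - w i) := hle θ
      rw [Complex.exp_sub, hsum, ← hθ, div_self (Complex.exp_ne_zero _)])
    (2 * Real.pi) 0
  simp only [hl0] at e1
  have e2 : ∑ i, (m i (2 * Real.pi) - m i 0) = 0 := by
    rw [Finset.sum_sub_distrib]
    linear_combination e1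
  simp only [hminc] at e2
  rw [← Finset.sum_filter, Finset.sum_const, nsmul_eq_mul] at e2
  obtain ⟨i, hi⟩ := hin
  have hcard : ((Finset.univ.filter fun i => ‖w i‖ < R).card : ℂ) ≠ 0 := by
    rw [Nat.cast_ne_zero]
    exact Finset.card_ne_zero.2 ⟨i, by simp [hi]⟩
  have hpi : (Real.pi : ℂ) ≠ 0 := by exact_mod_cast Real.pi_pos.ne'
  exact (mul_ne_zero hcard (mul_ne_zero (mul_ne_zero two_ne_zero hpi) I_ne_zero)) e2


/-- A Rouché theorem for continuous functions. If `g` had no zero in the disc, shrinking the circle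
to its centre would show that `g` has winding number zero on it, and `Γ` would transfer this to a
product with a zero inside. -/
theorem exists_zero_of_homotopy_prod {ι : Type*} [Fintype ι] {c : ℂ} {R : ℝ} (hR : 0 < R)
    {g : ℂ → ℂ} (hg : ContinuousOn g (Metric.closedBall c R)) {h : ι → ℂ}
    {Γ : ℝ × ℂ → ℂ} (hΓ : ContinuousOn Γ (Icc 0 1 ×ˢ Metric.sphere c R))
    (hΓ0 : ∀ s ∈ Metric.sphere c R, Γ (0, s) = g s)
    (hΓ1 : ∀ s ∈ Metric.sphere c R, Γ (1, s) = ∏ i, (s - h i))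
    (hne : ∀ p ∈ Icc (0 : ℝ) 1 ×ˢ Metric.sphere c R, Γ p ≠ 0) (hin : ∃ i, ‖h i - c‖ < R) :
    ∃ s ∈ Metric.closedBall c R, g s = 0 := by
  by_contra! hcon
  -- `HasClosedLog.of_homotopy` needs a map on the whole plane, so the homotopy parameter is clamped
  -- to `[0, 1]`.
  have hcl : ∀ τ : ℝ, max 0 (min τ 1) ∈ Icc (0 : ℝ) 1 := fun τ =>
    ⟨le_max_left _ _, max_le zero_le_one (min_le_right _ _)⟩
  have hsph : ∀ θ : ℝ, c + R * Complex.exp (θ * I) ∈ Metric.sphere c R := fun θ => by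
    rw [mem_sphere_iff_norm, add_sub_cancel_left, norm_mul, Complex.norm_exp_ofReal_mul_I,
      mul_one, Complex.norm_real, Real.norm_of_nonneg hR.le]
  have hball : ∀ p : ℝ × ℝ, c + ((max 0 (min p.1 1) : ℝ) : ℂ) * (R * Complex.exp (p.2 * I)) ∈
      Metric.closedBall c R := fun p => by
    rw [mem_closedBall_iff_norm, add_sub_cancel_left, norm_mul, norm_mul,
      Complex.norm_exp_ofReal_mul_I, mul_one, Complex.norm_real, Complex.norm_real,
      Real.norm_of_nonneg hR.le, Real.norm_of_nonneg (hcl _).1]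
    exact mul_le_of_le_one_left hR.le (hcl _).2
  have hexp : Complex.exp ((2 * Real.pi : ℝ) * I) = 1 := by
    push_cast
    exact Complex.exp_two_pi_mul_I
  have step1 := HasClosedLog.of_homotopy
    (Φ := fun p => g (c + ((max 0 (min p.1 1) : ℝ) : ℂ) * (R * Complex.exp (p.2 * I))))
    (hg.comp_continuous (by fun_prop) hball) (fun p => hcon _ (hball p))
    (fun τ => by simp only [hexp]; simp) (by
      refine ⟨fun _ => Complex.log (g c), continuous_const, fun θ => ?_, rfl⟩
      rw [Complex.exp_log (hcon c (Metric.mem_closedBall_self hR.le))]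
      simp)
  have step2 := HasClosedLog.of_homotopy
    (Φ := fun p => Γ (max 0 (min p.1 1), c + R * Complex.exp (p.2 * I)))
    (hΓ.comp_continuous (by fun_prop) fun p => ⟨hcl _, hsph _⟩)
    (fun p => hne _ ⟨hcl _, hsph _⟩) (fun τ => by simp only [hexp]; simp) (by
      obtain ⟨l, hl, hle, hl0⟩ := step1
      refine ⟨l, hl, fun θ => ?_, hl0⟩
      rw [hle]
      simp [hΓ0 _ (hsph _)])
  obtain ⟨l, hl, hle, hl0⟩ := step2
  have hle' : ∀ θ : ℝ, Complex.exp (l θ) = Γ (1, c + R * Complex.exp (θ * I)) := fun θ => by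
    simpa using hle θ
  refine not_hasClosedLog_prod hR (fun i => h i - c) (fun i hi => ?_) hin
    ⟨l, hl, fun θ => ?_, hl0⟩
  · have hs : h i ∈ Metric.sphere c R := by simpa [mem_sphere_iff_norm] using hi
    have := hΓ1 _ hs
    rw [Finset.prod_eq_zero (Finset.mem_univ i) (sub_self _)] at this
    exact hne (1, h i) ⟨by simp, hs⟩ this
  · rw [hle', hΓ1 _ (hsph θ)]
    refine Finset.prod_congr rfl fun i _ => ?_
    ring

/-- In an orthonormal eigenbasis of `A` the coordinates of `b` are those of `a` times `s - λ_j`. If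
all these factors exceeded `‖b‖ / ‖a‖`, Parseval's identity would fail. -/
theorem exists_eigenvalue_near {n : Type*} [Fintype n] [DecidableEq n]
    {A : Matrix n n ℂ} (hA : A.IsHermitian) {s : ℂ} {a b : n → ℂ} (ha : a ≠ 0)
    (hab : (s • (1 : Matrix n n ℂ) - A).mulVec a = b) :
    ∃ j, ‖s - hA.eigenvalues j‖ * ‖WithLp.toLp 2 a‖ ≤ ‖WithLp.toLp 2 b‖ := by
  set a' : EuclideanSpace ℂ n := WithLp.toLp 2 a with ha'
  set b' : EuclideanSpace ℂ n := WithLp.toLp 2 b with hb'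
  set v := hA.eigenvectorBasis
  have hcoord : ∀ j, inner ℂ (v j) b' = (s - hA.eigenvalues j) * inner ℂ (v j) a' := fun j => by
    have e1 : Matrix.vecMul (star (v j : n → ℂ)) A = (hA.eigenvalues j : ℂ) • star (v j : n → ℂ) := by
      have := congrArg star (hA.mulVec_eigenvectorBasis j)
      rw [Matrix.star_mulVec, hA.eq] at this
      rw [this]
      ext i
      simp [v]
    rw [EuclideanSpace.inner_eq_star_dotProduct, EuclideanSpace.inner_eq_star_dotProduct, hb',
      ha', ← hab]
    simp only [Matrix.sub_mulVec, Matrix.smul_mulVec, Matrix.one_mulVec]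
    rw [dotProduct_comm, dotProduct_sub, Matrix.dotProduct_mulVec, e1, dotProduct_smul,
      smul_dotProduct, dotProduct_comm a]
    simp
    ring
  by_contra! hcon
  have ha0 : 0 < ‖a'‖ := norm_pos_iff.2 (by simpa [ha'] using ha)
  have hb2 := v.sum_sq_norm_inner_right b'
  have ha2 := v.sum_sq_norm_inner_right a'
  have hne : ∃ j, inner ℂ (v j) a' ≠ 0 := by
    by_contra! hz
    simp only [hz, norm_zero] at ha2
    simp at ha2
    exact ha0.ne' (by simpa using ha2.symm)
  obtain ⟨j0, hj0⟩ := hne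
  have hlt : ‖b'‖ ^ 2 * ‖a'‖ ^ 2 < ‖b'‖ ^ 2 * ‖a'‖ ^ 2 := by
    calc ‖b'‖ ^ 2 * ‖a'‖ ^ 2 = ∑ j, ‖b'‖ ^ 2 * ‖inner ℂ (v j) a'‖ ^ 2 := by
          rw [← ha2, Finset.mul_sum]
      _ < ∑ j, ‖a'‖ ^ 2 * ‖inner ℂ (v j) b'‖ ^ 2 := by
          refine Finset.sum_lt_sum (fun j _ => ?_) ⟨j0, Finset.mem_univ _, ?_⟩
          · rw [hcoord, norm_mul, mul_pow, ← mul_assoc]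
            have := (pow_le_pow_left₀ (norm_nonneg _) (hcon j).le 2)
            rw [mul_pow, mul_comm] at this
            gcongr
          · rw [hcoord, norm_mul, mul_pow, ← mul_assoc]
            have := (pow_lt_pow_left₀ (hcon j0) (norm_nonneg _) two_ne_zero)
            rw [mul_pow, mul_comm] at this
            have h3 : 0 < ‖inner ℂ (v j0) a'‖ := norm_pos_iff.2 hj0
            gcongr
      _ = ‖b'‖ ^ 2 * ‖a'‖ ^ 2 := by rw [← Finset.mul_sum, hb2, mul_comm]
  exact lt_irrefl _ hlt

theorem norm_toLp_mulVec_le {n : ℕ} {E : Matrix (Fin n) (Fin n) ℂ} {ε : ℝ}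
    (hE : ∀ i j, ‖E i j‖ ≤ ε) (a : Fin n → ℂ) :
    ‖WithLp.toLp 2 (E.mulVec a)‖ ≤ n ^ 2 * ε * ‖WithLp.toLp 2 a‖ := by
  have h1 : ∀ j, ‖a j‖ ≤ ‖WithLp.toLp 2 a‖ := fun j => PiLp.norm_apply_le (WithLp.toLp 2 a) j
  have h2 : ∀ i, ‖E.mulVec a i‖ ≤ n * (ε * ‖WithLp.toLp 2 a‖) := fun i => by
    calc ‖∑ j, E i j * a j‖ ≤ ∑ j : Fin n, ‖E i j * a j‖ := norm_sum_le _ _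
      _ ≤ ∑ j : Fin n, ε * ‖WithLp.toLp 2 a‖ := by
          refine Finset.sum_le_sum fun j _ => ?_
          rw [norm_mul]
          exact mul_le_mul (hE i j) (h1 j) (norm_nonneg _) ((norm_nonneg _).trans (hE i j))
      _ = _ := by simp
  calc ‖WithLp.toLp 2 (E.mulVec a)‖ ≤ ∑ i : Fin n, ‖E.mulVec a i‖ := by
        have := norm_sum_le Finset.univ
          (fun i => (EuclideanSpace.single i (E.mulVec a i) : EuclideanSpace ℂ (Fin n)))
        simp only [PiLp.norm_single] at this
        refine le_trans (le_of_eq ?_) this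
        congr 1
        ext i
        simp [WithLp.ofLp_sum, Finset.sum_apply, Pi.single_apply]
    _ ≤ ∑ i : Fin n, n * (ε * ‖WithLp.toLp 2 a‖) := Finset.sum_le_sum fun i _ => h2 i
    _ = _ := by simp; ring

/-- A kernel vector `a` satisfies `(s - A) a = E a`, and `n² ε` is a crude bound for the norm of
`E`. -/
theorem exists_eigenvalue_near_of_det {n : ℕ} {A E : Matrix (Fin n) (Fin n) ℂ}
    (hA : A.IsHermitian) {ε : ℝ} (hE : ∀ i j, ‖E i j‖ ≤ ε) {s : ℂ}
    (hs : (s • (1 : Matrix (Fin n) (Fin n) ℂ) - A - E).det = 0) :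
    ∃ j, ‖s - hA.eigenvalues j‖ ≤ n ^ 2 * ε := by
  obtain ⟨a, ha, hae⟩ := Matrix.exists_mulVec_eq_zero_iff.2 hs
  rw [Matrix.sub_mulVec, sub_eq_zero] at hae
  obtain ⟨j, hj⟩ := exists_eigenvalue_near hA ha hae
  have h0 : 0 < ‖WithLp.toLp 2 a‖ := norm_pos_iff.2 (by simpa using ha)
  exact ⟨j, le_of_mul_le_mul_right (hj.trans (norm_toLp_mulVec_le hE a)) h0⟩

/-- The zeros of `det (s - A - E(s))` are stable: if `A` is Hermitian and one perturbation of
size `ε` has a zero at `s₀`, then so does, at distance `O(ε)`, every continuous one. -/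
theorem exists_det_eq_zero_near {n : ℕ} {A : Matrix (Fin n) (Fin n) ℂ} (hA : A.IsHermitian)
    {ε : ℝ} (hε : 0 < ε) {E₁ : Matrix (Fin n) (Fin n) ℂ} (hE₁ : ∀ i j, ‖E₁ i j‖ ≤ ε) {s₀ : ℂ}
    (hs₀ : (s₀ • (1 : Matrix (Fin n) (Fin n) ℂ) - A - E₁).det = 0)
    {E : ℂ → Matrix (Fin n) (Fin n) ℂ}
    (hc : ContinuousOn E (Metric.closedBall s₀ (3 * (n + 1) * n ^ 2 * ε)))
    (hE : ∀ s ∈ Metric.closedBall s₀ (3 * (n + 1) * n ^ 2 * ε), ∀ i j, ‖E s i j‖ ≤ ε) :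
    ∃ s ∈ Metric.closedBall s₀ (3 * (n + 1) * n ^ 2 * ε),
      (s • (1 : Matrix (Fin n) (Fin n) ℂ) - A - E s).det = 0 := by
  obtain ⟨j₀, hj₀⟩ := exists_eigenvalue_near_of_det hA hE₁ hs₀
  have hn : 0 < n := j₀.pos
  set η : ℝ := n ^ 2 * ε with hη
  have hη0 : 0 < η := by positivity
  set h : Fin n → ℂ := fun j => (hA.eigenvalues j : ℂ)
  -- Pigeonhole: the `n + 1` candidate radii are spaced by `3η`, so each of the `n` eigenvalues is
  -- `η`-close to at most one of the circles, and some circle is left over.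
  obtain ⟨k, hk⟩ : ∃ k : Fin (n + 1), ∀ j, η < |‖h j - s₀‖ - 3 * ((k : ℝ) + 1) * η| := by
    by_contra! hcon
    choose f hf using hcon
    obtain ⟨k, l, hkl, hfkl⟩ := Fintype.exists_ne_map_eq_of_card_lt f (by simp)
    have h1 := abs_le.1 (hf k)
    have h2 := abs_le.1 (hf l)
    rw [hfkl] at h1
    have h3 : ((k : ℕ) : ℝ) + 1 ≤ l ∨ ((l : ℕ) : ℝ) + 1 ≤ k := by
      have : (k : ℕ) ≠ l := fun h => hkl (Fin.ext h)
      rcases lt_or_gt_of_ne this with h | h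
      · left; exact_mod_cast h
      · right; exact_mod_cast h
    rcases h3 with h3 | h3 <;> nlinarith
  set R : ℝ := 3 * ((k : ℝ) + 1) * η with hR
  have hRpos : 0 < R := by positivity
  have hR3 : 3 * η ≤ R := by
    have : (0 : ℝ) ≤ (k : ℕ) := Nat.cast_nonneg _
    nlinarith
  have hRle : R ≤ 3 * (n + 1) * n ^ 2 * ε := by
    have : ((k : ℕ) : ℝ) ≤ n := by exact_mod_cast Nat.lt_succ_iff.1 k.2
    have : R ≤ 3 * ((n : ℝ) + 1) * η := by rw [hR]; gcongr
    rw [hη] at this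
    linarith
  have hsub := Metric.closedBall_subset_closedBall (x := s₀) hRle
  have hsph : Metric.sphere s₀ R ⊆ Metric.closedBall s₀ (3 * (n + 1) * n ^ 2 * ε) :=
    Metric.sphere_subset_closedBall.trans hsub
  -- The homotopy switches `E` off and ends at the characteristic polynomial of `A`. A zero on the
  -- circle would lie within `η` of an eigenvalue, against the choice of the radius. The eigenvalue
  -- `h j₀` lies inside because `η < 3η ≤ R`.
  obtain ⟨s, hs, hs'⟩ := exists_zero_of_homotopy_prod (c := s₀) hRpos
    (g := fun s => (s • (1 : Matrix (Fin n) (Fin n) ℂ) - A - E s).det) (h := h)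
    (Γ := fun p => (p.2 • (1 : Matrix (Fin n) (Fin n) ℂ) - A - ((1 - p.1 : ℝ) : ℂ) • E p.2).det)
    (by
      refine continuous_id.matrix_det.comp_continuousOn ?_
      exact (Continuous.continuousOn (by fun_prop)).sub (hc.mono hsub))
    (by
      refine continuous_id.matrix_det.comp_continuousOn ?_
      refine (Continuous.continuousOn (by fun_prop)).sub ?_
      refine ContinuousOn.smul (f := fun p : ℝ × ℂ => ((1 - p.1 : ℝ) : ℂ))
        (Continuous.continuousOn (by fun_prop)) ?_
      exact (hc.mono hsph).comp continuousOn_snd fun p hp => hp.2)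
    (fun s _ => by simp)
    (fun s _ => by
      have := congrArg (Polynomial.eval s) hA.charpoly_eq
      rw [Matrix.eval_charpoly, Polynomial.eval_prod] at this
      simpa [Matrix.smul_one_eq_diagonal, h] using this)
    (fun p hp h0 => by
      have hp1 : ‖((1 - p.1 : ℝ) : ℂ)‖ ≤ 1 := by
        rw [Complex.norm_real, Real.norm_eq_abs, abs_le]
        constructor <;> linarith [hp.1.1, hp.1.2]
      obtain ⟨j, hj⟩ := exists_eigenvalue_near_of_det hA (ε := ε) (fun i j => by
        rw [Matrix.smul_apply, smul_eq_mul, norm_mul]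
        exact (mul_le_of_le_one_left (norm_nonneg _) hp1).trans (hE _ (hsph hp.2) i j)) h0
      have h1 := hk j
      have h2 : ‖p.2 - s₀‖ = R := mem_sphere_iff_norm.1 hp.2
      have h3 : |‖h j - s₀‖ - R| ≤ ‖p.2 - h j‖ := by
        rw [← h2]
        refine (abs_norm_sub_norm_le _ _).trans (le_of_eq ?_)
        rw [norm_sub_rev]
        congr 1
        ring
      linarith)
    ⟨j₀, by rw [norm_sub_rev]; linarith⟩
  exact ⟨s, hsub hs, hs'⟩

end Resonators
end

/-! ### Schur complements, and perturbation of a single gapped eigenpair. -/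

noncomputable section
namespace Resonators
open Complex Set

/-- Neumann series: `a - y = a (1 - b y)` with `‖b y‖ ≤ 1/2`. The inverse `x` satisfies `x = b + b y
x`, and the last term is absorbed. -/
theorem isUnit_sub_and_norm_inverse_le {R : Type*} [NormedRing R] [CompleteSpace R] {a b y : R} {M : ℝ} (hab : a * b = 1) (hba : b * a = 1) (hb : ‖b‖ ≤ M)
    (hy : M * ‖y‖ ≤ 1 / 2) : IsUnit (a - y) ∧ ‖Ring.inverse (a - y)‖ ≤ 2 * M := by
  have h1 : ‖b * y‖ ≤ 1 / 2 :=
    (norm_mul_le _ _).trans ((mul_le_mul_of_nonneg_right hb (norm_nonneg _)).trans hy)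
  have h2 : IsUnit (1 - b * y) := isUnit_one_sub_of_norm_lt_one (by linarith)
  have h3 : a - y = a * (1 - b * y) := by rw [mul_sub, ← mul_assoc, hab, mul_one, one_mul]
  have h4 : IsUnit (a - y) := h3 ▸ (show IsUnit a from ⟨⟨a, b, hab, hba⟩, rfl⟩).mul h2
  refine ⟨h4, ?_⟩
  have h5 : Ring.inverse (a - y) = b + b * y * Ring.inverse (a - y) := by
    have : (a - y) * Ring.inverse (a - y) = 1 := Ring.mul_inverse_cancel _ h4
    have h6 : b * ((a - y) * Ring.inverse (a - y)) = b := by rw [this, mul_one]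
    rw [sub_mul, mul_sub, ← mul_assoc, hba, one_mul, ← mul_assoc, sub_eq_iff_eq_add] at h6
    exact h6
  have h7 : ‖Ring.inverse (a - y)‖ ≤ M + 1 / 2 * ‖Ring.inverse (a - y)‖ := by
    calc ‖Ring.inverse (a - y)‖ = ‖b + b * y * Ring.inverse (a - y)‖ := by rw [← h5]
      _ ≤ ‖b‖ + ‖b * y‖ * ‖Ring.inverse (a - y)‖ :=
          (norm_add_le _ _).trans (add_le_add_right (norm_mul_le _ _) _)
      _ ≤ _ := by gcongr
  linarith

variable {H : Type*} [NormedAddCommGroup H] [InnerProductSpace ℂ H]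

/-- The operator `u ↦ ∑ᵢ cᵢ ⟨wᵢ, u⟩ wᵢ`. -/
def diagOp {n : ℕ} (w : Fin n → H) (c : Fin n → ℂ) : H →L[ℂ] H :=
  ∑ i, c i • (innerSL ℂ (w i)).smulRight (w i)

theorem diagOp_apply {n : ℕ} (w : Fin n → H) (c : Fin n → ℂ) (u : H) :
    diagOp w c u = ∑ i, (c i * inner ℂ (w i) u) • w i := by
  simp [diagOp, smul_smul]

/-- The projection onto the orthogonal complement of an orthonormal family. -/
def coProj {n : ℕ} (w : Fin n → H) : H →L[ℂ] H := 1 - diagOp w 1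

theorem coProj_apply {n : ℕ} (w : Fin n → H) (u : H) :
    coProj w u = u - ∑ i, inner ℂ (w i) u • w i := by
  simp [coProj, diagOp_apply]

theorem inner_coProj {n : ℕ} {w : Fin n → H} (hw : Orthonormal ℂ w) (i : Fin n) (u : H) :
    inner ℂ (w i) (coProj w u) = 0 := by
  rw [coProj_apply, inner_sub_right, hw.inner_right_fintype, sub_self]

theorem norm_coProj_le {n : ℕ} {w : Fin n → H} (hw : Orthonormal ℂ w) :
    ‖coProj w‖ ≤ 1 := by
  refine ContinuousLinearMap.opNorm_le_bound _ zero_le_one fun u => ?_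
  have h : inner ℂ (∑ i, inner ℂ (w i) u • w i) (coProj w u) = 0 := by
    rw [sum_inner]
    exact Finset.sum_eq_zero fun i _ => by rw [inner_smul_left, inner_coProj hw, mul_zero]
  have h2 := norm_add_sq_eq_norm_sq_add_norm_sq_of_inner_eq_zero _ _ h
  have h3 : ∑ i, inner ℂ (w i) u • w i + coProj w u = u := by rw [coProj_apply]; abel
  rw [h3] at h2
  rw [one_mul]
  nlinarith [norm_nonneg u, norm_nonneg (coProj w u),
    mul_self_nonneg ‖∑ i, inner ℂ (w i) u • w i‖]

/-- The operator `s - D - Q X` whose inverse enters the Schur complement. -/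
def schurOp {n : ℕ} (w : Fin n → H) (D X : H →L[ℂ] H) (s : ℂ) : H →L[ℂ] H :=
  s • 1 - D - coProj w * X

/-- The Schur complement of `D + ∑ᵢ λᵢ wᵢ ⊗ wᵢ + X` on the span of the `wᵢ`. -/
def schurMatrix {n : ℕ} (w : Fin n → H) (lam : Fin n → ℂ) (D X : H →L[ℂ] H) (s : ℂ) :
    Matrix (Fin n) (Fin n) ℂ :=
  Matrix.diagonal lam + Matrix.of fun i j => inner ℂ (w i) (X (w j)) +
    inner ℂ (w i) (X (Ring.inverse (schurOp w D X s) (coProj w (X (w j)))))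

/-- Feshbach reduction. Write `u = ∑ a_j w_j + q` with `q` orthogonal to the `w_j`. The
complementary part of the eigenvalue equation is `T q = Q X ∑ a_j w_j` with `T` the Schur operator
and `Q` the projection `coProj w`; it determines `q` from `a`. Inserting `q` in the components along
the `w_i` gives the finite system for `a`, and `a = 0` would force `u = 0`. -/
theorem exists_eigenvector_iff_det_schurMatrix {n : ℕ} {w : Fin n → H} (hw : Orthonormal ℂ w)
    {lam : Fin n → ℂ} {D X : H →L[ℂ] H} (hD : ∀ i, D (w i) = 0)
    (hD' : ∀ i u, inner ℂ (w i) (D u) = 0) {s : ℂ} (hs : s ≠ 0)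
    (hunit : IsUnit (schurOp w D X s)) :
    (∃ u ≠ 0, (D + diagOp w lam + X) u = s • u) ↔
      (s • (1 : Matrix (Fin n) (Fin n) ℂ) - schurMatrix w lam D X s).det = 0 := by
  set T := schurOp w D X s with hT
  set G := Ring.inverse T with hG
  have hTG : ∀ v, T (G v) = v := fun v => by
    have := Ring.mul_inverse_cancel _ hunit
    exact congrArg (fun f : H →L[ℂ] H => f v) this
  have hGT : ∀ v, G (T v) = v := fun v => by
    have := Ring.inverse_mul_cancel _ hunit
    exact congrArg (fun f : H →L[ℂ] H => f v) this
  have hTv : ∀ v, T v = s • v - D v - coProj w (X v) := fun v => by simp [hT, schurOp]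
  have hcomp : ∀ (a : Fin n → ℂ) (i : Fin n),
      ((s • (1 : Matrix (Fin n) (Fin n) ℂ) - schurMatrix w lam D X s).mulVec a) i =
        (s - lam i) * a i - inner ℂ (w i) (X (∑ j, a j • w j)) -
          inner ℂ (w i) (X (G (coProj w (X (∑ j, a j • w j))))) := fun a i => by
    simp only [Matrix.sub_mulVec, Matrix.smul_mulVec, Matrix.one_mulVec, schurMatrix,
      Matrix.add_mulVec, Matrix.mulVec_diagonal, Pi.sub_apply, Pi.add_apply, Pi.smul_apply,
      map_sum, map_smul, inner_sum, inner_smul_right, smul_eq_mul]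
    simp only [Matrix.mulVec, dotProduct, Matrix.of_apply, add_mul, Finset.sum_add_distrib,
      mul_comm (a _), ← hT, ← hG]
    ring
  rw [← Matrix.exists_mulVec_eq_zero_iff]
  constructor
  · rintro ⟨u, hu, hue⟩
    simp only [_root_.add_apply, diagOp_apply] at hue
    set a : Fin n → ℂ := fun i => inner ℂ (w i) u with ha
    set q := coProj w u with hq
    have huq : u = ∑ j, a j • w j + q := by rw [hq, coProj_apply]; simp [ha]
    have hqT : T q = coProj w (X (∑ j, a j • w j)) := by
      have hDq : D q = D u := by
        conv_rhs => rw [huq]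
        simp [hD]
      have h1 : coProj w (s • u) = D u + coProj w (X u) := by
        rw [← hue, map_add, map_add]
        have e1 : coProj w (D u) = D u := by simp [coProj_apply, hD']
        have e2 : coProj w (∑ i, (lam i * a i) • w i) = 0 := by
          rw [coProj_apply]
          simp [hw.inner_right_fintype]
        rw [e1, e2, add_zero]
      rw [hTv, hDq, hq, ← map_smul, h1, add_sub_cancel_left, ← map_sub, ← map_sub]
      congr 2
      rw [sub_eq_iff_eq_add]
      exact huq
    have hqG : q = G (coProj w (X (∑ j, a j • w j))) := by rw [← hqT, hGT]
    refine ⟨a, fun h0 => hu ?_, ?_⟩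
    · rw [huq, hqG, h0]
      simp
    · ext i
      rw [hcomp, ← hqG, Pi.zero_apply, sub_sub, ← inner_add_right, ← map_add, ← huq]
      have := congrArg (fun v => inner ℂ (w i) v) hue
      simp only [inner_add_right, hD', hw.inner_right_fintype, inner_smul_right, zero_add] at this
      rw [sub_mul]
      simp only [ha]
      linear_combination -this
  · rintro ⟨a, ha, hae⟩
    set q := G (coProj w (X (∑ j, a j • w j))) with hq
    have hTq : s • q - D q - coProj w (X q) = coProj w (X (∑ j, a j • w j)) := by
      rw [← hTv, hq, hTG]
    -- `T` acts on the whole space, and the orthogonality of `q` is recovered from `⟨w i, T q⟩ = s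
    -- ⟨w i, q⟩` and `s ≠ 0`.
    have hwq : ∀ i, inner ℂ (w i) q = 0 := fun i => by
      have := congrArg (fun v => inner ℂ (w i) v) hTq
      simp only [inner_sub_right, hD', inner_coProj hw, inner_smul_right, sub_zero] at this
      exact (mul_eq_zero.1 this).resolve_left hs
    have hwu : ∀ i, inner ℂ (w i) (∑ j, a j • w j + q) = a i := fun i => by
      rw [inner_add_right, hw.inner_right_fintype, hwq, add_zero]
    refine ⟨∑ j, a j • w j + q, fun h0 => ha ?_, ?_⟩
    · ext i
      rw [← hwu i, h0, inner_zero_right, Pi.zero_apply]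
    · simp only [_root_.add_apply, diagOp_apply, hwu]
      have h1 : ∀ i, (s - lam i) * a i = inner ℂ (w i) (X (∑ j, a j • w j + q)) := fun i => by
        have := congrFun hae i
        rw [hcomp, Pi.zero_apply] at this
        rw [map_add, inner_add_right]
        linear_combination this
      have h2 : X (∑ j, a j • w j + q) = coProj w (X (∑ j, a j • w j)) + coProj w (X q) +
          ∑ i, ((s - lam i) * a i) • w i := by
        rw [← map_add, ← map_add, coProj_apply]
        simp only [h1]
        abel
      rw [h2, ← hTq, map_add, map_sum]
      simp only [map_smul, hD, smul_zero, Finset.sum_const_zero, zero_add, sub_mul, sub_smul,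
        Finset.sum_sub_distrib, smul_add, Finset.smul_sum, smul_smul]
      abel


/-- The resolvent term contains `X` twice, so it is of second order. -/
theorem norm_schurMatrix_sub_le {n : ℕ} {w : Fin n → H} (hw : Orthonormal ℂ w)
    (lam : Fin n → ℂ) (D X : H →L[ℂ] H) (s : ℂ) {M : ℝ}
    (hM : ‖Ring.inverse (schurOp w D X s)‖ ≤ M) (i j : Fin n) :
    ‖schurMatrix w lam D X s i j - (Matrix.diagonal lam i j + inner ℂ (w i) (X (w j)))‖ ≤
      M * ‖X‖ ^ 2 := by
  have h1 : schurMatrix w lam D X s i j - (Matrix.diagonal lam i j + inner ℂ (w i) (X (w j))) =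
      inner ℂ (w i) (X (Ring.inverse (schurOp w D X s) (coProj w (X (w j))))) := by
    simp only [schurMatrix, Matrix.add_apply, Matrix.of_apply]
    ring
  have hM0 : 0 ≤ M := (norm_nonneg _).trans hM
  rw [h1]
  calc _ ≤ ‖w i‖ * ‖X (Ring.inverse (schurOp w D X s) (coProj w (X (w j))))‖ :=
        norm_inner_le_norm _ _
    _ ≤ 1 * (‖X‖ * (M * (1 * (‖X‖ * 1)))) := by
        rw [hw.1 i]
        gcongr
        refine (X.le_opNorm _).trans ?_
        gcongr
        refine (ContinuousLinearMap.le_of_opNorm_le _ hM _).trans ?_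
        gcongr
        refine (ContinuousLinearMap.le_of_opNorm_le _ (norm_coProj_le hw) _).trans ?_
        gcongr
        exact (X.le_opNorm _).trans (by rw [hw.1 j])
    _ = M * ‖X‖ ^ 2 := by ring

theorem continuousOn_schurMatrix [CompleteSpace H] {n : ℕ} (w : Fin n → H)
    (lam : Fin n → ℂ) (D : H →L[ℂ] H) {X : ℂ → H →L[ℂ] H} {S : Set ℂ} (hX : ContinuousOn X S)
    (hu : ∀ s ∈ S, IsUnit (schurOp w D (X s) s)) :
    ContinuousOn (fun s => schurMatrix w lam D (X s) s) S := by
  have h1 : ContinuousOn (fun s => schurOp w D (X s) s) S := by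
    unfold schurOp
    fun_prop
  have h2 : ContinuousOn (fun s => Ring.inverse (schurOp w D (X s) s)) S := fun s hs => by
    obtain ⟨x, hx⟩ := hu s hs
    have := NormedRing.inverse_continuousAt x
    rw [hx] at this
    exact this.comp_continuousWithinAt (f := fun s => schurOp w D (X s) s) (h1 s hs)
  refine continuousOn_pi.2 fun i => continuousOn_pi.2 fun j => ?_
  have h3 : ContinuousOn (fun s => (X s) (w j)) S := hX.clm_apply continuousOn_const
  have h4 : ContinuousOn (fun s => inner ℂ (w i) ((X s)
      (Ring.inverse (schurOp w D (X s) s) (coProj w (X s (w j)))))) S :=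
    ContinuousOn.inner (𝕜 := ℂ) continuousOn_const (hX.clm_apply (h2.clm_apply
      ((coProj w).continuous.comp_continuousOn h3)))
  exact continuousOn_const.add ((ContinuousOn.inner (𝕜 := ℂ) continuousOn_const h3).add h4)

theorem isUnit_schurOp [CompleteSpace H] {n : ℕ} {w : Fin n → H} (hw : Orthonormal ℂ w)
    {D X G : H →L[ℂ] H} {μ s : ℂ} {M : ℝ} (h1 : (μ • 1 - D) * G = 1) (h2 : G * (μ • 1 - D) = 1)
    (hG : ‖G‖ ≤ M) (hs : M * ‖s - μ‖ ≤ 1 / 4) (hX : M * ‖X‖ ≤ 1 / 4) :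
    IsUnit (schurOp w D X s) ∧ ‖Ring.inverse (schurOp w D X s)‖ ≤ 2 * M := by
  have h3 : schurOp w D X s = (μ • 1 - D) - ((μ - s) • 1 + coProj w * X) := by
    rw [schurOp]
    module
  rw [h3]
  refine isUnit_sub_and_norm_inverse_le h1 h2 hG ?_
  have hM0 : 0 ≤ M := (norm_nonneg _).trans hG
  have h4 : ‖(μ - s) • (1 : H →L[ℂ] H) + coProj w * X‖ ≤ ‖s - μ‖ + ‖X‖ := by
    refine (norm_add_le _ _).trans (add_le_add ?_ ?_)
    · rw [norm_smul, norm_sub_rev]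
      exact mul_le_of_le_one_right (norm_nonneg _) ContinuousLinearMap.norm_id_le
    · exact (norm_mul_le _ _).trans
        (mul_le_of_le_one_left (norm_nonneg _) (norm_coProj_le hw))
  nlinarith

theorem exists_phase {z : ℂ} (hz : z ≠ 0) : ∃ c : ℂ, ‖c‖ = 1 ∧ c * z = ‖z‖ := by
  have h0 : (‖z‖ : ℂ) ≠ 0 := by exact_mod_cast (norm_pos_iff.2 hz).ne'
  refine ⟨(starRingEnd ℂ) z / ‖z‖, ?_, ?_⟩
  · rw [norm_div, RCLike.norm_conj, Complex.norm_real, norm_norm, div_self]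
    exact_mod_cast h0
  · rw [div_mul_eq_mul_div, mul_comm, Complex.mul_conj, Complex.normSq_eq_norm_sq]
    push_cast
    field_simp

/-- A unit eigenvector `e` of `K` for `lam`, on which `K` acts symmetrically, together with the
inverse `G` of `μ - (K - lam e ⊗ e)`. -/
structure IsGapped (K : H →L[ℂ] H) (e : H) (lam : ℝ) (μ : ℂ) (G : H →L[ℂ] H) : Prop where
  norm_eq : ‖e‖ = 1
  apply_eq : K e = (lam : ℂ) • e
  inner_eq : ∀ u, inner ℂ e (K u) = lam * inner ℂ e u
  mul_eq : (μ • 1 - (K - diagOp (fun _ : Fin 1 => e) fun _ => (lam : ℂ))) * G = 1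
  eq_mul : G * (μ • 1 - (K - diagOp (fun _ : Fin 1 => e) fun _ => (lam : ℂ))) = 1

namespace IsGapped

variable {K₀ K K' G : H →L[ℂ] H} {e φ φ' : H} {lam : ℝ} {s s' : ℂ} {M ε η : ℝ}

theorem inner_self (h : IsGapped K₀ e lam lam G) : inner ℂ e e = 1 := by
  rw [inner_self_eq_norm_sq_to_K, h.norm_eq]; simp

/-- On the complement of `e`, the operator `lam - K₀` is bounded below. -/
theorem norm_le (h : IsGapped K₀ e lam lam G) (hM : ‖G‖ ≤ M) {q v : H} {c : ℂ}
    (hq : inner ℂ e q = 0) (hv : (lam : ℂ) • q - K₀ q = v + c • e) : ‖q‖ ≤ M * ‖v‖ := by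
  have hM0 : 0 ≤ M := (norm_nonneg _).trans hM
  have h1 : G ((lam : ℂ) • q - K₀ q) = q := by
    have := congrArg (fun f : H →L[ℂ] H => f q) h.eq_mul
    simpa [diagOp_apply, hq] using this
  have h2 : inner ℂ e ((lam : ℂ) • q - K₀ q) = 0 := by
    rw [inner_sub_right, h.inner_eq, inner_smul_right, sub_self]
  -- Since `(lam - K₀) q` is orthogonal to `e`, the unknown multiple `c • e` only increases the norm
  -- of `v`.
  have h3 : ‖(lam : ℂ) • q - K₀ q‖ ≤ ‖v‖ := by
    have h4 : v = ((lam : ℂ) • q - K₀ q) + (-c) • e := by rw [hv]; simp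
    have h5 : inner ℂ ((lam : ℂ) • q - K₀ q) ((-c) • e) = 0 := by
      rw [inner_smul_right, ← inner_conj_symm, h2, map_zero, mul_zero]
    have h6 := norm_add_sq_eq_norm_sq_add_norm_sq_of_inner_eq_zero _ _ h5
    rw [← h4] at h6
    nlinarith [norm_nonneg v, norm_nonneg ((lam : ℂ) • q - K₀ q), mul_self_nonneg ‖(-c) • e‖]
  calc ‖q‖ = ‖G ((lam : ℂ) • q - K₀ q)‖ := by rw [h1]
    _ ≤ M * ‖(lam : ℂ) • q - K₀ q‖ := ContinuousLinearMap.le_of_opNorm_le _ hM _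
    _ ≤ M * ‖v‖ := by gcongr

/-- The part `q` of `φ` orthogonal to `e` solves `(lam - K₀) q = (lam - s) q + (K - K₀) φ` modulo
`e`. The gap makes `q` small, so the unit vector `φ` is mostly along `e`. -/
theorem norm_inner_ge (h : IsGapped K₀ e lam lam G) (hM : ‖G‖ ≤ M) (hK : ‖K - K₀‖ ≤ ε)
    (hε : M * ε ≤ 1 / 16) (hs : M * ‖s - lam‖ ≤ 1 / 16) (hφ : ‖φ‖ = 1) (hφe : K φ = s • φ) :
    1 / 2 ≤ ‖inner ℂ e φ‖ := by
  set a : ℂ := inner ℂ e φ with ha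
  have hM0 : 0 ≤ M := (norm_nonneg _).trans hM
  set q := φ - a • e with hq
  have h0 : inner ℂ e q = 0 := by
    rw [hq, inner_sub_right, inner_smul_right, h.inner_self, mul_one, sub_self]
  have h1 : (lam : ℂ) • q - K₀ q = ((lam - s) • q + (K - K₀) φ) + ((lam - s) * a) • e := by
    simp only [hq, map_sub, map_smul, h.apply_eq, _root_.sub_apply, hφe]
    module
  have h2 := h.norm_le hM h0 h1
  have h3 : ‖(lam - s) • q + (K - K₀) φ‖ ≤ ‖s - lam‖ * ‖q‖ + ε := by
    refine (norm_add_le _ _).trans (add_le_add ?_ ?_)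
    · rw [norm_smul, norm_sub_rev]
    · simpa [hφ] using ContinuousLinearMap.le_of_opNorm_le _ hK φ
  have h4 : ‖q‖ ≤ 1 / 8 := by
    have : ‖q‖ ≤ M * (‖s - lam‖ * ‖q‖ + ε) := h2.trans (by gcongr)
    nlinarith [norm_nonneg q]
  have h5 : ‖φ‖ ≤ ‖q‖ + ‖a‖ := by
    have : φ = q + a • e := by rw [hq]; abel
    calc ‖φ‖ = ‖q + a • e‖ := by rw [← this]
      _ ≤ _ := (norm_add_le _ _).trans (by rw [norm_smul, h.norm_eq, mul_one])
  linarith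

/-- Eigenpairs near a gapped eigenvalue depend on the operator in a Lipschitz way. -/
theorem lipschitz (h : IsGapped K₀ e lam lam G) (hM : ‖G‖ ≤ M) (hK : ‖K - K₀‖ ≤ ε)
    (hK' : ‖K' - K₀‖ ≤ ε) (hKK : ‖K - K'‖ ≤ η)
    (hε : M * ε ≤ 1 / 16) (hs : M * ‖s - lam‖ ≤ 1 / 16) (hs' : M * ‖s' - lam‖ ≤ 1 / 16)
    (hφ : ‖φ‖ = 1) (hφ' : ‖φ'‖ = 1) (hφe : K φ = s • φ) (hφe' : K' φ' = s' • φ') :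
    ‖s - s'‖ ≤ 7 * η ∧
      ‖(inner ℂ e φ' : ℂ) • φ - (inner ℂ e φ : ℂ) • φ'‖ ≤ 10 * M * η := by
  have ha2 := h.norm_inner_ge hM hK hε hs hφ hφe
  have ha2' := h.norm_inner_ge hM hK' hε hs' hφ' hφe'
  set a : ℂ := inner ℂ e φ with ha
  set a' : ℂ := inner ℂ e φ' with ha'
  have hM0 : 0 ≤ M := (norm_nonneg _).trans hM
  have hη0 : 0 ≤ η := (norm_nonneg _).trans hKK
  have ha1 : ‖a‖ ≤ 1 := by simpa [h.norm_eq, hφ] using norm_inner_le_norm (𝕜 := ℂ) e φ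
  have ha1' : ‖a'‖ ≤ 1 := by simpa [h.norm_eq, hφ'] using norm_inner_le_norm (𝕜 := ℂ) e φ'
  -- This combination has no component along `e`, so the lower bound on the complement applies;
  -- neither the phases nor the lengths of the components `a`, `a'` have to be matched beforehand.
  set ψ := a' • φ - a • φ' with hψ
  have h0 : inner ℂ e ψ = 0 := by
    rw [hψ, inner_sub_right, inner_smul_right, inner_smul_right, ← ha, ← ha']
    ring
  have h1 : (lam : ℂ) • ψ - K₀ ψ =
      (lam - s) • ψ + (K - K₀) ψ - ((s - s') * a) • φ' + a • (K - K') φ' := by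
    simp only [hψ, map_sub, map_smul, _root_.sub_apply, hφe, hφe']
    module
  have hE : ‖(K - K₀) ψ‖ ≤ ε * ‖ψ‖ := ContinuousLinearMap.le_of_opNorm_le _ hK ψ
  have hE' : ‖(K - K') φ'‖ ≤ η := by
    simpa [hφ'] using ContinuousLinearMap.le_of_opNorm_le _ hKK φ'
  -- Pairing `h1` with `e` kills the left side and leaves `(s - s') a a'`, where `|a|` and `|a'|`
  -- are at least `1/2`.
  have hss : ‖s - s'‖ ≤ 4 * (ε * ‖ψ‖ + η) := by
    have h2 := congrArg (fun v => inner ℂ e v) h1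
    simp only [inner_sub_right, inner_add_right, inner_smul_right, h.inner_eq, h0] at h2
    have h3 : (s - s') * a * a' = inner ℂ e ((K - K₀) ψ) + a * inner ℂ e ((K - K') φ') := by
      rw [ha']
      linear_combination h2
    have h4 : ‖s - s'‖ * ‖a‖ * ‖a'‖ ≤ ε * ‖ψ‖ + η := by
      rw [← norm_mul, ← norm_mul, h3]
      refine (norm_add_le _ _).trans (add_le_add ?_ ?_)
      · exact (norm_inner_le_norm _ _).trans (by rw [h.norm_eq, one_mul]; exact hE)
      · rw [norm_mul]
        refine (mul_le_of_le_one_left (norm_nonneg _) ha1).trans ?_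
        exact (norm_inner_le_norm _ _).trans (by rw [h.norm_eq, one_mul]; exact hE')
    have h5 : ‖s - s'‖ * (1 / 2) * (1 / 2) ≤ ‖s - s'‖ * ‖a‖ * ‖a'‖ := by gcongr
    linarith
  -- The terms in `‖ψ‖` on the right have total factor `M (‖s - lam‖ + 5 ε) ≤ 3/8` and are absorbed;
  -- what is left is `5 M η`.
  have hψn : ‖ψ‖ ≤ 10 * M * η := by
    have h2 := h.norm_le hM (c := 0) h0 (by rw [h1, zero_smul, add_zero])
    have h3 : ‖(lam - s) • ψ + (K - K₀) ψ - ((s - s') * a) • φ' + a • (K - K') φ'‖ ≤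
        ‖s - lam‖ * ‖ψ‖ + ε * ‖ψ‖ + 4 * (ε * ‖ψ‖ + η) + η := by
      refine (norm_add_le _ _).trans (add_le_add ((norm_sub_le _ _).trans (add_le_add
        ((norm_add_le _ _).trans (add_le_add ?_ hE)) ?_)) ?_)
      · rw [norm_smul, norm_sub_rev]
      · rw [norm_smul, norm_mul, hφ', mul_one]
        exact (mul_le_of_le_one_right (norm_nonneg _) ha1).trans hss
      · rw [norm_smul]
        exact (mul_le_of_le_one_left (norm_nonneg _) ha1).trans hE'
    have h4 := h2.trans (mul_le_mul_of_nonneg_left h3 hM0)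
    nlinarith [norm_nonneg ψ, mul_nonneg hM0 hη0]
  refine ⟨?_, hψn⟩
  have hε0 : 0 ≤ ε := (norm_nonneg _).trans hK
  have : ε * ‖ψ‖ ≤ ε * (10 * M * η) := by gcongr
  nlinarith

/-- With the phase fixed by `⟨e, φ⟩ > 0`, the eigenvectors are Lipschitz in the operator. -/
theorem lipschitz_of_pos (h : IsGapped K₀ e lam lam G) (hM : ‖G‖ ≤ M) (hK : ‖K - K₀‖ ≤ ε)
    (hK' : ‖K' - K₀‖ ≤ ε) (hKK : ‖K - K'‖ ≤ η)
    (hε : M * ε ≤ 1 / 16) (hs : M * ‖s - lam‖ ≤ 1 / 16) (hs' : M * ‖s' - lam‖ ≤ 1 / 16)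
    (hφ : ‖φ‖ = 1) (hφ' : ‖φ'‖ = 1) (hφe : K φ = s • φ) (hφe' : K' φ' = s' • φ')
    (hpos : inner ℂ e φ = (‖(inner ℂ e φ : ℂ)‖ : ℂ))
    (hpos' : inner ℂ e φ' = (‖(inner ℂ e φ' : ℂ)‖ : ℂ)) :
    ‖φ - φ'‖ ≤ 40 * M * η := by
  have ha2 := h.norm_inner_ge hM hK' hε hs' hφ' hφe'
  have h1 := (h.lipschitz hM hK hK' hKK hε hs hs' hφ hφ' hφe hφe').2
  rw [hpos, hpos'] at h1
  set a : ℝ := ‖(inner ℂ e φ : ℂ)‖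
  set a' : ℝ := ‖(inner ℂ e φ' : ℂ)‖
  -- The vectors `a' • φ` and `a • φ'` have norms `a'` and `a`, so the bound on their difference
  -- also compares these numbers. Dividing the sum of both errors by `a' ≥ 1/2` gives the `40`.
  have h2 : |a' - a| ≤ 10 * M * η := by
    have := abs_norm_sub_norm_le ((a' : ℂ) • φ) ((a : ℂ) • φ')
    rw [norm_smul, norm_smul, hφ, hφ', Complex.norm_real, Complex.norm_real, mul_one, mul_one,
      norm_norm, norm_norm] at this
    exact this.trans h1
  have h3 : (a' : ℂ) • (φ - φ') = ((a' : ℂ) • φ - (a : ℂ) • φ') + ((a - a' : ℝ) : ℂ) • φ' := by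
    push_cast
    module
  have h4 : a' * ‖φ - φ'‖ ≤ 10 * M * η + 10 * M * η := by
    have h5 : ‖(a' : ℂ) • (φ - φ')‖ = a' * ‖φ - φ'‖ := by
      rw [norm_smul, Complex.norm_real, norm_norm]
    rw [← h5, h3]
    refine (norm_add_le _ _).trans (add_le_add h1 ?_)
    rw [norm_smul, hφ', mul_one, Complex.norm_real, Real.norm_eq_abs, abs_sub_comm]
    exact h2
  nlinarith [norm_nonneg (φ - φ')]

/-- Operators near a gapped one have an eigenvalue near the gapped eigenvalue. -/
theorem exists_eigenpair [CompleteSpace H] (h : IsGapped K₀ e lam lam G)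
    (hM : ‖G‖ ≤ M) (hε0 : 0 < ε) (hK : ‖K - K₀‖ ≤ ε) (hε : M * ε ≤ 1 / 192)
    (hεl : 12 * ε < |lam|) :
    ∃ (s : ℂ) (φ : H), ‖φ‖ = 1 ∧ K φ = s • φ ∧ ‖s - lam‖ ≤ 12 * ε ∧
      inner ℂ e φ = (‖(inner ℂ e φ : ℂ)‖ : ℂ) := by
  have hM0 : 0 ≤ M := (norm_nonneg _).trans hM
  set w : Fin 1 → H := fun _ => e with hw
  set l : Fin 1 → ℂ := fun _ => (lam : ℂ) with hl
  set D : H →L[ℂ] H := K₀ - diagOp w l with hDdef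
  have hwo : Orthonormal ℂ w := ⟨fun _ => h.norm_eq, fun i j hij => (hij (Subsingleton.elim _ _)).elim⟩
  have hD : ∀ i, D (w i) = 0 := fun i => by
    simp [hDdef, diagOp_apply, hw, hl, h.apply_eq, h.norm_eq]
  have hD' : ∀ i u, inner ℂ (w i) (D u) = 0 := fun i u => by
    simp [hDdef, diagOp_apply, hw, hl, h.inner_eq, h.norm_eq]
  have hun : ∀ s ∈ Metric.closedBall (lam : ℂ) (12 * ε),
      IsUnit (schurOp w D (K - K₀) s) ∧ ‖Ring.inverse (schurOp w D (K - K₀) s)‖ ≤ 2 * M :=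
    fun s hs => by
      refine isUnit_schurOp hwo h.mul_eq h.eq_mul hM ?_ ?_
      · have := mul_le_mul_of_nonneg_left (mem_closedBall_iff_norm.1 hs) hM0
        linarith
      · have := mul_le_mul_of_nonneg_left hK hM0
        linarith
  -- The radius in `exists_det_eq_zero_near` for one mode and a perturbation of size `2ε`: one `ε`
  -- for `⟨e, (K - K₀) e⟩`, the other to cover the second order term `2 M ε²`.
  have hrad : 3 * (((1 : ℕ) : ℝ) + 1) * ((1 : ℕ) : ℝ) ^ 2 * (2 * ε) = 12 * ε := by
    push_cast; ring
  have hA : (Matrix.diagonal l).IsHermitian := by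
    simp [Matrix.IsHermitian, Matrix.diagonal_conjTranspose, hl, Pi.star_def]
  obtain ⟨s, hs, hdet⟩ := exists_det_eq_zero_near hA (ε := 2 * ε) (by positivity)
    (E₁ := 0) (s₀ := lam) (fun i j => by simp; positivity)
    (by simp [Matrix.smul_one_eq_diagonal, hl])
    (E := fun s => schurMatrix w l D (K - K₀) s - Matrix.diagonal l)
    (by
      rw [hrad]
      exact (continuousOn_schurMatrix w l D continuousOn_const fun s hs => (hun s hs).1).sub
        continuousOn_const)
    (fun s hs i j => by
      rw [hrad] at hs
      have h1 := norm_schurMatrix_sub_le hwo l D (K - K₀) s (hun s hs).2 i j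
      have h2 : ‖inner ℂ (w i) ((K - K₀) (w j))‖ ≤ ε := by
        refine (norm_inner_le_norm _ _).trans ?_
        simpa [hw, h.norm_eq] using ContinuousLinearMap.le_of_opNorm_le _ hK e
      have h3 : 2 * M * ‖K - K₀‖ ^ 2 ≤ 2 * M * ε ^ 2 := by gcongr
      have h4 : schurMatrix w l D (K - K₀) s i j - Matrix.diagonal l i j =
          (schurMatrix w l D (K - K₀) s i j -
            (Matrix.diagonal l i j + inner ℂ (w i) ((K - K₀) (w j)))) +
            inner ℂ (w i) ((K - K₀) (w j)) := by ring
      rw [Matrix.sub_apply, h4]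
      refine (norm_add_le _ _).trans ?_
      nlinarith)
  rw [hrad] at hs
  have hs' : ‖s - lam‖ ≤ 12 * ε := mem_closedBall_iff_norm.1 hs
  have hs0 : s ≠ 0 := by
    rintro rfl
    rw [zero_sub, norm_neg, Complex.norm_real, Real.norm_eq_abs] at hs'
    linarith
  have hdet' : (s • (1 : Matrix (Fin 1) (Fin 1) ℂ) - schurMatrix w l D (K - K₀) s).det = 0 := by
    rw [← hdet]
    congr 1
    abel
  obtain ⟨u, hu, hue⟩ :=
    (exists_eigenvector_iff_det_schurMatrix hwo hD hD' hs0 (hun s hs).1).2 hdet'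
  have hKu : K u = s • u := by
    rw [← hue, hDdef]
    simp
  have hu0 : ‖u‖ ≠ 0 := norm_ne_zero_iff.2 hu
  have hv : ‖((‖u‖ : ℂ)⁻¹ • u)‖ = 1 := by
    rw [norm_smul, norm_inv, Complex.norm_real, norm_norm, inv_mul_cancel₀ hu0]
  have hKv : K ((‖u‖ : ℂ)⁻¹ • u) = s • ((‖u‖ : ℂ)⁻¹ • u) := by
    rw [map_smul, hKu, smul_comm]
  have hin := h.norm_inner_ge hM hK (by linarith)
    (by have := mul_le_mul_of_nonneg_left hs' hM0; linarith) hv hKv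
  obtain ⟨c, hc, hcz⟩ := exists_phase (z := inner ℂ e ((‖u‖ : ℂ)⁻¹ • u))
    (norm_pos_iff.1 (by linarith))
  refine ⟨s, c • ((‖u‖ : ℂ)⁻¹ • u), by rw [norm_smul, hc, hv, mul_one],
    by rw [map_smul, hKv, smul_comm], hs', ?_⟩
  rw [inner_smul_right, hcz, Complex.norm_real, norm_norm]

/-- The eigenpair near a gapped eigenvalue is unique up to a phase. -/
theorem unique (h : IsGapped K₀ e lam lam G) (hM : ‖G‖ ≤ M) (hK : ‖K - K₀‖ ≤ ε)
    (hε : M * ε ≤ 1 / 16) (hs : M * ‖s - lam‖ ≤ 1 / 16) (hs' : M * ‖s' - lam‖ ≤ 1 / 16)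
    (hφ : ‖φ‖ = 1) (hφ' : ‖φ'‖ = 1) (hφe : K φ = s • φ) (hφe' : K φ' = s' • φ') :
    s' = s ∧ ∃ c : ℂ, ‖c‖ = 1 ∧ φ' = c • φ := by
  have h1 := h.lipschitz hM hK hK (η := 0) (by simp) hε hs hs' hφ hφ' hφe hφe'
  have ha := h.norm_inner_ge hM hK hε hs hφ hφe
  rw [mul_zero, mul_zero, norm_le_zero_iff, norm_le_zero_iff, sub_eq_zero, sub_eq_zero] at h1
  set a : ℂ := inner ℂ e φ
  have ha0 : a ≠ 0 := norm_pos_iff.1 (by linarith)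
  have h2 : φ' = (a⁻¹ * inner ℂ e φ') • φ := by
    rw [mul_smul, h1.2, smul_smul, inv_mul_cancel₀ ha0, one_smul]
  refine ⟨h1.1.symm, _, ?_, h2⟩
  have := congrArg norm h2
  rwa [norm_smul, hφ, hφ', mul_one, eq_comm] at this

end IsGapped

end Resonators
end

/-! ### Hilbert sums, block operators and families of modes. -/

noncomputable section
namespace Resonators
open Complex Set

section Block

variable {n : ℕ} {H : Fin n → Type*} [∀ i, NormedAddCommGroup (H i)]
  [∀ i, InnerProductSpace ℂ (H i)]

/-- The Hilbert sum of a finite family. -/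
def HilbertSum {n : ℕ} (H : Fin n → Type*) [∀ i, NormedAddCommGroup (H i)] : Type _ := PiLp 2 H

instance : NormedAddCommGroup (HilbertSum H) := inferInstanceAs (NormedAddCommGroup (PiLp 2 H))

instance : InnerProductSpace ℂ (HilbertSum H) := inferInstanceAs (InnerProductSpace ℂ (PiLp 2 H))

instance [∀ i, CompleteSpace (H i)] : CompleteSpace (HilbertSum H) :=
  inferInstanceAs (CompleteSpace (PiLp 2 H))

/-- The isometric inclusion of a summand in the Hilbert sum. -/
def incl (i : Fin n) : H i →L[ℂ] HilbertSum H :=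
  LinearMap.mkContinuous
    { toFun := fun x => (PiLp.single 2 i x : PiLp 2 H)
      map_add' := fun x y => PiLp.single_add 2 i
      map_smul' := fun c x => by
        change (PiLp.single 2 i (c • x) : PiLp 2 H) = c • PiLp.single 2 i x
        ext j
        by_cases hj : j = i
        · subst hj; simp
        · simp [Pi.single_eq_of_ne hj] } 1
    fun x => by
      rw [one_mul]
      exact (PiLp.norm_single 2 H i x).le

/-- The projection of the Hilbert sum on a summand. -/
def prj (i : Fin n) : HilbertSum H →L[ℂ] H i :=
  LinearMap.mkContinuous
    { toFun := fun u => (show PiLp 2 H from u) i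
      map_add' := fun _ _ => rfl
      map_smul' := fun _ _ => rfl } 1
    fun u => by
      rw [one_mul]
      exact PiLp.norm_apply_le (show PiLp 2 H from u) i

theorem norm_prj_le (i : Fin n) : ‖(prj i : HilbertSum H →L[ℂ] H i)‖ ≤ 1 :=
  LinearMap.mkContinuous_norm_le _ zero_le_one _

theorem norm_incl_apply (i : Fin n) (x : H i) : ‖incl i x‖ = ‖x‖ := PiLp.norm_single 2 H i x

theorem prj_incl_self (i : Fin n) (x : H i) : prj i (incl i x) = x := by
  change (PiLp.single 2 i x : PiLp 2 H) i = x
  simp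

theorem prj_incl_of_ne {i j : Fin n} (h : i ≠ j) (x : H j) : prj i (incl j x) = 0 := by
  change (PiLp.single 2 j x : PiLp 2 H) i = 0
  simp [Pi.single_eq_of_ne h]

theorem HilbertSum.ext_prj {u v : HilbertSum H} (h : ∀ i, prj i u = prj i v) : u = v :=
  PiLp.ext h

/-- The element of the Hilbert sum with given components. -/
def HilbertSum.mk (u : ∀ i, H i) : HilbertSum H := WithLp.toLp 2 u

theorem HilbertSum.prj_mk (u : ∀ i, H i) (i : Fin n) : prj i (HilbertSum.mk u) = u i := rfl

theorem inner_incl (i : Fin n) (x : H i) (u : HilbertSum H) :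
    inner ℂ (incl i x) u = inner ℂ x (prj i u) := by
  change inner ℂ (PiLp.single 2 i x : PiLp 2 H) (show PiLp 2 H from u) = _
  rw [PiLp.inner_apply, Finset.sum_eq_single i]
  · simp [prj]
    rfl
  · intro j _ hj
    simp [Pi.single_eq_of_ne hj]
  · simp

/-- The operator on the Hilbert sum with blocks `T i j`. -/
def blockOp (T : ∀ i j, H j →L[ℂ] H i) : HilbertSum H →L[ℂ] HilbertSum H :=
  ∑ i, ∑ j, incl i ∘L T i j ∘L prj j

theorem prj_blockOp (T : ∀ i j, H j →L[ℂ] H i) (u : HilbertSum H) (i : Fin n) :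
    prj i (blockOp T u) = ∑ j, T i j (prj j u) := by
  simp only [blockOp, _root_.sum_apply, map_sum, ContinuousLinearMap.comp_apply]
  rw [Finset.sum_eq_single i (fun k _ hk => Finset.sum_eq_zero fun j _ => by
    rw [prj_incl_of_ne (Ne.symm hk)]) (by simp)]
  simp only [prj_incl_self]

theorem norm_blockOp_le (T : ∀ i j, H j →L[ℂ] H i) {c : ℝ} (hc : 0 ≤ c)
    (hT : ∀ i j, ‖T i j‖ ≤ c) : ‖blockOp T‖ ≤ n ^ 2 * c := by
  calc ‖blockOp T‖ ≤ ∑ i : Fin n, ∑ j : Fin n, c := by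
        refine (norm_sum_le _ _).trans (Finset.sum_le_sum fun i _ => (norm_sum_le _ _).trans
          (Finset.sum_le_sum fun j _ => ?_))
        refine ContinuousLinearMap.opNorm_le_bound _ hc fun u => ?_
        rw [ContinuousLinearMap.comp_apply, norm_incl_apply]
        refine (ContinuousLinearMap.le_of_opNorm_le _ (hT i j) _).trans ?_
        gcongr
        simpa using ContinuousLinearMap.le_of_opNorm_le _ (norm_prj_le j) u
    _ = n ^ 2 * c := by simp; ring

theorem continuousOn_blockOp {T : ℂ → ∀ i j, H j →L[ℂ] H i} {S : Set ℂ}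
    (hT : ∀ i j, ContinuousOn (fun s => T s i j) S) : ContinuousOn (fun s => blockOp (T s)) S :=
  continuousOn_finsetSum _ fun i _ => continuousOn_finsetSum _ fun j _ =>
    continuousOn_const.clm_comp ((hT i j).clm_comp continuousOn_const)

/-- The block diagonal family. -/
def diagFamily (K : ∀ i, H i →L[ℂ] H i) : ∀ i j, H j →L[ℂ] H i := fun i j =>
  if h : j = i then h ▸ K j else 0

theorem diagFamily_self (K : ∀ i, H i →L[ℂ] H i) (i : Fin n) : diagFamily K i i = K i := by
  simp [diagFamily]

theorem diagFamily_of_ne (K : ∀ i, H i →L[ℂ] H i) {i j : Fin n} (h : i ≠ j) :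
    diagFamily K i j = 0 := by
  simp [diagFamily, Ne.symm h]

theorem prj_blockOp_diagFamily (K : ∀ i, H i →L[ℂ] H i) (u : HilbertSum H) (i : Fin n) :
    prj i (blockOp (diagFamily K) u) = K i (prj i u) := by
  rw [prj_blockOp, Finset.sum_eq_single i (fun j _ hj => by
    rw [diagFamily_of_ne K (Ne.symm hj)]; simp) (by simp), diagFamily_self]

/-- Unperturbed operators with gapped modes, and leading order interactions. -/
structure IsModeFamily (K : ∀ i, H i →L[ℂ] H i) (e : ∀ i, H i) (lam : Fin n → ℝ)
    (R : ∀ i j, H j →L[ℂ] H i) (M C : ℝ) : Prop where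
  M_pos : 0 < M
  C_pos : 0 < C
  lam_ne : ∀ i, lam i ≠ 0
  gapped : ∀ i j, ∃ G, ‖G‖ ≤ M ∧ IsGapped (K j) (e j) (lam j) (lam i) G
  herm : ∀ i j, (starRingEnd ℂ) (inner ℂ (e i) (R i j (e j))) = inner ℂ (e j) (R j i (e i))
  norm_le : ∀ i j, ‖R i j‖ ≤ C

/-- The family `T` is `O(ρ²)`-close to the diagonal `K` with interactions `ρ R`. -/
def IsNear (K : ∀ i, H i →L[ℂ] H i) (R T : ∀ i j, H j →L[ℂ] H i) (C ρ : ℝ) : Prop :=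
  ∀ i j, ‖T i j - (if i = j then diagFamily K i j else (ρ : ℂ) • R i j)‖ ≤ C * ρ ^ 2

/-- The matrix of the leading order problem. -/
def effMatrix (e : ∀ i, H i) (lam : Fin n → ℝ) (R : ∀ i j, H j →L[ℂ] H i) (ρ : ℝ) :
    Matrix (Fin n) (Fin n) ℂ :=
  Matrix.of fun i j => if i = j then (lam i : ℂ) else ρ * inner ℂ (e i) (R i j (e j))

/-- The matrix of the operators `T i j` in the modes `φ i` with eigenvalues `μ i`. -/
def modeMatrix (T : ∀ i j, H j →L[ℂ] H i) (μ : Fin n → ℂ) (φ : ∀ i, H i) :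
    Matrix (Fin n) (Fin n) ℂ :=
  Matrix.of fun i j => if i = j then μ i else inner ℂ (φ i) (T i j (φ j))

/-- `(μ, φ)` is a unit eigenpair of `K` at distance at most `r` from `lam`. -/
def IsUnitPair {V : Type*} [NormedAddCommGroup V] [InnerProductSpace ℂ V] (K : V →L[ℂ] V)
    (lam r : ℝ) (μ : ℂ) (φ : V) : Prop :=
  ‖φ‖ = 1 ∧ K φ = μ • φ ∧ ‖μ - lam‖ ≤ r

namespace IsModeFamily

variable {K : ∀ i, H i →L[ℂ] H i} {e : ∀ i, H i} {lam : Fin n → ℝ}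
  {R T : ∀ i j, H j →L[ℂ] H i} {M C ρ : ℝ}

theorem isHermitian_effMatrix (h : IsModeFamily K e lam R M C) :
    (effMatrix e lam R ρ).IsHermitian := by
  ext i j
  simp only [effMatrix, Matrix.conjTranspose_apply, Matrix.of_apply]
  by_cases hij : i = j
  · subst hij; simp
  · rw [if_neg hij, if_neg (Ne.symm hij), ← h.herm j i]
    simp

theorem orthonormal (h : IsModeFamily K e lam R M C) :
    Orthonormal ℂ fun i => (incl i (e i) : HilbertSum H) := by
  refine ⟨fun i => ?_, fun i j hij => ?_⟩
  · obtain ⟨G, -, hG⟩ := h.gapped i i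
    change ‖incl i (e i)‖ = 1
    rw [norm_incl_apply, hG.norm_eq]
  · simp only [inner_incl, prj_incl_of_ne hij, inner_zero_right]

end IsModeFamily

theorem prj_blockOp_incl (T : ∀ i j, H j →L[ℂ] H i) (j : Fin n) (x : H j) (i : Fin n) :
    prj i (blockOp T (incl j x)) = T i j x := by
  rw [prj_blockOp, Finset.sum_eq_single j]
  · rw [prj_incl_self]
  · intro k _ hk
    rw [prj_incl_of_ne hk, map_zero]
  · simp

/-- The family with the modes removed. -/
def deflated (K : ∀ i, H i →L[ℂ] H i) (e : ∀ i, H i) (lam : Fin n → ℝ) (i : Fin n) :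
    H i →L[ℂ] H i :=
  K i - diagOp (fun _ : Fin 1 => e i) fun _ => (lam i : ℂ)

namespace IsModeFamily

variable {K : ∀ i, H i →L[ℂ] H i} {e : ∀ i, H i} {lam : Fin n → ℝ}
  {R T : ∀ i j, H j →L[ℂ] H i} {M C ρ : ℝ}

theorem deflated_incl (h : IsModeFamily K e lam R M C) (i : Fin n) :
    blockOp (diagFamily (deflated K e lam)) (incl i (e i)) = 0 := by
  obtain ⟨G, -, hG⟩ := h.gapped i i
  refine HilbertSum.ext_prj fun j => ?_
  rw [prj_blockOp_incl, map_zero]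
  by_cases hij : j = i
  · subst hij
    simp [diagFamily_self, deflated, diagOp_apply, hG.apply_eq, hG.norm_eq]
  · simp [diagFamily_of_ne _ hij]

theorem inner_incl_deflated (h : IsModeFamily K e lam R M C) (i : Fin n) (u : HilbertSum H) :
    inner ℂ (incl i (e i)) (blockOp (diagFamily (deflated K e lam)) u) = 0 := by
  obtain ⟨G, -, hG⟩ := h.gapped i i
  rw [inner_incl, prj_blockOp_diagFamily]
  simp [deflated, diagOp_apply, hG.inner_eq, hG.norm_eq]

/-- Brings the block operator into the form `D + ∑ λ_i w_i ⊗ w_i + X` to which the Schur complement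
applies. -/
theorem blockOp_eq (K : ∀ i, H i →L[ℂ] H i) (e : ∀ i, H i) (lam : Fin n → ℝ)
    (T : ∀ i j, H j →L[ℂ] H i) :
    blockOp (diagFamily (deflated K e lam)) +
      diagOp (fun i => incl i (e i)) (fun i => (lam i : ℂ)) + blockOp (T - diagFamily K) =
    blockOp T := by
  refine ContinuousLinearMap.ext fun u => HilbertSum.ext_prj fun i => ?_
  simp only [_root_.add_apply, map_add, prj_blockOp_diagFamily]
  have h1 : prj i (blockOp (T - diagFamily K) u) = prj i (blockOp T u) - K i (prj i u) := by
    rw [← prj_blockOp_diagFamily K u i]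
    simp only [prj_blockOp, Pi.sub_apply, _root_.sub_apply, Finset.sum_sub_distrib]
  have h2 : prj i (diagOp (fun i => (incl i (e i) : HilbertSum H)) (fun i => (lam i : ℂ)) u) =
      ((lam i : ℂ) * inner ℂ (e i) (prj i u)) • e i := by
    rw [diagOp_apply, map_sum, Finset.sum_eq_single i]
    · rw [map_smul, inner_incl, prj_incl_self]
    · intro j _ hj
      rw [map_smul, prj_incl_of_ne (Ne.symm hj), smul_zero]
    · simp
  rw [h1, h2]
  simp [deflated, diagOp_apply]

/-- All deflated blocks have to be inverted at the same number `lam i`; this is why `gapped` is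
required for every pair of indices and not only on the diagonal. -/
theorem exists_inverse (h : IsModeFamily K e lam R M C) (i : Fin n) :
    ∃ G : HilbertSum H →L[ℂ] HilbertSum H, ‖G‖ ≤ n ^ 2 * M ∧
      ((lam i : ℂ) • 1 - blockOp (diagFamily (deflated K e lam))) * G = 1 ∧
      G * ((lam i : ℂ) • 1 - blockOp (diagFamily (deflated K e lam))) = 1 := by
  choose G hGM hG using h.gapped i
  refine ⟨blockOp (diagFamily G), norm_blockOp_le _ h.M_pos.le fun j k => ?_, ?_, ?_⟩
  · by_cases hjk : j = k
    · subst hjk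
      rw [diagFamily_self]
      exact hGM j
    · rw [diagFamily_of_ne _ hjk, norm_zero]
      exact h.M_pos.le
  · refine ContinuousLinearMap.ext fun u => HilbertSum.ext_prj fun j => ?_
    have := congrArg (fun f : H j →L[ℂ] H j => f (prj j u)) (hG j).mul_eq
    simpa [prj_blockOp_diagFamily, deflated] using this
  · refine ContinuousLinearMap.ext fun u => HilbertSum.ext_prj fun j => ?_
    have := congrArg (fun f : H j →L[ℂ] H j => f (prj j u)) (hG j).eq_mul
    simpa [prj_blockOp_diagFamily, deflated] using this

end IsModeFamily

end Block

end Resonators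
end

/-! ### Comparison of the Schur complement and the mode matrix. -/

noncomputable section
namespace Resonators
open Complex Set

section Modes

variable {n : ℕ} {H : Fin n → Type*} [∀ i, NormedAddCommGroup (H i)]
  [∀ i, InnerProductSpace ℂ (H i)]

/-- Changing the phases conjugates the matrix by a diagonal unitary, so the determinant does not
depend on the choice of normalised eigenvectors. -/
theorem det_modeMatrix_phase (T : ∀ i j, H j →L[ℂ] H i) (μ : Fin n → ℂ) (φ : ∀ i, H i)
    {c : Fin n → ℂ} (hc : ∀ i, ‖c i‖ = 1) (s : ℂ) :
    (s • (1 : Matrix (Fin n) (Fin n) ℂ) - modeMatrix T μ fun i => c i • φ i).det =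
      (s • (1 : Matrix (Fin n) (Fin n) ℂ) - modeMatrix T μ φ).det := by
  have hcc : ∀ i, (starRingEnd ℂ) (c i) * c i = 1 := fun i => by
    rw [mul_comm, Complex.mul_conj, Complex.normSq_eq_norm_sq, hc]; simp
  have h1 : s • (1 : Matrix (Fin n) (Fin n) ℂ) - modeMatrix T μ (fun i => c i • φ i) =
      Matrix.diagonal (fun i => (starRingEnd ℂ) (c i)) *
        (s • (1 : Matrix (Fin n) (Fin n) ℂ) - modeMatrix T μ φ) * Matrix.diagonal c := by
    ext i j
    rw [Matrix.mul_diagonal, Matrix.diagonal_mul]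
    by_cases hij : i = j
    · subst hij
      simp only [modeMatrix, Matrix.sub_apply, Matrix.smul_apply, Matrix.one_apply_eq,
        Matrix.of_apply, if_true]
      linear_combination (-(s • (1 : ℂ) - μ i)) * hcc i
    · simp only [modeMatrix, Matrix.sub_apply, Matrix.smul_apply, Matrix.one_apply_ne hij,
        Matrix.of_apply, if_neg hij, map_smul, inner_smul_left, inner_smul_right]
      simp
      ring
  rw [h1, Matrix.det_mul, Matrix.det_mul, Matrix.det_diagonal, Matrix.det_diagonal, mul_right_comm,
    ← Finset.prod_mul_distrib]
  simp [hcc]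

variable {K : ∀ i, H i →L[ℂ] H i} {e : ∀ i, H i} {lam : Fin n → ℝ}
  {R T : ∀ i j, H j →L[ℂ] H i} {M C ρ : ℝ}

theorem IsNear.norm_sub_le (hT : IsNear K R T C ρ) (i : Fin n) :
    ‖T i i - K i‖ ≤ C * ρ ^ 2 := by
  simpa [diagFamily_self] using hT i i

theorem IsNear.norm_sub_le_of_ne (hT : IsNear K R T C ρ) {i j : Fin n} (hij : i ≠ j) :
    ‖T i j - (ρ : ℂ) • R i j‖ ≤ C * ρ ^ 2 := by
  simpa [hij] using hT i j

theorem continuousOn_of_norm_sub_le {X V W : Type*} [TopologicalSpace X]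
    [SeminormedAddCommGroup V] [SeminormedAddCommGroup W] {f : X → V} {g : X → W} {S : Set X}
    {c : ℝ} (hg : ContinuousOn g S)
    (hf : ∀ s ∈ S, ∀ t ∈ S, ‖f s - f t‖ ≤ c * ‖g s - g t‖) : ContinuousOn f S := fun s hs => by
  have h1 := hg s hs
  rw [ContinuousWithinAt, tendsto_iff_norm_sub_tendsto_zero] at h1 ⊢
  refine squeeze_zero' (Filter.Eventually.of_forall fun _ => norm_nonneg _) ?_
    (by simpa using h1.const_mul c)
  filter_upwards [self_mem_nhdsWithin] with t ht using hf t ht s hs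

namespace IsModeFamily

theorem norm_e (h : IsModeFamily K e lam R M C) (i : Fin n) : ‖e i‖ = 1 := by
  obtain ⟨G, -, hG⟩ := h.gapped i i
  exact hG.norm_eq

theorem norm_blockOp_sub_le (h : IsModeFamily K e lam R M C) (hρ : 0 ≤ ρ) (hρ1 : ρ ≤ 1)
    (hT : IsNear K R T C ρ) : ‖blockOp (T - diagFamily K)‖ ≤ n ^ 2 * (2 * C * ρ) := by
  have hC := h.C_pos
  have hρ2 : ρ ^ 2 ≤ ρ := by nlinarith
  have hCρ : C * ρ ^ 2 ≤ C * ρ := by gcongr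
  refine norm_blockOp_le _ (by positivity) fun i j => ?_
  by_cases hij : i = j
  · subst hij
    have := hT.norm_sub_le i
    simp only [Pi.sub_apply, diagFamily_self]
    nlinarith
  · have h1 := hT.norm_sub_le_of_ne hij
    simp only [Pi.sub_apply, diagFamily_of_ne _ hij, sub_zero]
    have h2 : ‖(ρ : ℂ) • R i j‖ ≤ ρ * C := by
      rw [norm_smul, Complex.norm_real, Real.norm_of_nonneg hρ]
      exact mul_le_mul_of_nonneg_left (h.norm_le i j) hρ
    have h3 : T i j = (T i j - (ρ : ℂ) • R i j) + (ρ : ℂ) • R i j := by abel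
    rw [h3]
    refine (norm_add_le _ _).trans ?_
    linarith

/-- The Schur complement on the modes is the leading order matrix up to `O(ρ²)`. -/
theorem norm_schurMatrix_sub_effMatrix_le (h : IsModeFamily K e lam R M C) (hρ : 0 ≤ ρ)
    (hρ1 : ρ ≤ 1) (hT : IsNear K R T C ρ) {s : ℂ}
    (hs : ‖Ring.inverse (schurOp (fun i => (incl i (e i) : HilbertSum H))
      (blockOp (diagFamily (deflated K e lam))) (blockOp (T - diagFamily K)) s)‖ ≤
        2 * (n ^ 2 * M)) (i j : Fin n) :
    ‖(schurMatrix (fun i => (incl i (e i) : HilbertSum H)) (fun i => (lam i : ℂ))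
      (blockOp (diagFamily (deflated K e lam))) (blockOp (T - diagFamily K)) s -
        effMatrix e lam R ρ) i j‖ ≤ (C + 8 * n ^ 6 * M * C ^ 2) * ρ ^ 2 := by
  have hM := h.M_pos
  have hC := h.C_pos
  have h1 := norm_schurMatrix_sub_le h.orthonormal (fun i => (lam i : ℂ)) _ _ _ hs i j
  have hX := h.norm_blockOp_sub_le hρ hρ1 hT
  -- The square of `‖X‖ = O(ρ)` is the source of the constant `8 n⁶ M C²`.
  have h2 : 2 * (n ^ 2 * M) * ‖blockOp (T - diagFamily K)‖ ^ 2 ≤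
      2 * (n ^ 2 * M) * (n ^ 2 * (2 * C * ρ)) ^ 2 := by gcongr
  rw [inner_incl, prj_blockOp_incl] at h1
  have h3 : ‖(Matrix.diagonal (fun i => (lam i : ℂ)) i j +
      inner ℂ (e i) ((T - diagFamily K) i j (e j))) - effMatrix e lam R ρ i j‖ ≤ C * ρ ^ 2 := by
    have key : ∀ A : H j →L[ℂ] H i, ‖A‖ ≤ C * ρ ^ 2 →
        ‖(inner ℂ (e i) (A (e j)) : ℂ)‖ ≤ C * ρ ^ 2 := fun A hA => by
      refine (norm_inner_le_norm _ _).trans ?_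
      rw [h.norm_e, one_mul]
      simpa [h.norm_e] using ContinuousLinearMap.le_of_opNorm_le _ hA (e j)
    by_cases hij : i = j
    · subst hij
      have := key _ (by simpa [diagFamily_self] using hT i i)
      simpa [effMatrix, diagFamily_self] using this
    · have := key _ (hT.norm_sub_le_of_ne hij)
      simpa [effMatrix, hij, diagFamily_of_ne _ hij, inner_sub_right, inner_smul_right] using this
  rw [Matrix.sub_apply]
  refine (norm_sub_le_norm_sub_add_norm_sub _ (Matrix.diagonal (fun i => (lam i : ℂ)) i j +
      inner ℂ (e i) ((T - diagFamily K) i j (e j))) _).trans ?_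
  refine (add_le_add (h1.trans h2) h3).trans (le_of_eq ?_)
  ring

/-- The mode matrix is the leading order matrix up to `O(ρ²)`. -/
theorem norm_modeMatrix_sub_effMatrix_le (h : IsModeFamily K e lam R M C) (hρ : 0 ≤ ρ)
    (hρ1 : ρ ≤ 1) (hT : IsNear K R T C ρ) {μ : Fin n → ℂ} {φ : ∀ i, H i}
    (hμ : ∀ i, ‖μ i - lam i‖ ≤ 7 * (C * ρ ^ 2)) (hφ1 : ∀ i, ‖φ i‖ = 1)
    (hφ : ∀ i, ‖φ i - e i‖ ≤ 40 * M * (C * ρ ^ 2)) (i j : Fin n) :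
    ‖(modeMatrix T μ φ - effMatrix e lam R ρ) i j‖ ≤ (7 * C + 80 * M * C ^ 2) * ρ ^ 2 := by
  have hM := h.M_pos
  have hC := h.C_pos
  by_cases hij : i = j
  · subst hij
    simp only [modeMatrix, effMatrix, Matrix.sub_apply, Matrix.of_apply, if_true]
    refine (hμ i).trans ?_
    nlinarith [mul_nonneg (mul_nonneg hM.le (sq_nonneg C)) (sq_nonneg ρ)]
  · simp only [modeMatrix, effMatrix, Matrix.sub_apply, Matrix.of_apply, if_neg hij]
    have h1 : ‖(inner ℂ (φ i) ((T i j - (ρ : ℂ) • R i j) (φ j)) : ℂ)‖ ≤ C * ρ ^ 2 := by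
      refine (norm_inner_le_norm _ _).trans ?_
      rw [hφ1, one_mul]
      simpa [hφ1] using ContinuousLinearMap.le_of_opNorm_le _ (hT.norm_sub_le_of_ne hij) (φ j)
    have h2 : ‖(inner ℂ (φ i - e i) (R i j (φ j)) : ℂ)‖ ≤ 40 * M * (C * ρ ^ 2) * C := by
      refine (norm_inner_le_norm _ _).trans ?_
      have : ‖R i j (φ j)‖ ≤ C := by
        simpa [hφ1] using ContinuousLinearMap.le_of_opNorm_le _ (h.norm_le i j) (φ j)
      exact mul_le_mul (hφ i) this (norm_nonneg _) (by positivity)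
    have h3 : ‖(inner ℂ (e i) (R i j (φ j - e j)) : ℂ)‖ ≤ C * (40 * M * (C * ρ ^ 2)) := by
      refine (norm_inner_le_norm _ _).trans ?_
      rw [h.norm_e, one_mul]
      exact (ContinuousLinearMap.le_of_opNorm_le _ (h.norm_le i j) _).trans
        (mul_le_mul_of_nonneg_left (hφ j) hC.le)
    -- Replacing `T i j` by `ρ R i j` costs `O(ρ²)`. Replacing the eigenvectors by the modes costs
    -- `O(ρ²)` as well, with a further factor `ρ` from the interaction.
    have h4 : (inner ℂ (φ i) (T i j (φ j)) : ℂ) - ρ * inner ℂ (e i) (R i j (e j)) =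
        inner ℂ (φ i) ((T i j - (ρ : ℂ) • R i j) (φ j)) +
          ρ * (inner ℂ (φ i - e i) (R i j (φ j)) + inner ℂ (e i) (R i j (φ j - e j))) := by
      simp only [_root_.sub_apply, _root_.smul_apply, inner_sub_right, inner_sub_left, map_sub,
        inner_smul_right]
      ring
    rw [h4]
    refine (norm_add_le _ _).trans ?_
    rw [norm_mul, Complex.norm_real, Real.norm_of_nonneg hρ]
    have h5 : ρ * ‖(inner ℂ (φ i - e i) (R i j (φ j)) : ℂ) + inner ℂ (e i) (R i j (φ j - e j))‖ ≤
        1 * (40 * M * (C * ρ ^ 2) * C + C * (40 * M * (C * ρ ^ 2))) :=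
      mul_le_mul hρ1 ((norm_add_le _ _).trans (add_le_add h2 h3)) (norm_nonneg _) zero_le_one
    nlinarith [mul_nonneg hC.le (sq_nonneg ρ)]

theorem exists_pair [∀ i, CompleteSpace (H i)] (h : IsModeFamily K e lam R M C) (hρ : 0 < ρ)
    (hρM : M * (C * ρ ^ 2) ≤ 1 / 192) {i : Fin n} (hρl : 12 * (C * ρ ^ 2) < |lam i|)
    {L : H i →L[ℂ] H i} (hL : ‖L - K i‖ ≤ C * ρ ^ 2) :
    ∃ μ φ, IsUnitPair L (lam i) (12 * (C * ρ ^ 2)) μ φ ∧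
      inner ℂ (e i) φ = (‖(inner ℂ (e i) φ : ℂ)‖ : ℂ) := by
  obtain ⟨G, hGM, hG⟩ := h.gapped i i
  have hC := h.C_pos
  obtain ⟨μ, φ, h1, h2, h3, h4⟩ := hG.exists_eigenpair hGM (by positivity) hL hρM hρl
  exact ⟨μ, φ, ⟨h1, h2, h3⟩, h4⟩

theorem pair_unique (h : IsModeFamily K e lam R M C)
    (hρM : M * (C * ρ ^ 2) ≤ 1 / 192) {i : Fin n} {r : ℝ} (hr : M * r ≤ 1 / 16)
    {L : H i →L[ℂ] H i} (hL : ‖L - K i‖ ≤ C * ρ ^ 2) {μ μ' : ℂ} {φ φ' : H i}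
    (hφ : IsUnitPair L (lam i) r μ φ) (hφ' : IsUnitPair L (lam i) r μ' φ') :
    μ' = μ ∧ ∃ c : ℂ, ‖c‖ = 1 ∧ φ' = c • φ := by
  obtain ⟨G, hGM, hG⟩ := h.gapped i i
  have hM := h.M_pos
  exact hG.unique hGM hL (by linarith) ((mul_le_mul_of_nonneg_left hφ.2.2 hM.le).trans hr)
    ((mul_le_mul_of_nonneg_left hφ'.2.2 hM.le).trans hr) hφ.1 hφ'.1 hφ.2.1 hφ'.2.1

/-- A continuous choice of the eigenpairs along a continuous family. -/
theorem exists_continuousOn_pairs [∀ i, CompleteSpace (H i)] (h : IsModeFamily K e lam R M C)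
    (hρ : 0 < ρ) (hρM : M * (C * ρ ^ 2) ≤ 1 / 192)
    (hρl : ∀ i, 12 * (C * ρ ^ 2) < |lam i|) {T : ℂ → ∀ i j, H j →L[ℂ] H i} {S : Set ℂ}
    (hTc : ∀ i j, ContinuousOn (fun s => T s i j) S) (hT : ∀ s ∈ S, IsNear K R (T s) C ρ) :
    ∃ (μ : ℂ → Fin n → ℂ) (φ : ℂ → ∀ i, H i),
      (∀ s ∈ S, ∀ i, IsUnitPair (T s i i) (lam i) (12 * (C * ρ ^ 2)) (μ s i) (φ s i)) ∧
      (∀ s ∈ S, ∀ i, ‖μ s i - lam i‖ ≤ 7 * (C * ρ ^ 2)) ∧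
      (∀ s ∈ S, ∀ i, ‖φ s i - e i‖ ≤ 40 * M * (C * ρ ^ 2)) ∧
      ContinuousOn (fun s => modeMatrix (T s) (μ s) (φ s)) S := by
  have hM := h.M_pos
  have hC := h.C_pos
  -- Fixing the phase by `⟨e i, φ⟩ ≥ 0` makes the chosen eigenvectors Lipschitz in the operator, so
  -- a pointwise choice is automatically continuous.
  have hex : ∀ s i, ∃ μ φ, s ∈ S → IsUnitPair (T s i i) (lam i) (12 * (C * ρ ^ 2)) μ φ ∧
      inner ℂ (e i) φ = (‖(inner ℂ (e i) φ : ℂ)‖ : ℂ) := fun s i => by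
    by_cases hs : s ∈ S
    · obtain ⟨μ, φ, hμ⟩ := h.exists_pair hρ hρM (hρl i) ((hT s hs).norm_sub_le i)
      exact ⟨μ, φ, fun _ => hμ⟩
    · exact ⟨0, 0, fun hs' => absurd hs' hs⟩
  choose μ φ hμφ using hex
  have hr : ∀ s ∈ S, ∀ i, M * ‖μ s i - lam i‖ ≤ 1 / 16 := fun s hs i => by
    have := mul_le_mul_of_nonneg_left (hμφ s i hs).1.2.2 hM.le
    linarith
  have hlipμ : ∀ i, ∀ s ∈ S, ∀ t ∈ S, ‖μ s i - μ t i‖ ≤ 7 * ‖T s i i - T t i i‖ :=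
    fun i s hs t ht => by
      obtain ⟨G, hGM, hG⟩ := h.gapped i i
      obtain ⟨⟨a1, a2, a3⟩, a4⟩ := hμφ s i hs
      obtain ⟨⟨b1, b2, b3⟩, b4⟩ := hμφ t i ht
      exact (hG.lipschitz hGM ((hT s hs).norm_sub_le i) ((hT t ht).norm_sub_le i) le_rfl
        (by linarith) (hr s hs i) (hr t ht i) a1 b1 a2 b2).1
  have hlipφ : ∀ i, ∀ s ∈ S, ∀ t ∈ S, ‖φ s i - φ t i‖ ≤ 40 * M * ‖T s i i - T t i i‖ :=
    fun i s hs t ht => by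
      obtain ⟨G, hGM, hG⟩ := h.gapped i i
      obtain ⟨⟨a1, a2, a3⟩, a4⟩ := hμφ s i hs
      obtain ⟨⟨b1, b2, b3⟩, b4⟩ := hμφ t i ht
      exact hG.lipschitz_of_pos hGM ((hT s hs).norm_sub_le i) ((hT t ht).norm_sub_le i) le_rfl
        (by linarith) (hr s hs i) (hr t ht i) a1 b1 a2 b2 a4 b4
  refine ⟨μ, φ, fun s hs i => (hμφ s i hs).1, fun s hs i => ?_, fun s hs i => ?_, ?_⟩
  · obtain ⟨G, hGM, hG⟩ := h.gapped i i
    obtain ⟨⟨a1, a2, a3⟩, a4⟩ := hμφ s i hs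
    exact (hG.lipschitz hGM ((hT s hs).norm_sub_le i) (K' := K i) (by simp; positivity)
      ((hT s hs).norm_sub_le i) (by linarith) (hr s hs i) (by simp) a1 hG.norm_eq a2
      hG.apply_eq).1
  · obtain ⟨G, hGM, hG⟩ := h.gapped i i
    obtain ⟨⟨a1, a2, a3⟩, a4⟩ := hμφ s i hs
    exact hG.lipschitz_of_pos hGM ((hT s hs).norm_sub_le i) (K' := K i) (by simp; positivity)
      ((hT s hs).norm_sub_le i) (by linarith) (hr s hs i) (by simp) a1 hG.norm_eq a2
      hG.apply_eq a4 (by simp [hG.norm_eq])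
  · have hμc := fun i => continuousOn_of_norm_sub_le (hTc i i) (hlipμ i)
    have hφc := fun i => continuousOn_of_norm_sub_le (hTc i i) (hlipφ i)
    refine continuousOn_pi.2 fun i => continuousOn_pi.2 fun j => ?_
    by_cases hij : i = j
    · simpa [modeMatrix, hij] using hμc j
    · simp only [modeMatrix, Matrix.of_apply, if_neg hij]
      exact (hφc i).inner (𝕜 := ℂ) ((hTc i j).clm_apply (hφc j))

/-- Every zero of a perturbation of size `O(ρ²)` of the leading order matrix is `O(ρ)`-close to
one of the `lam i`. -/
theorem exists_norm_sub_lam_le (h : IsModeFamily K e lam R M C) (hρ : 0 ≤ ρ) (hρ1 : ρ ≤ 1)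
    {c : ℝ} (hc : 0 ≤ c) {A : Matrix (Fin n) (Fin n) ℂ}
    (hA : ∀ i j, ‖(A - effMatrix e lam R ρ) i j‖ ≤ c * ρ ^ 2) {s : ℂ}
    (hs : (s • (1 : Matrix (Fin n) (Fin n) ℂ) - A).det = 0) :
    ∃ i, ‖s - lam i‖ ≤ n ^ 2 * ((c + C) * ρ) := by
  have hC := h.C_pos
  -- The interactions in `effMatrix` are `O(ρ)`, so `A` is diagonal up to `O(ρ)`, and the argument
  -- of `exists_eigenvalue_near` can be repeated in the standard basis.
  have hE : ∀ i j, ‖(A - Matrix.diagonal fun i => (lam i : ℂ)) i j‖ ≤ (c + C) * ρ := fun i j => by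
    have h1 : ‖(effMatrix e lam R ρ - Matrix.diagonal fun i => (lam i : ℂ)) i j‖ ≤ C * ρ := by
      by_cases hij : i = j
      · subst hij
        simp [effMatrix]
        positivity
      · simp only [effMatrix, Matrix.sub_apply, Matrix.of_apply, if_neg hij,
          Matrix.diagonal_apply_ne _ hij, sub_zero, norm_mul, Complex.norm_real,
          Real.norm_of_nonneg hρ]
        rw [mul_comm]
        gcongr
        refine (norm_inner_le_norm _ _).trans ?_
        rw [h.norm_e, one_mul]
        simpa [h.norm_e] using ContinuousLinearMap.le_of_opNorm_le _ (h.norm_le i j) (e j)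
    have h2 : (A - Matrix.diagonal fun i => (lam i : ℂ)) i j =
        (A - effMatrix e lam R ρ) i j +
          (effMatrix e lam R ρ - Matrix.diagonal fun i => (lam i : ℂ)) i j := by
      simp
    have h3 : c * ρ ^ 2 ≤ c * ρ := by
      have : ρ ^ 2 ≤ ρ := by nlinarith
      gcongr
    rw [h2]
    refine (norm_add_le _ _).trans ?_
    linarith [hA i j]
  obtain ⟨a, ha, hae⟩ := Matrix.exists_mulVec_eq_zero_iff.2 hs
  have hsplit : s • (1 : Matrix (Fin n) (Fin n) ℂ) - A =
      (s • 1 - Matrix.diagonal fun i => (lam i : ℂ)) -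
        (A - Matrix.diagonal fun i => (lam i : ℂ)) := by abel
  rw [hsplit, Matrix.sub_mulVec, sub_eq_zero] at hae
  have h0 : 0 < ‖WithLp.toLp 2 a‖ := norm_pos_iff.2 (by simpa using ha)
  by_contra! hcon
  have h4 := norm_toLp_mulVec_le hE a
  rw [← hae] at h4
  have h5 : ∀ i, (s • (1 : Matrix (Fin n) (Fin n) ℂ) -
      Matrix.diagonal fun i => (lam i : ℂ)).mulVec a i = (s - lam i) * a i := fun i => by
    simp only [Matrix.sub_mulVec, Matrix.smul_mulVec, Matrix.one_mulVec, Matrix.mulVec_diagonal,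
      Pi.sub_apply, Pi.smul_apply, smul_eq_mul]
    ring
  set δ : ℝ := n ^ 2 * ((c + C) * ρ)
  have hδ : 0 ≤ δ := by positivity
  have h6 : (δ * ‖WithLp.toLp 2 a‖) ^ 2 < ‖WithLp.toLp 2 ((s • (1 : Matrix (Fin n) (Fin n) ℂ) -
      Matrix.diagonal fun i => (lam i : ℂ)).mulVec a)‖ ^ 2 := by
    rw [mul_pow, EuclideanSpace.norm_sq_eq, EuclideanSpace.norm_sq_eq, Finset.mul_sum]
    obtain ⟨i₀, hi₀⟩ : ∃ i, a i ≠ 0 := by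
      by_contra! hz
      exact ha (funext hz)
    refine Finset.sum_lt_sum (fun i _ => ?_) ⟨i₀, Finset.mem_univ _, ?_⟩
    · simp only [h5, norm_mul, mul_pow]
      have := (hcon i).le
      gcongr
    · simp only [h5, norm_mul, mul_pow]
      have h7 : 0 < ‖a i₀‖ := norm_pos_iff.2 hi₀
      have := hcon i₀
      gcongr
  exact absurd (pow_lt_pow_left₀ (lt_of_pow_lt_pow_left₀ 2 (norm_nonneg _) h6)
    (by positivity) two_ne_zero) (not_lt.2 (pow_le_pow_left₀ (norm_nonneg _) h4 2))

set_option maxHeartbeats 1000000 in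
/-- For small `ρ`, eigenvalues of the block operator and zeros of the mode determinant
approximate each other up to `O(ρ²)`, along continuous families. -/
theorem exists_constants [∀ i, CompleteSpace (H i)] (h : IsModeFamily K e lam R M C) :
    ∃ r₀ > (0 : ℝ), ∃ ρ₀ > (0 : ℝ), ∃ c > (0 : ℝ), r₀ ≤ 1 ∧ (∀ i, 2 * r₀ < |lam i|) ∧
      ∀ ρ, 0 < ρ → ρ ≤ ρ₀ →
      c * ρ ^ 2 ≤ r₀ ∧ 12 * (C * ρ ^ 2) ≤ r₀ ∧
      (∀ (i : Fin n) (L : H i →L[ℂ] H i), ‖L - K i‖ ≤ C * ρ ^ 2 →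
        ∃ μ φ, IsUnitPair L (lam i) (12 * (C * ρ ^ 2)) μ φ ∧
          ∀ μ' φ', IsUnitPair L (lam i) r₀ μ' φ' → μ' = μ ∧ ∃ a : ℂ, ‖a‖ = 1 ∧ φ' = a • φ) ∧
      (∀ (i : Fin n) (L : H i →L[ℂ] H i), ‖L - K i‖ ≤ C * ρ ^ 2 → ∀ μ φ,
        IsUnitPair L (lam i) r₀ μ φ → ∃ a : ℂ, ‖a‖ = 1 ∧ ‖φ - a • e i‖ ≤ c * ρ ^ 2) ∧
      ∀ (s₀ : ℂ) (T : ℂ → ∀ i j, H j →L[ℂ] H i), (∃ i, ‖s₀ - lam i‖ ≤ r₀) →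
        (∀ i j, ContinuousOn (fun s => T s i j) (Metric.closedBall s₀ (c * ρ ^ 2))) →
        (∀ s ∈ Metric.closedBall s₀ (c * ρ ^ 2), IsNear K R (T s) C ρ) →
        ((∃ u ≠ 0, blockOp (T s₀) u = s₀ • u) → (∃ i, ‖s₀ - lam i‖ ≤ c * ρ) ∧
          ∃ s ∈ Metric.closedBall s₀ (c * ρ ^ 2), ∃ (μ : Fin n → ℂ) (φ : ∀ i, H i),
            (∀ i, IsUnitPair (T s i i) (lam i) (12 * (C * ρ ^ 2)) (μ i) (φ i)) ∧
            (s • (1 : Matrix (Fin n) (Fin n) ℂ) - modeMatrix (T s) μ φ).det = 0) ∧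
        ∀ (μ : Fin n → ℂ) (φ : ∀ i, H i),
          (∀ i, IsUnitPair (T s₀ i i) (lam i) r₀ (μ i) (φ i)) →
          (s₀ • (1 : Matrix (Fin n) (Fin n) ℂ) - modeMatrix (T s₀) μ φ).det = 0 →
          (∃ i, ‖s₀ - lam i‖ ≤ c * ρ) ∧
          ∃ s ∈ Metric.closedBall s₀ (c * ρ ^ 2), ∃ u ≠ 0, blockOp (T s) u = s • u := by
  have hM := h.M_pos
  have hC := h.C_pos
  obtain ⟨l, hl0, hl⟩ : ∃ l > (0 : ℝ), ∀ i, l ≤ |lam i| := by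
    rcases isEmpty_or_nonempty (Fin n) with hn | hn
    · exact ⟨1, one_pos, fun i => hn.elim i⟩
    · obtain ⟨i, hi⟩ := Finite.exists_min fun i => |lam i|
      exact ⟨|lam i|, abs_pos.2 (h.lam_ne i), hi⟩
  -- A common bound for the `O(ρ²)` deviations of the Schur complement and of the mode matrix from
  -- `effMatrix`.
  set b : ℝ := 7 * C + (8 * n ^ 6 + 80) * M * C ^ 2 with hb
  have hb0 : 0 < b := by positivity
  have hb1 : C + 8 * n ^ 6 * M * C ^ 2 ≤ b := by
    have : 0 ≤ 80 * M * C ^ 2 := by positivity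
    rw [hb]
    linarith
  have hb2 : 7 * C + 80 * M * C ^ 2 ≤ b := by
    have : 0 ≤ 8 * (n : ℝ) ^ 6 * M * C ^ 2 := by positivity
    rw [hb]
    linarith
  -- The summands serve, in order, the displacement of zeros, the distance of a zero to the nearest
  -- `lam i`, and the distance of an eigenvector to its mode.
  set c : ℝ := 3 * (n + 1) * n ^ 2 * b + n ^ 2 * (b + C) + 40 * M * C with hc
  have hc0 : 0 < c := by positivity
  -- Discs of radius `2 r₀` about the `lam i` must avoid `0` and stay within reach of the Neumann
  -- series for the inverse at `lam i`.
  set r₀ : ℝ := min 1 (min (1 / (16 * (n ^ 2 + 1) * M)) (l / 4)) with hr₀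
  have hr₀0 : 0 < r₀ := by positivity
  have hr₀l : r₀ ≤ l / 4 := (min_le_right _ _).trans (min_le_right _ _)
  have hr₀M : (n ^ 2 + 1) * M * r₀ ≤ 1 / 16 := by
    have : r₀ ≤ 1 / (16 * (n ^ 2 + 1) * M) := (min_le_right _ _).trans (min_le_left _ _)
    rw [le_div_iff₀ (by positivity)] at this
    linarith
  -- Beyond `ρ ≤ 1`: displacements stay below `r₀`, the single eigenpairs exist, and the
  -- perturbation `X` is small against the inverse.
  set ρ₀ : ℝ := min 1 (min (r₀ / (c + 12 * C))
    (min (1 / (192 * M * C)) (1 / (8 * (n ^ 4 + 1) * M * C)))) with hρ₀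
  refine ⟨r₀, hr₀0, ρ₀, by positivity, c, hc0, min_le_left _ _,
    fun i => by linarith [hl i], fun ρ hρ hρρ => ?_⟩
  have hρ1 : ρ ≤ 1 := hρρ.trans (min_le_left _ _)
  have hρ2 : ρ ^ 2 ≤ ρ := by nlinarith
  have hρr : ρ ≤ r₀ / (c + 12 * C) := hρρ.trans ((min_le_right _ _).trans (min_le_left _ _))
  have hρM : ρ ≤ 1 / (192 * M * C) :=
    hρρ.trans ((min_le_right _ _).trans ((min_le_right _ _).trans (min_le_left _ _)))
  have hρX : ρ ≤ 1 / (8 * (n ^ 4 + 1) * M * C) :=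
    hρρ.trans ((min_le_right _ _).trans ((min_le_right _ _).trans (min_le_right _ _)))
  rw [le_div_iff₀ (by positivity)] at hρr hρM hρX
  have hcr : c * ρ ^ 2 ≤ r₀ := by nlinarith
  have hCr : 12 * (C * ρ ^ 2) ≤ r₀ := by nlinarith
  have hMC : M * (C * ρ ^ 2) ≤ 1 / 192 := by
    have : M * C * ρ ^ 2 ≤ M * C * ρ := by gcongr
    linarith
  have hMX : n ^ 2 * M * (n ^ 2 * (2 * C * ρ)) ≤ 1 / 4 := by
    have : 0 ≤ M * C * ρ := by positivity
    nlinarith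
  have hn2 : (0 : ℝ) ≤ n ^ 2 := by positivity
  have hMr : M * r₀ ≤ 1 / 16 := by nlinarith [mul_pos hM hr₀0]
  have hρl : ∀ i, 12 * (C * ρ ^ 2) < |lam i| := fun i => by linarith [hl i]
  refine ⟨hcr, hCr, fun i L hL => ?_, fun i L hL μ φ hp => ?_, fun s₀ T ⟨i₀, hi₀⟩ hTc hT => ?_⟩
  · obtain ⟨μ, φ, hp, -⟩ := h.exists_pair hρ hMC (hρl i) hL
    exact ⟨μ, φ, hp, fun μ' φ' hp' =>
      h.pair_unique hMC hMr hL ⟨hp.1, hp.2.1, hp.2.2.trans hCr⟩ hp'⟩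
  · obtain ⟨μ', φ', hp', hpos⟩ := h.exists_pair hρ hMC (hρl i) hL
    obtain ⟨-, a, ha, haφ⟩ :=
      h.pair_unique hMC hMr hL ⟨hp'.1, hp'.2.1, hp'.2.2.trans hCr⟩ hp
    obtain ⟨G, hGM, hG⟩ := h.gapped i i
    refine ⟨a, ha, ?_⟩
    rw [haφ, ← smul_sub, norm_smul, ha, one_mul]
    have := hG.lipschitz_of_pos hGM hL (K' := K i) (by simp; positivity) hL (by linarith)
      ((mul_le_mul_of_nonneg_left (hp'.2.2.trans hCr) hM.le).trans hMr) (by simp) hp'.1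
      hG.norm_eq hp'.2.1 hG.apply_eq hpos (by simp [hG.norm_eq])
    refine this.trans ?_
    have : 0 ≤ (3 * (n + 1) * n ^ 2 * b + n ^ 2 * (b + C)) * ρ ^ 2 := by positivity
    rw [hc]
    linarith
  · set S := Metric.closedBall s₀ (c * ρ ^ 2) with hS
    have hs₀ : s₀ ∈ S := Metric.mem_closedBall_self (by positivity)
    set w : Fin n → HilbertSum H := fun i => incl i (e i) with hw
    set D := blockOp (diagFamily (deflated K e lam)) with hD
    set X := fun s => blockOp (T s - diagFamily K) with hX
    -- The inverse at the `lam i₀` near `s₀` serves the whole ball `S`, which lies within `2 r₀` of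
    -- `lam i₀`.
    obtain ⟨G, hGn, hG1, hG2⟩ := h.exists_inverse i₀
    have hun : ∀ s ∈ S, IsUnit (schurOp w D (X s) s) ∧
        ‖Ring.inverse (schurOp w D (X s) s)‖ ≤ 2 * (n ^ 2 * M) := fun s hs => by
      refine isUnit_schurOp h.orthonormal hG1 hG2 hGn ?_ ?_
      · have h1 : ‖s - lam i₀‖ ≤ 2 * r₀ := by
          have := mem_closedBall_iff_norm.1 hs
          have h2 := norm_sub_le_norm_sub_add_norm_sub s s₀ (lam i₀ : ℂ)
          linarith
        have h2 : n ^ 2 * M * ‖s - lam i₀‖ ≤ n ^ 2 * M * (2 * r₀) := by gcongr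
        nlinarith [mul_pos hM hr₀0]
      · refine le_trans ?_ hMX
        have := h.norm_blockOp_sub_le hρ.le hρ1 (hT s hs)
        gcongr
    have hs0 : ∀ s ∈ S, s ≠ 0 := fun s hs h0 => by
      subst h0
      have h1 := mem_closedBall_iff_norm.1 hs
      have h2 := norm_sub_le_norm_sub_add_norm_sub (0 : ℂ) s₀ (lam i₀ : ℂ)
      rw [zero_sub, norm_neg, Complex.norm_real, Real.norm_eq_abs] at h2
      linarith [hl i₀]
    have hres : ∀ s ∈ S, ((∃ u ≠ 0, blockOp (T s) u = s • u) ↔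
        (s • (1 : Matrix (Fin n) (Fin n) ℂ) -
          schurMatrix w (fun i => (lam i : ℂ)) D (X s) s).det = 0) := fun s hs => by
      rw [← exists_eigenvector_iff_det_schurMatrix h.orthonormal h.deflated_incl
        h.inner_incl_deflated (hs0 s hs) (hun s hs).1, ← blockOp_eq K e lam (T s)]
    have hschur : ∀ s ∈ S, ∀ i j, ‖(schurMatrix w (fun i => (lam i : ℂ)) D (X s) s -
        effMatrix e lam R ρ) i j‖ ≤ b * ρ ^ 2 := fun s hs i j => by
      have h1 := h.norm_schurMatrix_sub_effMatrix_le hρ.le hρ1 (hT s hs) (hun s hs).2 i j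
      exact h1.trans (mul_le_mul_of_nonneg_right hb1 (sq_nonneg ρ))
    have hXc : ContinuousOn X S := continuousOn_blockOp fun i j => (hTc i j).sub continuousOn_const
    have hschurc : ContinuousOn (fun s => schurMatrix w (fun i => (lam i : ℂ)) D (X s) s -
        effMatrix e lam R ρ) S := (continuousOn_schurMatrix w (fun i => (lam i : ℂ)) D hXc
      fun s hs => (hun s hs).1).sub
        (continuousOn_const (c := effMatrix e lam R ρ))
    obtain ⟨μ, φ, hp, hpμ, hpφ, hmc⟩ := h.exists_continuousOn_pairs hρ hMC hρl hTc hT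
    have hmode : ∀ s ∈ S, ∀ i j, ‖(modeMatrix (T s) (μ s) (φ s) -
        effMatrix e lam R ρ) i j‖ ≤ b * ρ ^ 2 := fun s hs i j => by
      have h1 := h.norm_modeMatrix_sub_effMatrix_le hρ.le hρ1 (hT s hs) (hpμ s hs)
        (fun i => (hp s hs i).1) (hpφ s hs) i j
      exact h1.trans (mul_le_mul_of_nonneg_right hb2 (sq_nonneg ρ))
    have hmodec : ContinuousOn (fun s => modeMatrix (T s) (μ s) (φ s) - effMatrix e lam R ρ) S :=
      hmc.sub (continuousOn_const (c := effMatrix e lam R ρ))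
    have hsub : Metric.closedBall s₀ (3 * (n + 1) * n ^ 2 * (b * ρ ^ 2)) ⊆ S := by
      refine Metric.closedBall_subset_closedBall ?_
      have : 0 ≤ (n ^ 2 * (b + C) + 40 * M * C) * ρ ^ 2 := by positivity
      rw [hc]
      linarith
    have hnear : ∀ A : Matrix (Fin n) (Fin n) ℂ,
        (∀ i j, ‖(A - effMatrix e lam R ρ) i j‖ ≤ b * ρ ^ 2) →
        (s₀ • (1 : Matrix (Fin n) (Fin n) ℂ) - A).det = 0 → ∃ i, ‖s₀ - lam i‖ ≤ c * ρ :=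
      fun A hA hA0 => by
        obtain ⟨i, hi⟩ := h.exists_norm_sub_lam_le hρ.le hρ1 hb0.le hA hA0
        refine ⟨i, hi.trans ?_⟩
        have : 0 ≤ (3 * (n + 1) * n ^ 2 * b + 40 * M * C) * ρ := by positivity
        rw [hc]
        linarith
    have hεpos : 0 < b * ρ ^ 2 := by positivity
    refine ⟨fun hu => ?_, fun μ' φ' hp' hdet => ?_⟩
    · have h1 := (hres s₀ hs₀).1 hu
      refine ⟨hnear _ (hschur s₀ hs₀) h1, ?_⟩
      -- The Schur complement supplies the known zero and the mode matrix the continuous family; the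
      -- other implication exchanges the roles.
      obtain ⟨s, hs, hdet⟩ := exists_det_eq_zero_near (h.isHermitian_effMatrix (ρ := ρ)) hεpos
        (hschur s₀ hs₀) (by rw [sub_sub, add_sub_cancel]; exact h1) (hmodec.mono hsub)
        (fun s hs => hmode s (hsub hs))
      refine ⟨s, hsub hs, μ s, φ s, hp s (hsub hs), ?_⟩
      rwa [sub_sub, add_sub_cancel] at hdet
    -- The given eigenpairs differ from the continuous choice at `s₀` by phases only, which the
    -- determinant does not see.
    · have hph : ∀ i, μ' i = μ s₀ i ∧ ∃ a : ℂ, ‖a‖ = 1 ∧ φ' i = a • φ s₀ i := fun i =>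
        h.pair_unique hMC hMr ((hT s₀ hs₀).norm_sub_le i)
          ⟨(hp s₀ hs₀ i).1, (hp s₀ hs₀ i).2.1, (hp s₀ hs₀ i).2.2.trans hCr⟩ (hp' i)
      choose hμ' a ha hφ' using hph
      rw [show μ' = μ s₀ from funext hμ', show φ' = fun i => a i • φ s₀ i from funext hφ',
        det_modeMatrix_phase _ _ _ ha] at hdet
      refine ⟨hnear _ (hmode s₀ hs₀) hdet, ?_⟩
      obtain ⟨s, hs, hdet'⟩ := exists_det_eq_zero_near (h.isHermitian_effMatrix (ρ := ρ)) hεpos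
        (hmode s₀ hs₀) (by rw [sub_sub, add_sub_cancel]; exact hdet) (hschurc.mono hsub)
        (fun s hs => hschur s (hsub hs))
      refine ⟨s, hsub hs, (hres s (hsub hs)).2 ?_⟩
      rwa [sub_sub, add_sub_cancel] at hdet'

end IsModeFamily

end Modes

end Resonators
end

/-! ### Integral operators with square-integrable kernels. -/

noncomputable section
namespace Resonators
open Complex Set

section HilbertSchmidt

theorem isCompactOperator_smulRight {E F : Type*} [NormedAddCommGroup E] [NormedSpace ℂ E]
    [NormedAddCommGroup F] [NormedSpace ℂ F] (f : E →L[ℂ] ℂ) (x : F) :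
    IsCompactOperator (f.smulRight x) := by
  have h : IsCompactOperator f := isCompactOperator_of_locallyCompactSpace_dom f
  exact h.clm_comp (ContinuousLinearMap.toSpanSingleton ℂ x)

universe u in
/-- Hilbert–Schmidt operators are compact. -/
theorem isCompactOperator_of_sum_sq_le {E : Type u} {F : Type*} [NormedAddCommGroup E]
    [InnerProductSpace ℂ E] [CompleteSpace E] [NormedAddCommGroup F] [InnerProductSpace ℂ F]
    [CompleteSpace F] (T : E →L[ℂ] F) {C : ℝ}
    (hT : ∀ (ι : Type u) (v : ι → E), Orthonormal ℂ v → ∀ s : Finset ι,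
      ∑ i ∈ s, ‖T (v i)‖ ^ 2 ≤ C) : IsCompactOperator T := by
  classical
  obtain ⟨w, b, -⟩ := exists_hilbertBasis ℂ E
  have hsum : Summable fun i => ‖T (b i)‖ ^ 2 :=
    summable_of_sum_le (fun i => sq_nonneg _) (hT _ b b.orthonormal)
  -- The finite rank truncations of `T` in a Hilbert basis. By the Cauchy–Schwarz and Bessel
  -- inequalities their distance to `T` is controlled by the tail of `∑ ‖T b_i‖²`.
  set F' : Finset w → E →L[ℂ] F := fun s => ∑ i ∈ s, (innerSL ℂ (b i)).smulRight (T (b i))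
    with hF'
  refine isCompactOperator_of_tendsto (F := F') (l := Filter.atTop) ?_
    (Filter.Eventually.of_forall fun s => ?_)
  · rw [Metric.tendsto_atTop]
    intro ε hε
    obtain ⟨s₀, hs₀⟩ := summable_iff_vanishing_norm.1 hsum ((ε / 2) ^ 2) (by positivity)
    refine ⟨s₀, fun s hs => ?_⟩
    rw [dist_eq_norm]
    refine lt_of_le_of_lt (ContinuousLinearMap.opNorm_le_bound _ (half_pos hε).le fun u => ?_)
      (half_lt_self hε)
    have hlim : Filter.Tendsto (fun t : Finset w => ‖F' s u - F' t u‖) Filter.atTop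
        (nhds ‖F' s u - T u‖) := by
      refine Filter.Tendsto.norm (Filter.Tendsto.sub tendsto_const_nhds ?_)
      have := ((b.hasSum_repr u).mapL T)
      simpa [HasSum, hF', b.repr_apply_apply] using this
    refine le_of_tendsto hlim (Filter.eventually_atTop.2 ⟨s, fun t hst => ?_⟩)
    have h1 : F' s u - F' t u = -∑ i ∈ t \ s, inner ℂ (b i) u • T (b i) := by
      simp only [hF', _root_.sum_apply, ContinuousLinearMap.smulRight_apply, innerSL_apply_apply]
      rw [← Finset.sum_sdiff hst]
      abel
    rw [h1, norm_neg]
    have h2 : ∑ i ∈ t \ s, ‖T (b i)‖ ^ 2 ≤ (ε / 2) ^ 2 := by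
      have := hs₀ (t \ s) (Finset.disjoint_of_subset_right hs Finset.sdiff_disjoint)
      exact (le_abs_self _).trans this.le
    have h3 : ∑ i ∈ t \ s, ‖(inner ℂ (b i) u : ℂ)‖ ^ 2 ≤ ‖u‖ ^ 2 :=
      b.orthonormal.sum_inner_products_le u
    refine (norm_sum_le _ _).trans ?_
    simp only [norm_smul]
    refine (Real.sum_mul_le_sqrt_mul_sqrt _ _ _).trans ?_
    rw [mul_comm (ε / 2)]
    refine mul_le_mul ?_ ?_ (Real.sqrt_nonneg _) (norm_nonneg _)
    · exact (Real.sqrt_le_sqrt h3).trans (by rw [Real.sqrt_sq (norm_nonneg _)])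
    · exact (Real.sqrt_le_sqrt h2).trans (by rw [Real.sqrt_sq (half_pos hε).le])
  · have : ∀ s : Finset w, IsCompactOperator (F' s) := fun s => by
      induction s using Finset.induction_on with
      | empty => simpa [hF'] using isCompactOperator_zero
      | insert i s hi ih =>
        simp only [hF', Finset.sum_insert hi]
        exact (isCompactOperator_smulRight _ _).add ih
    exact this s

end HilbertSchmidt

section Kernel

variable {X Y : Type*} [MeasurableSpace X] [MeasurableSpace Y] {μ : Measure X} {ν : Measure Y}

theorem norm_sq_toLp {f : X → ℂ} (hf : MemLp f 2 μ) :
    ‖hf.toLp f‖ ^ 2 = ∫ x, ‖f x‖ ^ 2 ∂μ := by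
  rw [← @inner_self_eq_norm_sq ℂ, L2.inner_def, ← integral_re]
  · refine integral_congr_ae ?_
    filter_upwards [hf.coeFn_toLp] with x hx
    rw [hx]
    simp [← Complex.ofReal_pow]
  · exact L2.integrable_inner _ _

/-- The square of the Hilbert–Schmidt norm. -/
def hsSq (k : X → Y → ℂ) (μ : Measure X) (ν : Measure Y) : ℝ :=
  ∫ p, ‖Function.uncurry k p‖ ^ 2 ∂(μ.prod ν)

theorem hsSq_nonneg (k : X → Y → ℂ) : 0 ≤ hsSq k μ ν := integral_nonneg fun _ => sq_nonneg _

variable [SFinite μ] [SFinite ν]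

/-- The sections of a square-integrable kernel represent the integral operator. -/
theorem ae_exists_section {k : X → Y → ℂ} (hk : MemLp (Function.uncurry k) 2 (μ.prod ν)) :
    ∀ᵐ x ∂μ, ∃ a : Lp ℂ 2 ν, ‖a‖ ^ 2 = ∫ y, ‖k x y‖ ^ 2 ∂ν ∧
      ∀ u : Lp ℂ 2 ν, ∫ y, k x y * u y ∂ν = inner ℂ a u := by
  have h1 : Integrable (fun p => ‖Function.uncurry k p‖ ^ 2) (μ.prod ν) :=
    (memLp_two_iff_integrable_sq_norm hk.1).1 hk
  filter_upwards [h1.prod_right_ae, hk.1.prodMk_left] with x hx hxm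
  have hx2 : MemLp (fun y => (starRingEnd ℂ) (k x y)) 2 ν :=
    ((memLp_two_iff_integrable_sq_norm hxm).2 hx).star
  refine ⟨hx2.toLp _, ?_, fun u => ?_⟩
  · rw [← @inner_self_eq_norm_sq ℂ, L2.inner_def, ← integral_re]
    · refine integral_congr_ae ?_
      filter_upwards [hx2.coeFn_toLp] with y hy
      rw [hy]
      simp [← Complex.ofReal_pow]
    · exact L2.integrable_inner _ _
  · rw [L2.inner_def]
    refine integral_congr_ae ?_
    filter_upwards [hx2.coeFn_toLp] with y hy
    rw [hy]
    simp [mul_comm]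

theorem memLp_integral_kernel {k : X → Y → ℂ} (hk : MemLp (Function.uncurry k) 2 (μ.prod ν))
    (u : Lp ℂ 2 ν) : MemLp (fun x => ∫ y, k x y * u y ∂ν) 2 μ := by
  have h1 : Integrable (fun p => ‖Function.uncurry k p‖ ^ 2) (μ.prod ν) :=
    (memLp_two_iff_integrable_sq_norm hk.1).1 hk
  have hm : AEStronglyMeasurable (fun x => ∫ y, k x y * u y ∂ν) μ :=
    (hk.1.mul (Lp.aestronglyMeasurable u).comp_snd).integral_prod_right'
  rw [memLp_two_iff_integrable_sq_norm hm]
  refine Integrable.mono' (h1.integral_prod_left.mul_const (‖u‖ ^ 2)) (hm.norm.pow 2) ?_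
  filter_upwards [ae_exists_section hk] with x ⟨a, ha, hau⟩
  rw [hau, Real.norm_of_nonneg (sq_nonneg _)]
  simp only [Function.uncurry_apply_pair]
  rw [← ha, ← mul_pow]
  exact pow_le_pow_left₀ (norm_nonneg _) (norm_inner_le_norm _ _) 2

/-- Bessel's inequality for almost every section of the kernel, integrated over `x`. -/
theorem sum_norm_sq_integral_kernel_le {k : X → Y → ℂ}
    (hk : MemLp (Function.uncurry k) 2 (μ.prod ν)) {ι : Type*} {v : ι → Lp ℂ 2 ν}
    (hv : Orthonormal ℂ v) (s : Finset ι) :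
    ∑ i ∈ s, ‖(memLp_integral_kernel hk (v i)).toLp _‖ ^ 2 ≤ hsSq k μ ν := by
  have h1 : Integrable (fun p => ‖Function.uncurry k p‖ ^ 2) (μ.prod ν) :=
    (memLp_two_iff_integrable_sq_norm hk.1).1 hk
  simp only [norm_sq_toLp]
  have h2 : ∀ i ∈ s, Integrable (fun x => ‖∫ y, k x y * v i y ∂ν‖ ^ 2) μ := fun i _ =>
    (memLp_two_iff_integrable_sq_norm (memLp_integral_kernel hk (v i)).1).1
      (memLp_integral_kernel hk (v i))
  rw [← integral_finsetSum _ h2, hsSq, integral_prod _ h1]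
  refine integral_mono_ae (integrable_finsetSum _ h2) h1.integral_prod_left ?_
  filter_upwards [ae_exists_section hk] with x ⟨a, ha, hau⟩
  simp only [hau, Function.uncurry_apply_pair]
  rw [← ha]
  refine le_trans (le_of_eq ?_) (hv.sum_inner_products_le (s := s) a)
  refine Finset.sum_congr rfl fun i _ => ?_
  rw [norm_inner_symm]

/-- The integral operator with a square-integrable kernel. -/
def kernelOp (k : X → Y → ℂ) (hk : MemLp (Function.uncurry k) 2 (μ.prod ν)) :
    Lp ℂ 2 ν →L[ℂ] Lp ℂ 2 μ :=
  LinearMap.mkContinuous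
    { toFun := fun u => (memLp_integral_kernel hk u).toLp _
      map_add' := fun u v => by
        rw [← MemLp.toLp_add]
        refine (MemLp.toLp_eq_toLp_iff _ _).2 ?_
        filter_upwards [ae_exists_section hk] with x ⟨a, ha, hau⟩
        simp only [hau, Pi.add_apply, inner_add_right]
      map_smul' := fun c u => by
        rw [RingHom.id_apply, ← MemLp.toLp_const_smul]
        refine (MemLp.toLp_eq_toLp_iff _ _).2 ?_
        filter_upwards [ae_exists_section hk] with x ⟨a, ha, hau⟩
        simp only [hau, Pi.smul_apply, inner_smul_right, smul_eq_mul] }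
    (Real.sqrt (hsSq k μ ν)) fun u => by
      have h1 : Integrable (fun p => ‖Function.uncurry k p‖ ^ 2) (μ.prod ν) :=
        (memLp_two_iff_integrable_sq_norm hk.1).1 hk
      refine le_of_sq_le_sq ?_ (by positivity)
      rw [mul_pow, Real.sq_sqrt (hsSq_nonneg k)]
      change ‖(memLp_integral_kernel hk u).toLp _‖ ^ 2 ≤ _
      rw [norm_sq_toLp, hsSq, integral_prod _ h1, ← integral_mul_const]
      refine integral_mono_ae ((memLp_two_iff_integrable_sq_norm
        (memLp_integral_kernel hk u).1).1 (memLp_integral_kernel hk u))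
        (h1.integral_prod_left.mul_const _) ?_
      filter_upwards [ae_exists_section hk] with x ⟨a, ha, hau⟩
      simp only [hau, Function.uncurry_apply_pair]
      rw [← ha, ← mul_pow]
      exact pow_le_pow_left₀ (norm_nonneg _) (norm_inner_le_norm _ _) 2

theorem kernelOp_apply_ae (k : X → Y → ℂ) (hk : MemLp (Function.uncurry k) 2 (μ.prod ν))
    (u : Lp ℂ 2 ν) : kernelOp k hk u =ᵐ[μ] fun x => ∫ y, k x y * u y ∂ν :=
  (memLp_integral_kernel hk u).coeFn_toLp

theorem norm_kernelOp_le (k : X → Y → ℂ) (hk : MemLp (Function.uncurry k) 2 (μ.prod ν)) :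
    ‖kernelOp k hk‖ ≤ Real.sqrt (hsSq k μ ν) :=
  LinearMap.mkContinuous_norm_le _ (Real.sqrt_nonneg _) _

theorem isCompactOperator_kernelOp (k : X → Y → ℂ)
    (hk : MemLp (Function.uncurry k) 2 (μ.prod ν)) : IsCompactOperator (kernelOp k hk) :=
  isCompactOperator_of_sum_sq_le _ fun _ _ hv s => sum_norm_sq_integral_kernel_le hk hv s

theorem inner_kernelOp {k : X → Y → ℂ} (hk : MemLp (Function.uncurry k) 2 (μ.prod ν))
    (v : Lp ℂ 2 μ) (u : Lp ℂ 2 ν) :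
    inner ℂ v (kernelOp k hk u) = ∫ x, (∫ y, k x y * u y ∂ν) * (starRingEnd ℂ) (v x) ∂μ := by
  rw [L2.inner_def]
  refine integral_congr_ae ?_
  filter_upwards [kernelOp_apply_ae k hk u] with x hx
  rw [hx]
  simp

/-- Fubini's theorem, for a product of two square-integrable functions on the product space. With
two different spaces it covers the interactions as well as the symmetry of a static operator. -/
theorem conj_inner_kernelOp {k : X → Y → ℂ} {k' : Y → X → ℂ}
    (hk : MemLp (Function.uncurry k) 2 (μ.prod ν))
    (hk' : MemLp (Function.uncurry k') 2 (ν.prod μ))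
    (hkk : ∀ x y, k' y x = (starRingEnd ℂ) (k x y)) (v : Lp ℂ 2 μ) (u : Lp ℂ 2 ν) :
    (starRingEnd ℂ) (inner ℂ v (kernelOp k hk u)) = inner ℂ u (kernelOp k' hk' v) := by
  have hint : Integrable (fun p : X × Y => k' p.2 p.1 * v p.1 * (starRingEnd ℂ) (u p.2))
      (μ.prod ν) := by
    have h1 : MemLp (fun p : X × Y => (starRingEnd ℂ) (Function.uncurry k p)) 2 (μ.prod ν) :=
      hk.star
    have h2 : MemLp (fun p : X × Y => v p.1 * (starRingEnd ℂ) (u p.2)) 2 (μ.prod ν) := by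
      have hm : AEStronglyMeasurable (fun p : X × Y => v p.1 * (starRingEnd ℂ) (u p.2))
          (μ.prod ν) := (Lp.aestronglyMeasurable v).comp_fst.mul
            (Lp.aestronglyMeasurable u).star.comp_snd
      rw [memLp_two_iff_integrable_sq_norm hm]
      have := ((memLp_two_iff_integrable_sq_norm (Lp.aestronglyMeasurable v)).1
        (Lp.memLp v)).mul_prod ((memLp_two_iff_integrable_sq_norm
          (Lp.aestronglyMeasurable u)).1 (Lp.memLp u))
      simpa [mul_pow] using this
    have := h1.integrable_mul h2
    refine this.congr (Filter.Eventually.of_forall fun p => ?_)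
    simp [hkk, Function.uncurry, mul_assoc]
  rw [inner_kernelOp, inner_kernelOp, ← integral_conj]
  have e1 : ∀ x, (starRingEnd ℂ) ((∫ y, k x y * u y ∂ν) * (starRingEnd ℂ) (v x)) =
      ∫ y, k' y x * v x * (starRingEnd ℂ) (u y) ∂ν := fun x => by
    rw [map_mul, ← integral_conj, Complex.conj_conj, ← integral_mul_const]
    refine integral_congr_ae (Filter.Eventually.of_forall fun y => ?_)
    simp only [map_mul, hkk]
    ring
  simp only [e1]
  rw [integral_integral_swap hint]
  refine integral_congr_ae (Filter.Eventually.of_forall fun y => ?_)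
  simp only [integral_mul_const]

/-- Kernels that are uniformly close give close operators. -/
theorem norm_kernelOp_sub_le [IsFiniteMeasure μ] [IsFiniteMeasure ν] {k k' : X → Y → ℂ}
    (hk : MemLp (Function.uncurry k) 2 (μ.prod ν))
    (hk' : MemLp (Function.uncurry k') 2 (μ.prod ν)) {c : ℝ} (hc : 0 ≤ c)
    (h : ∀ᵐ p ∂(μ.prod ν), ‖k p.1 p.2 - k' p.1 p.2‖ ≤ c) :
    ‖kernelOp k hk - kernelOp k' hk'‖ ≤ c * Real.sqrt ((μ.prod ν).real univ) := by
  have hd : MemLp (Function.uncurry fun x y => k x y - k' x y) 2 (μ.prod ν) := hk.sub hk'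
  have h1 : kernelOp k hk - kernelOp k' hk' = kernelOp _ hd := by
    refine ContinuousLinearMap.ext fun u => Lp.ext ?_
    have hs : (fun x => ∫ y, (k x y - k' x y) * u y ∂ν) =ᵐ[μ]
        fun x => (∫ y, k x y * u y ∂ν) - ∫ y, k' x y * u y ∂ν := by
      have i1 := (hk.1.mul (Lp.aestronglyMeasurable u).comp_snd).prodMk_left
      have hint : ∀ {q : X → Y → ℂ}, MemLp (Function.uncurry q) 2 (μ.prod ν) →
          ∀ᵐ x ∂μ, Integrable (fun y => q x y * u y) ν := fun {q} hq => by
        have j1 : Integrable (fun p => ‖Function.uncurry q p‖ ^ 2) (μ.prod ν) :=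
          (memLp_two_iff_integrable_sq_norm hq.1).1 hq
        filter_upwards [j1.prod_right_ae, hq.1.prodMk_left] with x hx hxm
        exact ((memLp_two_iff_integrable_sq_norm hxm).2 hx).integrable_mul (Lp.memLp u)
      filter_upwards [hint hk, hint hk'] with x h1 h2
      rw [← integral_sub h1 h2]
      simp only [sub_mul]
    filter_upwards [hs, kernelOp_apply_ae k hk u, kernelOp_apply_ae k' hk' u,
      kernelOp_apply_ae _ hd u, Lp.coeFn_sub (kernelOp k hk u) (kernelOp k' hk' u)]
      with x h1 h2 h3 h4 h5
    rw [h4, h1, _root_.sub_apply, h5, Pi.sub_apply, h2, h3]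
  rw [h1]
  refine (norm_kernelOp_le _ hd).trans ?_
  rw [Real.sqrt_le_left (by positivity), mul_pow, Real.sq_sqrt measureReal_nonneg, hsSq]
  have h2 := integral_mono_of_nonneg (μ := μ.prod ν)
    (f := fun p => ‖Function.uncurry (fun x y => k x y - k' x y) p‖ ^ 2) (g := fun _ => c ^ 2)
    (Filter.Eventually.of_forall fun _ => sq_nonneg _) (integrable_const _)
    (by filter_upwards [h] with p hp using pow_le_pow_left₀ (norm_nonneg _) hp 2)
  rw [integral_const, smul_eq_mul, mul_comm] at h2
  exact h2

end Kernel

end Resonators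
end

/-! ### Estimates for the Helmholtz kernel. -/

noncomputable section
namespace Resonators
open Complex Set

/-- The kernel `exp(iκ|x|) / (4π|x|)` of the potential. -/
def gk (κ : ℂ) (x : E3) : ℂ := -green x κ

theorem gk_eq (κ : ℂ) (x : E3) :
    gk κ x = Complex.exp (I * κ * (‖x‖ : ℂ)) / (4 * (Real.pi : ℂ) * (‖x‖ : ℂ)) := by
  rw [gk, green, neg_neg]

theorem potential_eq (κ : ℂ) (D : Set E3) (u : L2 D) (x : E3) :
    potential κ D u x = ∫ y in D, gk κ (x - y) * u y := by
  rw [potential, ← integral_neg]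
  simp only [gk, neg_mul]

theorem measurable_gk (κ : ℂ) : Measurable (gk κ) := by
  have : gk κ = fun x => Complex.exp (I * κ * (‖x‖ : ℂ)) / (4 * (Real.pi : ℂ) * (‖x‖ : ℂ)) :=
    funext fun x => gk_eq κ x
  rw [this]
  fun_prop

theorem norm_exp_sub_exp_le (a b : ℂ) :
    ‖Complex.exp a - Complex.exp b‖ ≤ Real.exp ‖b‖ * (‖a - b‖ * Real.exp ‖a - b‖) := by
  have h1 : Complex.exp a - Complex.exp b = Complex.exp b * (Complex.exp (a - b) - 1) := by
    rw [mul_sub, ← Complex.exp_add]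
    ring_nf
  have h2 := Complex.norm_exp_sub_sum_le_norm_mul_exp (a - b) 1
  rw [h1, norm_mul]
  refine mul_le_mul (Complex.norm_exp_le_exp_norm b) (by simpa using h2) (norm_nonneg _)
    (Real.exp_pos _).le

theorem one_le_four_pi : (1 : ℝ) ≤ 4 * Real.pi := by linarith [Real.pi_gt_three]

theorem norm_four_pi_mul (x : E3) : ‖(4 * (Real.pi : ℂ) * (‖x‖ : ℂ))‖ = 4 * Real.pi * ‖x‖ := by
  rw [norm_mul, norm_mul, Complex.norm_real, Complex.norm_real, norm_norm,
    Real.norm_of_nonneg Real.pi_pos.le]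
  simp

theorem norm_gk_le (κ : ℂ) (x : E3) : ‖gk κ x‖ ≤ Real.exp (‖κ‖ * ‖x‖) * ‖x‖⁻¹ := by
  rw [gk_eq, norm_div, norm_four_pi_mul, div_eq_mul_inv, mul_inv]
  have h1 : ‖Complex.exp (I * κ * (‖x‖ : ℂ))‖ ≤ Real.exp (‖κ‖ * ‖x‖) := by
    refine (Complex.norm_exp_le_exp_norm _).trans (le_of_eq ?_)
    simp
  have h2 : (4 * Real.pi)⁻¹ ≤ 1 := inv_le_one_of_one_le₀ one_le_four_pi
  have h3 : (4 * Real.pi)⁻¹ * ‖x‖⁻¹ ≤ ‖x‖⁻¹ :=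
    mul_le_of_le_one_left (inv_nonneg.2 (norm_nonneg x)) h2
  have h4 : 0 ≤ (4 * Real.pi)⁻¹ * ‖x‖⁻¹ := by positivity
  exact mul_le_mul h1 h3 h4 (Real.exp_pos _).le

/-- The kernel is Lipschitz in the wavenumber. -/
theorem norm_gk_sub_gk_le {κ κ' : ℂ} (hκ : ‖κ‖ ≤ 1) (hκ' : ‖κ'‖ ≤ 1) {x : E3} {L : ℝ}
    (hx : ‖x‖ ≤ L) : ‖gk κ x - gk κ' x‖ ≤ Real.exp (3 * L) * ‖κ - κ'‖ := by
  have hL : 0 ≤ L := (norm_nonneg x).trans hx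
  rcases eq_or_ne x 0 with rfl | hx0
  · rw [gk_eq, gk_eq]
    simp only [norm_zero, ofReal_zero, mul_zero, div_zero, sub_zero]
    positivity
  have hxp : 0 < ‖x‖ := norm_pos_iff.2 hx0
  -- The difference of the exponentials is `O(‖κ - κ'‖ ‖x‖)`, and its factor `‖x‖` cancels the
  -- singularity.
  rw [gk_eq, gk_eq, ← sub_div, norm_div, norm_four_pi_mul, div_le_iff₀ (by positivity)]
  refine (norm_exp_sub_exp_le _ _).trans ?_
  have e1 : I * κ * (‖x‖ : ℂ) - I * κ' * (‖x‖ : ℂ) = I * (κ - κ') * (‖x‖ : ℂ) := by ring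
  have e2 : ‖I * κ' * (‖x‖ : ℂ)‖ ≤ L := by
    simp only [norm_mul, norm_I, one_mul, Complex.norm_real, norm_norm]
    nlinarith [norm_nonneg κ']
  have e3 : ‖I * (κ - κ') * (‖x‖ : ℂ)‖ = ‖κ - κ'‖ * ‖x‖ := by
    simp only [norm_mul, norm_I, one_mul, Complex.norm_real, norm_norm]
  have e4 : ‖κ - κ'‖ ≤ 2 := (norm_sub_le _ _).trans (by linarith)
  rw [e1, e3]
  have e5 : ‖κ - κ'‖ * ‖x‖ ≤ 2 * L := by gcongr
  calc Real.exp ‖I * κ' * (‖x‖ : ℂ)‖ * (‖κ - κ'‖ * ‖x‖ * Real.exp (‖κ - κ'‖ * ‖x‖))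
      ≤ Real.exp L * (‖κ - κ'‖ * ‖x‖ * Real.exp (2 * L)) := by gcongr
    _ = Real.exp (3 * L) * ‖κ - κ'‖ * (1 * ‖x‖) := by
        rw [show 3 * L = L + 2 * L by ring, Real.exp_add]
        ring
    _ ≤ Real.exp (3 * L) * ‖κ - κ'‖ * (4 * Real.pi * ‖x‖) := by
        gcongr
        exact one_le_four_pi

theorem gk_zero (x : E3) : gk 0 x = 1 / (4 * (Real.pi : ℂ) * (‖x‖ : ℂ)) := by
  rw [gk_eq]
  simp

/-- The factor `ρ` compensates the homogeneity of `1/‖x‖`, so a dilation only replaces `κ` by `ρκ`.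
For `κ = O(ρ)` this is a perturbation of size `O(ρ²)` of the static kernel. -/
theorem mul_gk_smul {ρ : ℝ} (hρ : 0 < ρ) (κ : ℂ) (x : E3) :
    (ρ : ℂ) * gk κ (ρ • x) = gk (ρ * κ) x := by
  have hρ' : (ρ : ℂ) ≠ 0 := by exact_mod_cast hρ.ne'
  have hpi : (Real.pi : ℂ) ≠ 0 := by exact_mod_cast Real.pi_pos.ne'
  rw [gk_eq, gk_eq, norm_smul, Real.norm_of_nonneg hρ.le]
  push_cast
  rcases eq_or_ne x 0 with rfl | hx
  · simp
  have hx' : (‖x‖ : ℂ) ≠ 0 := by exact_mod_cast (norm_pos_iff.2 hx).ne'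
  rw [show I * κ * (ρ * (‖x‖ : ℂ)) = I * (ρ * κ) * (‖x‖ : ℂ) by ring]
  field_simp

/-- At a fixed distance `a` the kernel is nearly constant. -/
theorem norm_gk_add_sub_le {κ : ℂ} (hκ : ‖κ‖ ≤ 1) {a w : E3} (ha : a ≠ 0) {ρ L L' : ℝ}
    (hρ : 0 ≤ ρ) (hw : ‖w‖ ≤ L) (hρL : ρ * L ≤ ‖a‖ / 2) (hL' : ‖a + ρ • w‖ ≤ L') :
    ‖gk κ (a + ρ • w) - gk 0 a‖ ≤ Real.exp (3 * L') * ‖κ‖ + 2 * L / ‖a‖ ^ 2 * ρ := by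
  have ha0 : 0 < ‖a‖ := norm_pos_iff.2 ha
  have h1 := norm_gk_sub_gk_le hκ (κ' := 0) (by simp) hL'
  rw [sub_zero] at h1
  have hw' : ‖ρ • w‖ ≤ ρ * L := by
    rw [norm_smul, Real.norm_of_nonneg hρ]
    gcongr
  have hb : ‖a‖ / 2 ≤ ‖a + ρ • w‖ := by
    have := norm_sub_le_norm_add a (ρ • w)
    linarith
  have hb0 : 0 < ‖a + ρ • w‖ := lt_of_lt_of_le (by positivity) hb
  have hd : |‖a‖ - ‖a + ρ • w‖| ≤ ρ * L := by
    refine (abs_norm_sub_norm_le _ _).trans ?_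
    rw [sub_add_cancel_left, norm_neg]
    exact hw'
  -- The static part is a difference of reciprocals of distances, and both distances are at least
  -- `‖a‖ / 2`.
  have h2 : ‖gk 0 (a + ρ • w) - gk 0 a‖ ≤ 2 * L / ‖a‖ ^ 2 * ρ := by
    have e1 : gk 0 (a + ρ • w) - gk 0 a =
        (((‖a‖ - ‖a + ρ • w‖) / (4 * Real.pi * (‖a + ρ • w‖ * ‖a‖)) : ℝ) : ℂ) := by
      have hpi : (Real.pi : ℂ) ≠ 0 := by exact_mod_cast Real.pi_pos.ne'
      have h3 : (‖a‖ : ℂ) ≠ 0 := by exact_mod_cast ha0.ne'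
      have h4 : (‖a + ρ • w‖ : ℂ) ≠ 0 := by exact_mod_cast hb0.ne'
      rw [gk_zero, gk_zero]
      push_cast
      field_simp
    rw [e1, Complex.norm_real, Real.norm_eq_abs, abs_div,
      abs_of_pos (show 0 < 4 * Real.pi * (‖a + ρ • w‖ * ‖a‖) by positivity)]
    have hL0 : 0 ≤ L := (norm_nonneg w).trans hw
    calc |‖a‖ - ‖a + ρ • w‖| / (4 * Real.pi * (‖a + ρ • w‖ * ‖a‖))
        ≤ (ρ * L) / (1 * (‖a‖ / 2 * ‖a‖)) := by
          gcongr
          exact one_le_four_pi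
      _ = 2 * L / ‖a‖ ^ 2 * ρ := by field_simp
  exact (norm_sub_le_norm_sub_add_norm_sub _ (gk 0 (a + ρ • w)) _).trans (add_le_add h1 h2)

theorem gk_conj_zero (x : E3) : (starRingEnd ℂ) (gk 0 x) = gk 0 x := by
  rw [gk_zero]
  simp [Complex.conj_ofNat]

theorem gk_neg (κ : ℂ) (x : E3) : gk κ (-x) = gk κ x := by rw [gk_eq, gk_eq, norm_neg]

theorem volume_restrict_prod (B B' : Set E3) :
    ((volume : Measure E3).restrict B).prod ((volume : Measure E3).restrict B') =
      (volume.prod volume).restrict (B ×ˢ B') := Measure.prod_restrict B B'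

/-- The square is `O(‖x‖⁻²)`, which is locally integrable in dimension three. -/
theorem integrableOn_sq_norm_gk (κ : ℂ) {ρ : ℝ} (hρ : ρ ≠ 0) (r : ℝ) :
    IntegrableOn (fun x : E3 => ‖gk κ (ρ • x)‖ ^ 2) (Metric.ball 0 r) := by
  refine integrableOn_ball_of_norm_le_rpow (α := 2)
    (C := Real.exp (‖κ‖ * (|ρ| * r)) ^ 2 * |ρ|⁻¹ ^ 2) (by simp) (by simp; norm_num) ?_ ?_
  · refine (ae_restrict_mem Metric.isOpen_ball.measurableSet).mono fun x hx => ?_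
    have hx' : ‖x‖ ≤ r := (mem_ball_zero_iff.1 hx).le
    have h1 := norm_gk_le κ (ρ • x)
    rw [norm_smul, Real.norm_eq_abs, mul_inv] at h1
    have h2 : ‖gk κ (ρ • x)‖ ≤ Real.exp (‖κ‖ * (|ρ| * r)) * (|ρ|⁻¹ * ‖x‖⁻¹) := by
      refine h1.trans ?_
      gcongr
    rw [Real.norm_of_nonneg (sq_nonneg _), Real.rpow_neg (norm_nonneg x), Real.rpow_two]
    calc ‖gk κ (ρ • x)‖ ^ 2 ≤ (Real.exp (‖κ‖ * (|ρ| * r)) * (|ρ|⁻¹ * ‖x‖⁻¹)) ^ 2 := by gcongr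
      _ = _ := by ring
  · exact (((measurable_gk κ).comp (by fun_prop)).norm.pow_const 2).aestronglyMeasurable

/-- The kernel of the potential between two affine images of bounded sets. -/
def interKernel (a : E3) (ρ : ℝ) (κ : ℂ) (x y : E3) : ℂ := ρ * gk κ (a + ρ • (x - y))

theorem measurable_interKernel (a : E3) (ρ : ℝ) (κ : ℂ) :
    Measurable (Function.uncurry (interKernel a ρ κ)) := by
  have : Measurable fun p : E3 × E3 => a + ρ • (p.1 - p.2) := by fun_prop
  exact ((measurable_gk κ).comp this).const_mul _

/-- The squared kernel depends on `x - y` only. On the bounded set `B ×ˢ B'` it is a multiple of the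
convolution integrand of two integrable functions: the indicator of `B'` and a shifted square of
`gk` cut off to a large ball. -/
theorem memLp_interKernel (a : E3) (ρ : ℝ) (κ : ℂ) {B B' : Set E3} (hB : IsOpen B)
    (hB' : IsOpen B') (hb : Bornology.IsBounded B) (hb' : Bornology.IsBounded B') :
    MemLp (Function.uncurry (interKernel a ρ κ)) 2
      (((volume : Measure E3).restrict B).prod ((volume : Measure E3).restrict B')) := by
  rcases eq_or_ne ρ 0 with rfl | hρ
  · have : Function.uncurry (interKernel a 0 κ) = 0 := by
      ext p
      simp [interKernel, Function.uncurry]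
    rw [this]
    exact MemLp.zero
  rw [memLp_two_iff_integrable_sq_norm (measurable_interKernel a ρ κ).aestronglyMeasurable,
    volume_restrict_prod]
  obtain ⟨r, hr⟩ := hb.exists_norm_le
  obtain ⟨r', hr'⟩ := hb'.exists_norm_le
  set s : ℝ := r + r' + ‖ρ⁻¹ • a‖ + 1 with hs
  have h1 : Integrable (fun x : E3 =>
      (Metric.ball (0 : E3) s).indicator (fun x => ‖gk κ (ρ • x)‖ ^ 2) (x + ρ⁻¹ • a)) := by
    refine Integrable.comp_add_right (f := (Metric.ball (0 : E3) s).indicator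
      (fun x => ‖gk κ (ρ • x)‖ ^ 2)) ?_ (ρ⁻¹ • a)
    exact (integrable_indicator_iff Metric.isOpen_ball.measurableSet).2
      (integrableOn_sq_norm_gk κ hρ s)
  have h2 : Integrable (B'.indicator (fun _ : E3 => (1 : ℝ))) :=
    (integrable_indicator_iff hB'.measurableSet).2
      (integrableOn_const (hb'.measure_lt_top.ne))
  have h3 := (Integrable.convolution_integrand (ContinuousLinearMap.mul ℝ ℝ) h2 h1).const_mul
    (ρ ^ 2)
  refine (h3.restrict (s := B ×ˢ B')).congr ?_
  refine (ae_restrict_mem (hB.measurableSet.prod hB'.measurableSet)).mono fun p hp => ?_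
  have hmem : p.1 - p.2 + ρ⁻¹ • a ∈ Metric.ball (0 : E3) s := by
    rw [mem_ball_zero_iff]
    have e1 := norm_add_le (p.1 - p.2) (ρ⁻¹ • a)
    have e2 := norm_sub_le p.1 p.2
    have e3 := hr _ hp.1
    have e4 := hr' _ hp.2
    rw [hs]
    linarith
  have e : ρ • (p.1 - p.2 + ρ⁻¹ • a) = a + ρ • (p.1 - p.2) := by
    rw [smul_add, smul_inv_smul₀ hρ, add_comm]
  simp only [ContinuousLinearMap.mul_apply', indicator_of_mem hp.2, indicator_of_mem hmem, e,
    one_mul, Function.uncurry, interKernel, norm_mul, mul_pow, Complex.norm_real,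
    Real.norm_eq_abs, sq_abs]

end Resonators
end

/-! ### Dilation of the particles to their shapes. -/

noncomputable section
namespace Resonators
open Complex Set

/-- The affine map `x ↦ z + ρ x`. -/
abbrev dilate (z : E3) (ρ : ℝ) : E3 → E3 := fun x => z + ρ • x

theorem measurableEmbedding_dilate (z : E3) {ρ : ℝ} (hρ : 0 < ρ) :
    MeasurableEmbedding (dilate z ρ) :=
  (((Homeomorph.smulOfNeZero ρ hρ.ne').trans (Homeomorph.addLeft z)).measurableEmbedding)

theorem restrict_dilate_image (z : E3) {ρ : ℝ} (hρ : 0 < ρ) (B : Set E3) :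
    (volume : Measure E3).restrict (dilate z ρ '' B) =
      ENNReal.ofReal (ρ ^ 3) • ((volume : Measure E3).restrict B).map (dilate z ρ) := by
  have h1 : (volume : Measure E3).map (dilate z ρ) = ENNReal.ofReal (ρ ^ 3)⁻¹ • volume := by
    have e : dilate z ρ = (fun x => z + x) ∘ fun x => ρ • x := rfl
    rw [e, ← Measure.map_map (by fun_prop) (by fun_prop), Measure.map_addHaar_smul _ hρ.ne',
      Measure.map_smul, Measure.IsAddLeftInvariant.map_add_left_eq_self]
    simp [abs_of_pos hρ]
  have h2 : (volume : Measure E3) = ENNReal.ofReal (ρ ^ 3) • volume.map (dilate z ρ) := by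
    rw [h1, smul_smul, ← ENNReal.ofReal_mul (by positivity), mul_inv_cancel₀ (by positivity),
      ENNReal.ofReal_one, one_smul]
  conv_lhs => rw [h2]
  rw [Measure.restrict_smul, (measurableEmbedding_dilate z hρ).restrict_map,
    preimage_image_eq _ (measurableEmbedding_dilate z hρ).injective]

theorem ofReal_cube_ne_zero {ρ : ℝ} (hρ : 0 < ρ) : ENNReal.ofReal (ρ ^ 3) ≠ 0 := by
  simp only [ne_eq, ENNReal.ofReal_eq_zero, not_le]
  positivity

theorem ae_dilate_image_iff (z : E3) {ρ : ℝ} (hρ : 0 < ρ) (B : Set E3) (p : E3 → Prop) :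
    (∀ᵐ x ∂(volume : Measure E3).restrict (dilate z ρ '' B), p x) ↔
      ∀ᵐ x ∂(volume : Measure E3).restrict B, p (dilate z ρ x) := by
  rw [restrict_dilate_image z hρ, Measure.ae_ennreal_smul_measure_iff (ofReal_cube_ne_zero hρ),
    (measurableEmbedding_dilate z hρ).ae_map_iff]

theorem integral_dilate_image (z : E3) {ρ : ℝ} (hρ : 0 < ρ) (B : Set E3) (f : E3 → ℂ) :
    ∫ x in dilate z ρ '' B, f x = (ρ : ℂ) ^ 3 * ∫ x in B, f (dilate z ρ x) := by
  rw [restrict_dilate_image z hρ, integral_smul_measure,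
    (measurableEmbedding_dilate z hρ).integral_map, ENNReal.toReal_ofReal (by positivity)]
  rw [Complex.real_smul]
  push_cast
  rfl

theorem memLp_dilate_image_iff (z : E3) {ρ : ℝ} (hρ : 0 < ρ) (B : Set E3) {f : E3 → ℂ} :
    MemLp f 2 ((volume : Measure E3).restrict (dilate z ρ '' B)) ↔
      MemLp (f ∘ dilate z ρ) 2 ((volume : Measure E3).restrict B) := by
  rw [restrict_dilate_image z hρ, ← (measurableEmbedding_dilate z hρ).memLp_map_measure_iff]
  refine ⟨fun h => ?_, fun h => h.smul_measure ENNReal.ofReal_ne_top⟩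
  have := h.smul_measure (c := (ENNReal.ofReal (ρ ^ 3))⁻¹)
    (ENNReal.inv_ne_top.2 (ofReal_cube_ne_zero hρ))
  rwa [smul_smul, ENNReal.inv_mul_cancel (ofReal_cube_ne_zero hρ) ENNReal.ofReal_ne_top,
    one_smul] at this

/-- The normalisation factor of the pull-back along `dilate z ρ`. -/
def jac (ρ : ℝ) : ℂ := (Real.sqrt (ρ ^ 3) : ℝ)

theorem jac_mul_jac {ρ : ℝ} (hρ : 0 < ρ) : jac ρ * jac ρ = (ρ : ℂ) ^ 3 := by
  rw [jac, ← Complex.ofReal_mul, Real.mul_self_sqrt (by positivity)]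
  push_cast
  rfl

theorem jac_ne_zero {ρ : ℝ} (hρ : 0 < ρ) : jac ρ ≠ 0 := fun h => by
  have := jac_mul_jac hρ
  rw [h, mul_zero] at this
  exact pow_ne_zero 3 (by exact_mod_cast hρ.ne' : (ρ : ℂ) ≠ 0) this.symm

theorem conj_jac (ρ : ℝ) : (starRingEnd ℂ) (jac ρ) = jac ρ := Complex.conj_ofReal _

theorem memLp_jac_mul_comp_dilate (z : E3) {ρ : ℝ} (hρ : 0 < ρ) (B : Set E3)
    (u : L2 (dilate z ρ '' B)) :
    MemLp (fun x => jac ρ * u (dilate z ρ x)) 2 ((volume : Measure E3).restrict B) :=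
  ((memLp_dilate_image_iff z hρ B).1 (Lp.memLp u)).const_mul _

variable (z : E3) {ρ : ℝ} (hρ : 0 < ρ) (B : Set E3)

/-- The unitary map from functions on `z + ρ B` to functions on `B`. -/
def pullLin : L2 (dilate z ρ '' B) →ₗ[ℂ] L2 B where
  toFun u := (memLp_jac_mul_comp_dilate z hρ B u).toLp _
  map_add' u v := by
    rw [← MemLp.toLp_add]
    refine (MemLp.toLp_eq_toLp_iff _ _).2 ?_
    filter_upwards [(ae_dilate_image_iff z hρ B _).1 (Lp.coeFn_add u v)] with x hx
    simp only [hx, Pi.add_apply, mul_add]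
  map_smul' c u := by
    rw [RingHom.id_apply, ← MemLp.toLp_const_smul]
    refine (MemLp.toLp_eq_toLp_iff _ _).2 ?_
    filter_upwards [(ae_dilate_image_iff z hρ B _).1 (Lp.coeFn_smul c u)] with x hx
    simp only [hx, Pi.smul_apply, smul_eq_mul]
    ring

theorem pullLin_ae (u : L2 (dilate z ρ '' B)) :
    pullLin z hρ B u =ᵐ[(volume : Measure E3).restrict B] fun x => jac ρ * u (dilate z ρ x) :=
  (memLp_jac_mul_comp_dilate z hρ B u).coeFn_toLp

theorem inner_pullLin (u v : L2 (dilate z ρ '' B)) :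
    inner ℂ (pullLin z hρ B u) (pullLin z hρ B v) = inner ℂ u v := by
  rw [L2.inner_def, L2.inner_def, integral_dilate_image z hρ, ← integral_const_mul]
  refine integral_congr_ae ?_
  filter_upwards [pullLin_ae z hρ B u, pullLin_ae z hρ B v] with x hx hx'
  rw [hx, hx', ← jac_mul_jac hρ]
  simp only [RCLike.inner_apply, map_mul, conj_jac]
  ring

theorem pullLin_surjective : Function.Surjective (pullLin z hρ B) := fun w => by
  have hinv : ∀ x, ρ⁻¹ • (dilate z ρ x - z) = x := fun x => by
    simp [dilate, smul_smul, inv_mul_cancel₀ hρ.ne']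
  have hm : MemLp (fun x => (jac ρ)⁻¹ * w (ρ⁻¹ • (x - z))) 2
      ((volume : Measure E3).restrict (dilate z ρ '' B)) := by
    rw [memLp_dilate_image_iff z hρ B]
    refine MemLp.const_mul ?_ _
    have : (fun x => w (ρ⁻¹ • (dilate z ρ x - z))) = w := funext fun x => by rw [hinv x]
    rw [this]
    exact Lp.memLp w
  refine ⟨hm.toLp _, Lp.ext ?_⟩
  filter_upwards [pullLin_ae z hρ B (hm.toLp _),
    (ae_dilate_image_iff z hρ B _).1 hm.coeFn_toLp] with x h1 h2
  rw [h1, h2, hinv x, mul_inv_cancel_left₀ (jac_ne_zero hρ)]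

/-- The unitary equivalence of the square-integrable functions on `z + ρ B` and on `B`. -/
def pull : L2 (dilate z ρ '' B) ≃ₗᵢ[ℂ] L2 B :=
  LinearIsometryEquiv.ofSurjective ((pullLin z hρ B).isometryOfInner (inner_pullLin z hρ B))
    (pullLin_surjective z hρ B)

theorem pull_ae (u : L2 (dilate z ρ '' B)) :
    pull z hρ B u =ᵐ[(volume : Measure E3).restrict B] fun x => jac ρ * u (dilate z ρ x) :=
  pullLin_ae z hρ B u

/-- The rescaled integral operators. -/
def interOp (a : E3) (ρ : ℝ) (κ : ℂ) {B B' : Set E3} (hB : IsOpen B ∧ Bornology.IsBounded B)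
    (hB' : IsOpen B' ∧ Bornology.IsBounded B') : L2 B' →L[ℂ] L2 B :=
  kernelOp (interKernel a ρ κ) (memLp_interKernel a ρ κ hB.1 hB'.1 hB.2 hB'.2)

/-- Of the Jacobian `ρ³` one factor `ρ` goes into `interKernel`, which leaves `ρ²`. The factor `jac
ρ` normalises the pull-back of `u`. -/
theorem jac_mul_potential_ae (z' : E3) (κ : ℂ) {B B' : Set E3}
    (hB : IsOpen B ∧ Bornology.IsBounded B) (hB' : IsOpen B' ∧ Bornology.IsBounded B')
    (u : L2 (dilate z' ρ '' B')) :
    ∀ᵐ x ∂(volume : Measure E3).restrict B,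
      jac ρ * potential κ (dilate z' ρ '' B') u (dilate z ρ x) =
        (ρ : ℂ) ^ 2 * interOp (z - z') ρ κ hB hB' (pull z' hρ B' u) x := by
  filter_upwards [kernelOp_apply_ae (interKernel (z - z') ρ κ)
    (memLp_interKernel (z - z') ρ κ hB.1 hB'.1 hB.2 hB'.2) (pull z' hρ B' u)] with x hx
  rw [interOp, hx, potential_eq, integral_dilate_image z' hρ, ← integral_const_mul,
    ← integral_const_mul, ← integral_const_mul]
  refine integral_congr_ae ?_
  filter_upwards [pull_ae z' hρ B' u] with y hy
  rw [hy, interKernel]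
  have : dilate z ρ x - dilate z' ρ y = z - z' + ρ • (x - y) := by
    simp only [dilate, smul_sub]
    abel
  rw [this]
  ring

theorem eigenEq_iff (κ : ℂ) {B : Set E3} (hB : IsOpen B ∧ Bornology.IsBounded B) (lam : ℂ)
    (φ : L2 (dilate z ρ '' B)) :
    EigenEq κ (dilate z ρ '' B) lam φ ↔
      interOp 0 ρ κ hB hB (pull z hρ B φ) = (lam / (ρ : ℂ) ^ 2) • pull z hρ B φ := by
  have hρ' : (ρ : ℂ) ≠ 0 := by exact_mod_cast hρ.ne'
  have h1 := jac_mul_potential_ae z hρ z κ hB hB φ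
  rw [sub_self] at h1
  have h2 := Lp.coeFn_smul (lam / (ρ : ℂ) ^ 2) (pull z hρ B φ)
  rw [EigenEq, ae_dilate_image_iff z hρ]
  constructor
  · intro h
    refine Lp.ext ?_
    filter_upwards [h, h1, h2, pull_ae z hρ B φ] with x e e1 e2 e3
    rw [e2, Pi.smul_apply, e3, smul_eq_mul]
    rw [e] at e1
    field_simp
    linear_combination -e1
  · intro h
    rw [h] at h1
    filter_upwards [h1, h2, pull_ae z hρ B φ] with x e1 e2 e3
    rw [e2, Pi.smul_apply, e3, smul_eq_mul] at e1
    refine mul_left_cancel₀ (jac_ne_zero hρ) (e1.trans ?_)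
    field_simp

theorem pairing_eq (z' : E3) (κ : ℂ) {B B' : Set E3}
    (hB : IsOpen B ∧ Bornology.IsBounded B) (hB' : IsOpen B' ∧ Bornology.IsBounded B')
    (u : L2 (dilate z' ρ '' B')) (v : L2 (dilate z ρ '' B)) :
    pairing κ (dilate z' ρ '' B') (dilate z ρ '' B) u v =
      (ρ : ℂ) ^ 2 * inner ℂ (pull z hρ B v) (interOp (z - z') ρ κ hB hB' (pull z' hρ B' u)) := by
  rw [pairing, integral_dilate_image z hρ, L2.inner_def, ← integral_const_mul,
    ← integral_const_mul]
  refine integral_congr_ae ?_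
  filter_upwards [jac_mul_potential_ae z hρ z' κ hB hB' u, pull_ae z hρ B v] with x h1 h2
  rw [h2, ← jac_mul_jac hρ]
  simp only [RCLike.inner_apply, map_mul, conj_jac]
  linear_combination (jac ρ * (starRingEnd ℂ) (v (dilate z ρ x))) * h1

end Resonators
end

/-! ### The resonance problem and `det 𝒦` after rescaling. -/

noncomputable section
namespace Resonators
open Complex Set

/-- Away from the poles the cleared determinant differs from `det 𝒦` by a nonzero factor, so the
case distinction disappears. -/
theorem detVanishes_iff {N : ℕ} (m : Medium) (k : ℂ) (D : Fin N → Set E3) (δ : ℝ) (ω : ℂ)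
    (lam : Fin N → ℂ) (φ : (i : Fin N) → L2 (D i)) :
    DetVanishes m k D δ ω lam φ ↔ (calKCleared m k D δ ω lam φ).det = 0 := by
  rw [DetVanishes]
  by_cases h : ∀ i, 1 - m.factor k δ ω * lam i ≠ 0
  · have h' : ¬ ∃ i, 1 - m.factor k δ ω * lam i = 0 := by
      push Not
      exact h
    rw [det_calKCleared m k D δ ω lam φ h]
    simp only [h', false_and, or_false, mul_eq_zero,
      Finset.prod_ne_zero_iff.2 fun i _ => h i, false_or]
    exact and_iff_right h
  · have h' : ∃ i, 1 - m.factor k δ ω * lam i = 0 := by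
      push Not at h
      exact h
    simp only [h, false_and, false_or, h', true_and]

variable {N : ℕ} {B : Fin N → Set E3} (hB : ∀ i, IsOpen (B i) ∧ Bornology.IsBounded (B i))
  (z : Fin N → E3) {ρ : ℝ} (hρ : 0 < ρ)

/-- The rescaled operators between the shapes. -/
def scatterOp (ρ : ℝ) (κ : ℂ) (i j : Fin N) : L2 (B j) →L[ℂ] L2 (B i) :=
  interOp (z i - z j) ρ κ (hB i) (hB j)

theorem scatterOp_self (ρ : ℝ) (κ : ℂ) (i : Fin N) :
    scatterOp hB z ρ κ i i = interOp 0 ρ κ (hB i) (hB i) := by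
  rw [scatterOp, sub_self]

variable (B) in
/-- The unitary equivalence of functions on a particle and on its shape. -/
def toShape (i : Fin N) : L2 (particle B z ρ i) ≃ₗᵢ[ℂ] L2 (B i) := pull (z i) hρ (B i)

theorem isEigenpairNear_iff (m : Medium) (r : ℝ) (lam0 : ℝ) (i : Fin N) (δ : ℝ) (ω lam : ℂ)
    (φ : L2 (particle B z ρ i)) :
    IsEigenpairNear m r ρ lam0 (particle B z ρ i) δ ω lam φ ↔
      IsUnitPair (scatterOp hB z ρ (δ * m.k0 ω) i i) lam0 r (lam / (ρ : ℂ) ^ 2)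
        (toShape B z hρ i φ) := by
  have hρ' : (ρ : ℂ) ≠ 0 := by exact_mod_cast hρ.ne'
  rw [IsEigenpairNear, IsUnitPair, LinearIsometryEquiv.norm_map, scatterOp_self]
  refine and_congr Iff.rfl (and_congr (eigenEq_iff (z i) hρ _ (hB i) lam φ) ?_)
  have h1 : lam - (ρ : ℂ) ^ 2 * lam0 = (ρ : ℂ) ^ 2 * (lam / (ρ : ℂ) ^ 2 - lam0) := by
    field_simp
  rw [h1, norm_mul, norm_pow, Complex.norm_real, Real.norm_of_nonneg hρ.le, mul_comm r]
  exact mul_le_mul_iff_of_pos_left (by positivity)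

theorem pairing_particle (κ : ℂ) (i j : Fin N) (u : L2 (particle B z ρ j))
    (v : L2 (particle B z ρ i)) :
    pairing κ (particle B z ρ j) (particle B z ρ i) u v =
      (ρ : ℂ) ^ 2 * inner ℂ (toShape B z hρ i v) (scatterOp hB z ρ κ i j (toShape B z hρ j u)) :=
  pairing_eq (z i) hρ (z j) κ (hB i) (hB j) u v

/-- The determinant of the cleared matrix in terms of the rescaled operators. -/
theorem det_calKCleared_eq (m : Medium) (k : ℂ) (δ : ℝ) (ω : ℂ) (hF : m.factor k δ ω ≠ 0)
    (lam : Fin N → ℂ) (φ : (i : Fin N) → L2 (particle B z ρ i)) :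
    (calKCleared m k (particle B z ρ) δ ω lam φ).det =
      (∏ i, calK m k (particle B z ρ) δ ω lam φ i i) *
        ((m.factor k δ ω * (ρ : ℂ) ^ 2) ^ N *
          ((1 / (m.factor k δ ω * (ρ : ℂ) ^ 2)) • (1 : Matrix (Fin N) (Fin N) ℂ) -
            modeMatrix (scatterOp hB z ρ (δ * m.k0 ω)) (fun i => lam i / (ρ : ℂ) ^ 2)
              fun i => toShape B z hρ i (φ i)).det) := by
  have hρ' : (ρ : ℂ) ≠ 0 := by exact_mod_cast hρ.ne'
  -- Every entry of row `i` contains the pairing of `D_i` with its successor, that is `𝒦_ii`.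
  -- Pulling it out explains why a zero of the determinant is informative only if no `𝒦_ii`
  -- vanishes.
  have h1 : calKCleared m k (particle B z ρ) δ ω lam φ =
      Matrix.diagonal (fun i => calK m k (particle B z ρ) δ ω lam φ i i) *
        ((m.factor k δ ω * (ρ : ℂ) ^ 2) •
          ((1 / (m.factor k δ ω * (ρ : ℂ) ^ 2)) • (1 : Matrix (Fin N) (Fin N) ℂ) -
            modeMatrix (scatterOp hB z ρ (δ * m.k0 ω)) (fun i => lam i / (ρ : ℂ) ^ 2)
              fun i => toShape B z hρ i (φ i))) := by
    ext i j
    rw [Matrix.diagonal_mul]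
    simp only [calKCleared, calK, Matrix.of_apply, if_true, Matrix.smul_apply, Matrix.sub_apply,
      modeMatrix, smul_eq_mul]
    by_cases hij : i = j
    · subst hij
      simp only [if_true, Matrix.one_apply_eq]
      field_simp
    · simp only [if_neg hij, Matrix.one_apply_ne hij, pairing_particle hB z hρ _ i j]
      ring
  rw [h1, Matrix.det_mul, Matrix.det_diagonal, Matrix.det_smul, Fintype.card_fin]

/-- Conjugation by the unitaries `toShape` and division by `δ²ω²ξρ²`; the self term and the sum over
`j ≠ i` together form one row of the block operator. -/
theorem isResonance_iff {ρ : ℝ} (hρ : 0 < ρ) (m : Medium) (k : ℂ) (δ : ℝ) (ω : ℂ) (hF : m.factor k δ ω ≠ 0) :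
    IsResonance m k (particle B z ρ) δ ω ↔
      ∃ u : HilbertSum fun i => L2 (B i), u ≠ 0 ∧
        blockOp (scatterOp hB z ρ (δ * m.k0 ω)) u =
          (1 / (m.factor k δ ω * (ρ : ℂ) ^ 2)) • u := by
  have hρ' : (ρ : ℂ) ≠ 0 := by exact_mod_cast hρ.ne'
  set F := m.factor k δ ω with hFdef
  set κ := (δ : ℂ) * m.k0 ω
  have key : ∀ (u : (i : Fin N) → L2 (particle B z ρ i)) (i : Fin N),
      (∀ᵐ x ∂((volume : Measure E3).restrict (particle B z ρ i)),
        u i x - F * potential κ (particle B z ρ i) (u i) x - F *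
          ∑ j ∈ Finset.univ.erase i, potential κ (particle B z ρ j) (u j) x = 0) ↔
      ∑ j, scatterOp hB z ρ κ i j (toShape B z hρ j (u j)) =
        (1 / (F * (ρ : ℂ) ^ 2)) • toShape B z hρ i (u i) := by
    intro u i
    have h1 : ∀ᵐ x ∂(volume : Measure E3).restrict (B i), ∀ j,
        jac ρ * potential κ (particle B z ρ j) (u j) (dilate (z i) ρ x) =
          (ρ : ℂ) ^ 2 * scatterOp hB z ρ κ i j (toShape B z hρ j (u j)) x :=
      ae_all_iff.2 fun j => jac_mul_potential_ae (z i) hρ (z j) κ (hB i) (hB j) (u j)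
    have h2 := pull_ae (z i) hρ (B i) (u i)
    have h3 := Lp.coeFn_smul (1 / (F * (ρ : ℂ) ^ 2)) (toShape B z hρ i (u i))
    have h4 := Lp.coeFn_finsetSum Finset.univ
      fun j => scatterOp hB z ρ κ i j (toShape B z hρ j (u j))
    have h5 : ∀ x, F * potential κ (particle B z ρ i) (u i) x + F *
          ∑ j ∈ Finset.univ.erase i, potential κ (particle B z ρ j) (u j) x =
        F * ∑ j, potential κ (particle B z ρ j) (u j) x := fun x => by
      rw [← Finset.add_sum_erase _ _ (Finset.mem_univ i), mul_add]
    simp only [sub_sub, h5]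
    have h6 : ∀ᵐ x ∂(volume : Measure E3).restrict (B i),
        jac ρ * (u i (dilate (z i) ρ x) -
            F * ∑ j, potential κ (particle B z ρ j) (u j) (dilate (z i) ρ x)) =
          (F * (ρ : ℂ) ^ 2) * (((1 / (F * (ρ : ℂ) ^ 2)) • toShape B z hρ i (u i)) x -
            (∑ j, scatterOp hB z ρ κ i j (toShape B z hρ j (u j)) : L2 (B i)) x) := by
      filter_upwards [h1, h2, h3, h4] with x e1 e2 e3 e4
      have e2' : (toShape B z hρ i (u i)) x = jac ρ * u i (dilate (z i) ρ x) := e2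
      rw [e3, e4, Pi.smul_apply, e2', Finset.sum_apply, mul_sub, mul_left_comm, Finset.mul_sum]
      simp only [e1, ← Finset.mul_sum, smul_eq_mul]
      field_simp
    refine (ae_dilate_image_iff (z i) hρ (B i) _).trans ?_
    constructor
    · intro h
      refine Lp.ext ?_
      filter_upwards [h, h6] with x e e6
      rw [e, mul_zero] at e6
      exact (sub_eq_zero.1 ((mul_eq_zero.1 e6.symm).resolve_left
        (mul_ne_zero hF (pow_ne_zero 2 hρ')))).symm
    · intro h
      rw [h] at h6
      filter_upwards [h6] with x e6
      rw [sub_self, mul_zero] at e6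
      exact (mul_eq_zero.1 e6).resolve_left (jac_ne_zero hρ)
  rw [IsResonance]
  constructor
  · rintro ⟨u, hu, h⟩
    refine ⟨HilbertSum.mk fun i => toShape B z hρ i (u i), fun h0 => hu ?_, ?_⟩
    · ext1 i
      have : prj i (HilbertSum.mk fun i => toShape B z hρ i (u i)) =
          prj i (0 : HilbertSum fun i => L2 (B i)) := by rw [h0]
      rw [HilbertSum.prj_mk, map_zero] at this
      exact (toShape B z hρ i).map_eq_zero_iff.1 this
    · refine HilbertSum.ext_prj fun i => ?_
      rw [prj_blockOp, map_smul]
      exact (key u i).1 (h i)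
  · rintro ⟨u, hu, h⟩
    have hw : ∀ j, ∃ w : L2 (particle B z ρ j), toShape B z hρ j w = prj j u := fun j =>
      (toShape B z hρ j).surjective _
    choose w hw using hw
    refine ⟨w, fun h0 => hu ?_, fun i => (key w i).2 ?_⟩
    · refine HilbertSum.ext_prj fun i => ?_
      rw [← hw i, h0]
      simp only [Pi.zero_apply, map_zero]
    · have h' := congrArg (prj i) h
      rw [prj_blockOp, map_smul] at h'
      rw [hw i, ← h']
      exact Finset.sum_congr rfl fun j _ => by rw [hw j]

end Resonators
end

/-! ### Static operators and leading order interactions of the shapes. -/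

noncomputable section
namespace Resonators
open Complex Set

theorem exists_pos_forall_ge {ι : Type*} [Finite ι] (f : ι → ℝ) : ∃ C > 0, ∀ i, f i ≤ C := by
  obtain ⟨C, hC⟩ := (Set.finite_range f).bddAbove
  exact ⟨max C 1, by positivity, fun i => (hC ⟨i, rfl⟩).trans (le_max_left _ _)⟩

theorem exists_pos_forall_le {ι : Type*} [Finite ι] {f : ι → ℝ} (hf : ∀ i, 0 < f i) :
    ∃ c > 0, ∀ i, c ≤ f i := by
  obtain ⟨C, hC, h⟩ := exists_pos_forall_ge fun i => (f i)⁻¹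
  exact ⟨C⁻¹, inv_pos.2 hC, fun i => inv_le_of_inv_le₀ (hf i) (h i)⟩

section Gap

variable {H : Type*} [NormedAddCommGroup H] [InnerProductSpace ℂ H] [CompleteSpace H]

/-- For a compact symmetric operator, a number that is not an eigenvalue on the orthogonal
complement of a mode is separated from the rest of the spectrum. -/
theorem exists_isGapped {K : H →L[ℂ] H} (hK : IsCompactOperator K) {e : H} {lam : ℝ} {μ : ℂ}
    (hμ : μ ≠ 0) (he : ‖e‖ = 1) (hKe : K e = (lam : ℂ) • e)
    (hinner : ∀ u, inner ℂ e (K u) = lam * inner ℂ e u)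
    (h : ∀ u, K u = μ • u → inner ℂ e u = 0 → u = 0) : ∃ G, IsGapped K e lam μ G := by
  set D : H →L[ℂ] H := K - diagOp (fun _ : Fin 1 => e) fun _ => (lam : ℂ) with hD
  have hDu : ∀ u, D u = K u - ((lam : ℂ) * inner ℂ e u) • e := fun u => by
    simp [hD, diagOp_apply]
  have hcomp : IsCompactOperator D := by
    refine hK.sub ?_
    have : diagOp (fun _ : Fin 1 => e) (fun _ => (lam : ℂ)) =
        ((lam : ℂ) • innerSL ℂ e).smulRight e := by
      ext u
      simp [diagOp_apply]
    rw [this]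
    exact isCompactOperator_smulRight _ _
  have hee : inner ℂ e e = (1 : ℂ) := by
    rw [inner_self_eq_norm_sq_to_K, he]
    simp
  rcases IsCompactOperator.hasEigenvalue_or_mem_resolventSet hcomp hμ with hev | hres
  -- In this branch of the Fredholm alternative an eigenvector of `D` for `μ ≠ 0` is orthogonal to
  -- `e`, because `D` maps into the complement of `e`. It is then an eigenvector of `K`, which is
  -- excluded by `h`.
  · exfalso
    obtain ⟨u, hu⟩ := hev.exists_hasEigenvector
    have h1 : D u = μ • u := hu.apply_eq_smul
    have h2 : inner ℂ e u = (0 : ℂ) := by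
      have := congrArg (inner ℂ e) h1
      rw [hDu, inner_sub_right, hinner, inner_smul_right, hee, mul_one, sub_self,
        inner_smul_right] at this
      exact (mul_eq_zero.1 this.symm).resolve_left hμ
    refine hu.2 (h u ?_ h2)
    rw [← h1, hDu, h2]
    simp
  · rw [spectrum.mem_resolventSet_iff, Algebra.algebraMap_eq_smul_one] at hres
    obtain ⟨U, hU⟩ := hres
    refine ⟨(↑U⁻¹ : H →L[ℂ] H), he, hKe, hinner, ?_, ?_⟩
    · rw [← hD, ← hU]
      exact U.mul_inv
    · rw [← hD, ← hU]
      exact U.inv_mul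

end Gap

section Kernel

variable {X Y : Type*} [MeasurableSpace X] [MeasurableSpace Y] {μ : Measure X} {ν : Measure Y}
  [SFinite μ] [SFinite ν]

theorem kernelOp_const_mul (c : ℂ) {k : X → Y → ℂ}
    (hk : MemLp (Function.uncurry k) 2 (μ.prod ν))
    (hk' : MemLp (Function.uncurry fun x y => c * k x y) 2 (μ.prod ν)) :
    kernelOp (fun x y => c * k x y) hk' = c • kernelOp k hk := by
  refine ContinuousLinearMap.ext fun u => Lp.ext ?_
  filter_upwards [kernelOp_apply_ae _ hk' u, kernelOp_apply_ae k hk u,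
    Lp.coeFn_smul c (kernelOp k hk u)] with x h1 h2 h3
  rw [h1, _root_.smul_apply, h3, Pi.smul_apply, h2, smul_eq_mul, ← integral_const_mul]
  simp only [mul_assoc]

end Kernel

variable {N : ℕ} {B : Fin N → Set E3} (hB : ∀ i, IsOpen (B i) ∧ Bornology.IsBounded (B i))
  (z : Fin N → E3)

/-- The static operators of the shapes. -/
def shapeOp (i : Fin N) : L2 (B i) →L[ℂ] L2 (B i) := interOp 0 1 0 (hB i) (hB i)

theorem interKernel_zero_one (x y : E3) : interKernel 0 1 0 x y = gk 0 (x - y) := by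
  simp [interKernel]

theorem eigenEq_iff_shapeOp (i : Fin N) (lam : ℂ) (f : L2 (B i)) :
    EigenEq 0 (B i) lam f ↔ shapeOp hB i f = lam • f := by
  have h1 := kernelOp_apply_ae (interKernel 0 1 0)
    (memLp_interKernel 0 1 0 (hB i).1 (hB i).1 (hB i).2 (hB i).2) f
  have h2 := Lp.coeFn_smul lam f
  simp only [interKernel_zero_one] at h1
  simp only [EigenEq, potential_eq]
  constructor
  · intro h
    refine Lp.ext ?_
    filter_upwards [h, h1, h2] with x e e1 e2
    rw [e2, Pi.smul_apply, smul_eq_mul, ← e]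
    exact e1
  · intro h
    rw [← h] at h2
    filter_upwards [h1, h2] with x e1 e2
    rw [← e1]
    exact e2

/-- The static kernel is real and even. -/
theorem conj_inner_shapeOp (i : Fin N) (v u : L2 (B i)) :
    (starRingEnd ℂ) (inner ℂ v (shapeOp hB i u)) = inner ℂ u (shapeOp hB i v) := by
  have hk := memLp_interKernel 0 1 0 (hB i).1 (hB i).1 (hB i).2 (hB i).2
  refine conj_inner_kernelOp hk hk (fun x y => ?_) v u
  rw [interKernel_zero_one, interKernel_zero_one, gk_conj_zero, ← gk_neg, neg_sub]

theorem isFiniteMeasure_shape {B : Fin N → Set E3}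
    (hB : ∀ i, IsOpen (B i) ∧ Bornology.IsBounded (B i)) (i : Fin N) :
    IsFiniteMeasure ((volume : Measure E3).restrict (B i)) :=
  isFiniteMeasure_restrict.2 (hB i).2.measure_lt_top.ne

theorem memLp_constKernel {B : Fin N → Set E3}
    (hB : ∀ i, IsOpen (B i) ∧ Bornology.IsBounded (B i)) (c : ℂ) (i j : Fin N) :
    MemLp (Function.uncurry fun _ _ : E3 => c) 2
      (((volume : Measure E3).restrict (B i)).prod ((volume : Measure E3).restrict (B j))) := by
  have := isFiniteMeasure_shape hB i
  have := isFiniteMeasure_shape hB j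
  exact memLp_const c

/-- The leading order interactions. -/
def leadOp (i j : Fin N) : L2 (B j) →L[ℂ] L2 (B i) :=
  kernelOp (fun _ _ => gk 0 (z i - z j)) (memLp_constKernel hB _ i j)

theorem conj_inner_leadOp (i j : Fin N) (v : L2 (B i)) (u : L2 (B j)) :
    (starRingEnd ℂ) (inner ℂ v (leadOp hB z i j u)) = inner ℂ u (leadOp hB z j i v) := by
  refine conj_inner_kernelOp (memLp_constKernel hB _ i j) (memLp_constKernel hB _ j i)
    (fun x y => ?_) v u
  rw [gk_conj_zero, ← gk_neg, neg_sub]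

/-- A constant kernel gives a rank one operator. Through this formula the means of the modes enter
item 4. -/
theorem inner_leadOp (i j : Fin N) (v : L2 (B i)) (u : L2 (B j)) :
    inner ℂ v (leadOp hB z i j u) =
      gk 0 (z i - z j) * (∫ y in B j, u y) * (starRingEnd ℂ) (∫ x in B i, v x) := by
  rw [leadOp, inner_kernelOp, ← integral_conj, ← integral_const_mul]
  simp only [integral_const_mul]

/-- The normalised modes. -/
def unitMode (e : (i : Fin N) → L2 (B i)) (i : Fin N) : L2 (B i) := ((‖e i‖⁻¹ : ℝ) : ℂ) • e i

theorem norm_unitMode {e : (i : Fin N) → L2 (B i)} (he0 : ∀ i, e i ≠ 0) (i : Fin N) :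
    ‖unitMode e i‖ = 1 := by
  rw [unitMode, norm_smul, Complex.norm_real, norm_inv, norm_norm,
    inv_mul_cancel₀ (norm_ne_zero_iff.2 (he0 i))]

/-- If `lam0 i` were an eigenvalue of the `j`-th static operator with eigenvector orthogonal to `e
j`, separation would give `lam0 j = lam0 i` and simplicity would make the eigenvector a multiple of
`e j`. The constant may be enlarged beyond a prescribed `C`, so that one constant serves here and in
`IsNear`. -/
theorem exists_isModeFamily (C : ℝ) {lam0 : Fin N → ℝ} (hlam0 : ∀ i, lam0 i ≠ 0)
    {e : (i : Fin N) → L2 (B i)} (he0 : ∀ i, e i ≠ 0)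
    (he : ∀ i, EigenEq 0 (B i) (lam0 i) (e i))
    (hsimple : ∀ i, ∀ f : L2 (B i), EigenEq 0 (B i) (lam0 i) f → ∃ c : ℂ, f = c • e i)
    (hsep : ∀ i j, IsEigenvalue 0 (B j) (lam0 i) → lam0 j = lam0 i) :
    ∃ M C', C ≤ C' ∧ IsModeFamily (shapeOp hB) (unitMode e) lam0 (leadOp hB z) M C' := by
  have h1 : ∀ p : Fin N × Fin N, ∃ G,
      IsGapped (shapeOp hB p.2) (unitMode e p.2) (lam0 p.2) (lam0 p.1) G := by
    rintro ⟨i, j⟩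
    have hKe : shapeOp hB j (unitMode e j) = (lam0 j : ℂ) • unitMode e j := by
      rw [unitMode, map_smul, (eigenEq_iff_shapeOp hB j _ _).1 (he j), smul_comm]
    have hc : IsCompactOperator (shapeOp hB j) := isCompactOperator_kernelOp _
      (memLp_interKernel 0 1 0 (hB j).1 (hB j).1 (hB j).2 (hB j).2)
    refine exists_isGapped hc (by exact_mod_cast hlam0 i)
      (norm_unitMode he0 j) hKe (fun u => ?_) fun u hu h0 => ?_
    · rw [← Complex.conj_conj (inner ℂ (unitMode e j) (shapeOp hB j u)), conj_inner_shapeOp, hKe,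
        inner_smul_right, map_mul, Complex.conj_ofReal, inner_conj_symm]
    · by_contra hu0
      have hE := (eigenEq_iff_shapeOp hB j _ _).2 hu
      have hl := hsep i j ⟨u, hu0, hE⟩
      change EigenEq 0 (B j) (lam0 i) u at hE
      rw [← hl] at hE
      obtain ⟨c, rfl⟩ := hsimple j u hE
      have hej : (‖e j‖ : ℂ) ≠ 0 := by exact_mod_cast norm_ne_zero_iff.2 (he0 j)
      rw [unitMode, inner_smul_left, inner_smul_right, inner_self_eq_norm_sq_to_K,
        Complex.conj_ofReal] at h0
      have hc : c = 0 := by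
        simpa [hej] using h0
      exact hu0 (by rw [hc, zero_smul])
  choose G hG using h1
  obtain ⟨M, hM, hGM⟩ := exists_pos_forall_ge fun p => ‖G p‖
  obtain ⟨C₁, hC₁, hRC⟩ := exists_pos_forall_ge fun p : Fin N × Fin N => ‖leadOp hB z p.1 p.2‖
  exact ⟨M, max C C₁, le_max_left _ _, hM, lt_max_of_lt_right hC₁, hlam0,
    fun i j => ⟨G (i, j), hGM (i, j), hG (i, j)⟩, fun i j => conj_inner_leadOp hB z i j _ _,
    fun i j => (hRC (i, j)).trans (le_max_right _ _)⟩

theorem exists_diam_bound {B : Fin N → Set E3}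
    (hB : ∀ i, IsOpen (B i) ∧ Bornology.IsBounded (B i)) :
     ∃ L > 0, ∀ i j, ∀ p : E3 × E3, p ∈ B i ×ˢ B j → ‖p.1 - p.2‖ ≤ L := by
  have h : ∀ i, ∃ r, ∀ x ∈ B i, ‖x‖ ≤ r := fun i => (hB i).2.exists_norm_le
  choose r hr using h
  obtain ⟨C, hC, hrC⟩ := exists_pos_forall_ge r
  refine ⟨C + C, by positivity, fun i j p hp => (norm_sub_le _ _).trans ?_⟩
  exact add_le_add ((hr i _ hp.1).trans (hrC i)) ((hr j _ hp.2).trans (hrC j))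

theorem norm_kernelOp_sub_le_of_forall {B : Fin N → Set E3}
    (hB : ∀ i, IsOpen (B i) ∧ Bornology.IsBounded (B i)) {i j : Fin N} {k k' : E3 → E3 → ℂ}
    (hk : MemLp (Function.uncurry k) 2
      (((volume : Measure E3).restrict (B i)).prod ((volume : Measure E3).restrict (B j))))
    (hk' : MemLp (Function.uncurry k') 2
      (((volume : Measure E3).restrict (B i)).prod ((volume : Measure E3).restrict (B j))))
    {c : ℝ} (hc : 0 ≤ c) (h : ∀ p ∈ B i ×ˢ B j, ‖k p.1 p.2 - k' p.1 p.2‖ ≤ c) :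
    ‖kernelOp k hk - kernelOp k' hk'‖ ≤ c * Real.sqrt ((((volume : Measure E3).restrict (B i)).prod
      ((volume : Measure E3).restrict (B j))).real univ) := by
  have := isFiniteMeasure_shape hB i
  have := isFiniteMeasure_shape hB j
  refine norm_kernelOp_sub_le hk hk' hc ?_
  rw [volume_restrict_prod]
  exact (ae_restrict_mem ((hB i).1.measurableSet.prod (hB j).1.measurableSet)).mono h

/-- The rescaled operators depend continuously on the wavenumber. -/
theorem continuousOn_scatterOp {ρ : ℝ} (hρ : 0 < ρ) (i j : Fin N) :
    ContinuousOn (fun κ => scatterOp hB z ρ κ i j) (Metric.closedBall 0 1) := by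
  obtain ⟨L, hL, hLB⟩ := exists_diam_bound hB
  set V := Real.sqrt ((((volume : Measure E3).restrict (B i)).prod
      ((volume : Measure E3).restrict (B j))).real univ) with hV
  set E := ρ * Real.exp (3 * (‖z i - z j‖ + ρ * L))
  refine LipschitzOnWith.continuousOn (K := Real.toNNReal (E * V))
    (LipschitzOnWith.of_dist_le_mul fun κ hκ κ' hκ' => ?_)
  rw [mem_closedBall_zero_iff] at hκ hκ'
  rw [Real.coe_toNNReal _ (by positivity), dist_eq_norm, dist_eq_norm]
  have := norm_kernelOp_sub_le_of_forall hB
    (memLp_interKernel (z i - z j) ρ κ (hB i).1 (hB j).1 (hB i).2 (hB j).2)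
    (memLp_interKernel (z i - z j) ρ κ' (hB i).1 (hB j).1 (hB i).2 (hB j).2)
    (c := E * ‖κ - κ'‖) (by positivity) fun p hp => ?_
  · exact this.trans (le_of_eq (by ring))
  · rw [interKernel, interKernel, ← mul_sub, norm_mul, Complex.norm_real,
      Real.norm_of_nonneg hρ.le, mul_assoc]
    gcongr
    refine norm_gk_sub_gk_le hκ hκ' ((norm_add_le _ _).trans ?_)
    rw [norm_smul, Real.norm_of_nonneg hρ.le]
    gcongr
    exact hLB i j p hp

/-- The rescaled operators are close to the static ones and the leading order interactions. -/
theorem exists_isNear (hz : Function.Injective z) {C₃ : ℝ} (hC₃ : 0 < C₃) :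
    ∃ C > 0, ∃ ρ₀ > 0, ∀ ρ, 0 < ρ → ρ ≤ ρ₀ → ∀ κ : ℂ, ‖κ‖ ≤ C₃ * ρ →
      IsNear (shapeOp hB) (leadOp hB z) (scatterOp hB z ρ κ) C ρ := by
  obtain ⟨L, hL, hLB⟩ := exists_diam_bound hB
  obtain ⟨V, hV, hVB⟩ := exists_pos_forall_ge fun p : Fin N × Fin N =>
    Real.sqrt ((((volume : Measure E3).restrict (B p.1)).prod
      ((volume : Measure E3).restrict (B p.2))).real univ)
  obtain ⟨A, hA, hzA⟩ := exists_pos_forall_ge fun p : Fin N × Fin N => ‖z p.1 - z p.2‖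
  obtain ⟨d, hd, hzd⟩ := exists_pos_forall_le
    (f := fun p : {p : Fin N × Fin N // p.1 ≠ p.2} => ‖z p.1.1 - z p.1.2‖)
    fun p => norm_pos_iff.2 (sub_ne_zero.2 (hz.ne p.2))
  -- In `Q` the summand `E * C₃` accounts for the wavenumber and `2 * L / d ^ 2` for the extent of
  -- the particles compared with their least distance.
  set E := Real.exp (3 * (A + L))
  set Q := E * C₃ + 2 * L / d ^ 2 with hQ
  have hE : 0 < E := Real.exp_pos _
  have hQ0 : 0 < Q := by positivity
  refine ⟨Q * V, by positivity, min 1 (min C₃⁻¹ (d / (2 * L))), by positivity,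
    fun ρ hρ hρ₀ κ hκ i j => ?_⟩
  have hρ1 : ρ ≤ 1 := hρ₀.trans (min_le_left _ _)
  have hρ2 : ρ ≤ C₃⁻¹ := hρ₀.trans ((min_le_right _ _).trans (min_le_left _ _))
  have hρ3 : ρ ≤ d / (2 * L) := hρ₀.trans ((min_le_right _ _).trans (min_le_right _ _))
  have hκ1 : ‖κ‖ ≤ 1 := hκ.trans (by
    calc C₃ * ρ ≤ C₃ * C₃⁻¹ := by gcongr
      _ = 1 := mul_inv_cancel₀ hC₃.ne')
  have hfin : Q * ρ ^ 2 * Real.sqrt ((((volume : Measure E3).restrict (B i)).prod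
      ((volume : Measure E3).restrict (B j))).real univ) ≤ Q * V * ρ ^ 2 := by
    calc _ ≤ Q * ρ ^ 2 * V := by
          gcongr
          exact hVB (i, j)
      _ = _ := by ring
  by_cases hij : i = j
  · subst hij
    rw [if_pos rfl, diagFamily_self, scatterOp_self]
    refine (norm_kernelOp_sub_le_of_forall hB
      (memLp_interKernel 0 ρ κ (hB i).1 (hB i).1 (hB i).2 (hB i).2)
      (memLp_interKernel 0 1 0 (hB i).1 (hB i).1 (hB i).2 (hB i).2) (c := Q * ρ ^ 2) (by positivity)
      fun p hp => ?_).trans hfin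
    rw [interKernel_zero_one, interKernel, zero_add, mul_gk_smul hρ]
    -- On the diagonal the rescaled wavenumber is already `O(ρ²)`, and the kernel is Lipschitz in
    -- it.
    have hρκ : ‖(ρ : ℂ) * κ‖ ≤ C₃ * ρ ^ 2 := by
      rw [norm_mul, Complex.norm_real, Real.norm_of_nonneg hρ.le]
      calc ρ * ‖κ‖ ≤ ρ * (C₃ * ρ) := by gcongr
        _ = C₃ * ρ ^ 2 := by ring
    have hρκ1 : ‖(ρ : ℂ) * κ‖ ≤ 1 := by
      rw [norm_mul, Complex.norm_real, Real.norm_of_nonneg hρ.le]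
      exact mul_le_one₀ hρ1 (norm_nonneg _) hκ1
    have h1 := norm_gk_sub_gk_le hρκ1 (κ' := 0) (by simp)
      ((hLB i i p hp).trans (le_add_of_nonneg_left hA.le))
    rw [sub_zero] at h1
    calc _ ≤ E * (C₃ * ρ ^ 2) := h1.trans (by gcongr)
      _ ≤ Q * ρ ^ 2 := by
        rw [← mul_assoc]
        gcongr
        rw [hQ]
        exact le_add_of_nonneg_right (by positivity)
  · have hk' : MemLp (Function.uncurry fun _ _ : E3 => (ρ : ℂ) * gk 0 (z i - z j)) 2
        (((volume : Measure E3).restrict (B i)).prod ((volume : Measure E3).restrict (B j))) :=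
      memLp_constKernel hB _ i j
    -- Off the diagonal the kernel deviates from its value between the centres by `O(ρ)`, and the
    -- factor `ρ` of `interKernel` gives the second power.
    rw [if_neg hij, leadOp, ← kernelOp_const_mul _ _ hk']
    refine (norm_kernelOp_sub_le_of_forall hB
      (memLp_interKernel (z i - z j) ρ κ (hB i).1 (hB j).1 (hB i).2 (hB j).2) hk' (c := Q * ρ ^ 2) (by positivity)
      fun p hp => ?_).trans hfin
    have hda : d ≤ ‖z i - z j‖ := hzd ⟨(i, j), hij⟩
    have haA : ‖z i - z j‖ ≤ A := hzA (i, j)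
    have hw := hLB i j p hp
    have hρL : ρ * L ≤ d / 2 := by
      calc ρ * L ≤ d / (2 * L) * L := by gcongr
        _ = d / 2 := by field_simp
    have h1 := norm_gk_add_sub_le hκ1 (sub_ne_zero.2 (hz.ne hij)) hρ.le hw
      (hρL.trans (by gcongr)) (L' := A + L) (by
        refine (norm_add_le _ _).trans (add_le_add haA ?_)
        rw [norm_smul, Real.norm_of_nonneg hρ.le]
        calc ρ * ‖p.1 - p.2‖ ≤ 1 * L := by gcongr
          _ = L := one_mul L)
    rw [interKernel, ← mul_sub, norm_mul, Complex.norm_real, Real.norm_of_nonneg hρ.le]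
    calc ρ * ‖gk κ (z i - z j + ρ • (p.1 - p.2)) - gk 0 (z i - z j)‖
        ≤ ρ * (E * (C₃ * ρ) + 2 * L / d ^ 2 * ρ) := by
          gcongr
          refine h1.trans ?_
          gcongr
      _ = Q * ρ ^ 2 := by ring

end Resonators
end

/-! ### The frequency as a function of the spectral parameter. -/

noncomputable section
namespace Resonators
open Complex Set

/-- The square root of `1 + x` with nonnegative real part. -/
def sqrtOneAdd (x : ℂ) : ℂ := Complex.exp (Complex.log (1 + x) / 2)

theorem one_add_ne_zero {x : ℂ} (hx : ‖x‖ < 1) : 1 + x ≠ 0 := fun h => by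
  have : x = -1 := by linear_combination h
  rw [this, norm_neg, norm_one] at hx
  exact lt_irrefl _ hx

theorem sqrtOneAdd_sq {x : ℂ} (hx : ‖x‖ < 1) : sqrtOneAdd x ^ 2 = 1 + x := by
  rw [sqrtOneAdd, ← Complex.exp_nat_mul]
  push_cast
  rw [mul_div_cancel₀ _ two_ne_zero, Complex.exp_log (one_add_ne_zero hx)]

theorem sqrtOneAdd_re_nonneg (x : ℂ) : 0 ≤ (sqrtOneAdd x).re := by
  have h1 : (Complex.log (1 + x) / 2).im = Complex.arg (1 + x) / 2 := by
    rw [← Complex.log_im]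
    simp
  rw [sqrtOneAdd, Complex.exp_re, h1]
  refine mul_nonneg (Real.exp_pos _).le (Real.cos_nonneg_of_neg_pi_div_two_le_of_le ?_ ?_)
  · linarith [Complex.neg_pi_lt_arg (1 + x)]
  · linarith [Complex.arg_le_pi (1 + x)]

theorem one_le_norm_one_add_sqrtOneAdd (x : ℂ) : 1 ≤ ‖1 + sqrtOneAdd x‖ := by
  refine le_trans ?_ (Complex.re_le_norm _)
  have := sqrtOneAdd_re_nonneg x
  simp only [Complex.add_re, Complex.one_re]
  linarith

theorem one_add_sqrtOneAdd_ne_zero (x : ℂ) : 1 + sqrtOneAdd x ≠ 0 :=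
  norm_pos_iff.1 (zero_lt_one.trans_le (one_le_norm_one_add_sqrtOneAdd x))

theorem continuousOn_sqrtOneAdd : ContinuousOn sqrtOneAdd (Metric.ball 0 1) := by
  have h : ContinuousOn (fun x : ℂ => Complex.log (1 + x)) (Metric.ball 0 1) :=
    (continuousOn_const.add continuousOn_id).clog fun x hx =>
      Complex.mem_slitPlane_of_norm_lt_one (mem_ball_zero_iff.1 hx)
  exact (h.div_const 2).cexp

/-- The small root of `b t² + m t = h`. -/
def smallRoot (b m h : ℂ) : ℂ := 2 * h / m / (1 + sqrtOneAdd (4 * b * h / m ^ 2))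

/-- The rationalised quadratic formula. It remains valid for `b = 0`, and its denominator `1 + √(1 +
x)` has modulus at least one, which selects the root of size `O(|h / m|)`. -/
theorem smallRoot_eq {b m h : ℂ} (hm : m ≠ 0) (hx : ‖4 * b * h / m ^ 2‖ < 1) :
    b * smallRoot b m h ^ 2 + m * smallRoot b m h = h := by
  have h1 := sqrtOneAdd_sq hx
  have h2 := one_add_sqrtOneAdd_ne_zero (4 * b * h / m ^ 2)
  rw [smallRoot]
  set r := sqrtOneAdd (4 * b * h / m ^ 2)
  have h3 : 4 * b * h = (r ^ 2 - 1) * m ^ 2 := by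
    rw [h1]
    field_simp
    ring
  field_simp
  linear_combination h * h3

theorem norm_smallRoot_le (b m h : ℂ) : ‖smallRoot b m h‖ ≤ 2 * ‖h‖ / ‖m‖ := by
  rw [smallRoot, norm_div, norm_div, norm_mul, Complex.norm_ofNat]
  exact div_le_self (by positivity) (one_le_norm_one_add_sqrtOneAdd _)

section Quadratic

variable {b : ℂ} {γ : ℝ}

/-- If `b v` were large, `b v - iγ` would be comparable with it, and `(b v - iγ) v = 1 + y` would
bound `‖b v‖²` by `4 ‖b‖`. -/
theorem norm_mul_le_of_quadratic (hγ : 0 < γ) {v y : ℂ} (hy : ‖y‖ ≤ 1)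
    (h : b * v ^ 2 - I * γ * v - 1 = y) : ‖b * v‖ ≤ 2 * γ + 1 + 4 * ‖b‖ := by
  by_contra! hlt
  have hg : ‖I * (γ : ℂ)‖ = γ := by
    rw [norm_mul, norm_I, one_mul, Complex.norm_real, Real.norm_of_nonneg hγ.le]
  have h1 : (b * v - I * γ) * v = 1 + y := by linear_combination h
  have h2 : ‖b * v - I * γ‖ * ‖v‖ ≤ 2 := by
    rw [← norm_mul, h1]
    exact (norm_add_le _ _).trans (by rw [norm_one]; linarith)
  have h3 : ‖b * v‖ - γ ≤ ‖b * v - I * γ‖ := by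
    have := norm_sub_norm_le (b * v) (I * γ)
    rwa [hg] at this
  have h4 : ‖b * v‖ / 2 ≤ ‖b * v - I * γ‖ := by linarith [norm_nonneg b]
  have h5 : ‖b * v‖ / 2 * ‖v‖ ≤ 2 := (by gcongr : _ ≤ _).trans h2
  have h6 : ‖b * v‖ * ‖b * v‖ ≤ 4 * ‖b‖ := by
    calc ‖b * v‖ * ‖b * v‖ = ‖b‖ * (2 * (‖b * v‖ / 2 * ‖v‖)) := by
          rw [norm_mul]
          ring
      _ ≤ ‖b‖ * (2 * 2) := by gcongr
      _ = 4 * ‖b‖ := by ring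
  have h7 : 1 < ‖b * v‖ := by linarith [norm_nonneg b]
  nlinarith

/-- Near `v = 0` the left side is close to `-1`. In terms of `ω = 1/v` this bounds the frequencies.
-/
theorem le_norm_of_quadratic (hγ : 0 < γ) {v y : ℂ} (hy : ‖y‖ ≤ 1 / 2)
    (h : b * v ^ 2 - I * γ * v - 1 = y) : min 1 (1 / (2 * (‖b‖ + γ))) ≤ ‖v‖ := by
  by_contra! hlt
  have hb := norm_nonneg b
  have h1 : ‖v‖ < 1 := hlt.trans_le (min_le_left _ _)
  have h2 : ‖v‖ < 1 / (2 * (‖b‖ + γ)) := hlt.trans_le (min_le_right _ _)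
  rw [lt_div_iff₀ (by positivity)] at h2
  have h3 : (1 : ℂ) = b * v ^ 2 - I * γ * v - y := by linear_combination -h
  have h4 : (1 : ℝ) ≤ ‖b‖ * ‖v‖ ^ 2 + γ * ‖v‖ + ‖y‖ := by
    calc (1 : ℝ) = ‖b * v ^ 2 - I * γ * v - y‖ := by rw [← h3, norm_one]
      _ ≤ ‖b * v ^ 2‖ + ‖I * γ * v‖ + ‖y‖ :=
        (norm_sub_le _ _).trans (by gcongr; exact norm_sub_le _ _)
      _ = _ := by
        rw [norm_mul, norm_mul, norm_mul, norm_pow, norm_I, one_mul, Complex.norm_real,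
          Real.norm_of_nonneg hγ.le]
  have h5 : ‖b‖ * ‖v‖ ^ 2 ≤ ‖b‖ * ‖v‖ := by
    gcongr
    nlinarith [norm_nonneg v]
  linarith

/-- Either `b q` is small against `γ`, and `(b q - iγ) q = 1` bounds `q`, or `b ≠ 0` and the bound
on `b q` can be divided by `‖b‖`. For `b = 0` the second summand is `0` by the convention for
division. -/
theorem norm_root_le (hγ : 0 < γ) {q : ℂ} (h : b * q ^ 2 - I * γ * q - 1 = 0) :
    ‖q‖ ≤ 2 / γ + (2 * γ + 1 + 4 * ‖b‖) / ‖b‖ := by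
  have hg : ‖I * (γ : ℂ)‖ = γ := by
    rw [norm_mul, norm_I, one_mul, Complex.norm_real, Real.norm_of_nonneg hγ.le]
  have hb := norm_nonneg b
  have hX := norm_mul_le_of_quadratic hγ (y := 0) (by simp) h
  rcases le_or_gt ‖b * q‖ (γ / 2) with h1 | h1
  · have h2 : ‖b * q - I * γ‖ * ‖q‖ = 1 := by
      rw [← norm_mul, show (b * q - I * γ) * q = 1 by linear_combination h, norm_one]
    have h3 : γ - ‖b * q‖ ≤ ‖b * q - I * γ‖ := by
      have := norm_sub_norm_le (I * (γ : ℂ)) (b * q)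
      rwa [hg, norm_sub_rev] at this
    have h4 : γ / 2 * ‖q‖ ≤ 1 := by
      rw [← h2]
      gcongr
      linarith
    have h5 : ‖q‖ ≤ 2 / γ := by
      rw [le_div_iff₀ hγ]
      linarith
    have : 0 ≤ (2 * γ + 1 + 4 * ‖b‖) / ‖b‖ := by positivity
    linarith
  · have hb0 : 0 < ‖b‖ := by
      refine norm_pos_iff.2 fun h0 => ?_
      rw [h0, zero_mul, norm_zero] at h1
      linarith
    have h5 : ‖q‖ ≤ (2 * γ + 1 + 4 * ‖b‖) / ‖b‖ := by
      rw [le_div_iff₀ hb0, mul_comm, ← norm_mul]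
      exact hX
    have : 0 ≤ 2 / γ := by positivity
    linarith

/-- Lower bounds for the derivative of the quadratic, with or without a double root. -/
theorem exists_derivative_bounds (b : ℂ) (hγ : 0 < γ) {l L ε : ℝ} (hl : 0 < l) (hL : 0 < L)
    (hε : 0 < ε) : ∃ a₀ > 0, ∃ Q > 0, ∀ A : ℝ, 0 < A → A ≤ a₀ → ∀ v₀ s₀ : ℂ, l ≤ ‖s₀‖ →
      ‖s₀‖ ≤ L → b * v₀ ^ 2 - I * γ * v₀ - 1 = A * s₀ → 2 * b * v₀ - I * γ ≠ 0 ∧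
        (∀ h : ℂ, ‖h‖ ≤ A * (ε * l) → ‖4 * b * h / (2 * b * v₀ - I * γ) ^ 2‖ ≤ ε) ∧
        ∀ q : ℂ, b * q ^ 2 - I * γ * q - 1 = 0 →
          ‖b * (v₀ + q) - I * γ‖ ≤ Q * ‖2 * b * v₀ - I * γ‖ := by
  -- The discriminant up to sign conventions: the square of the derivative `2 b v₀ - iγ` is `D + 4 b
  -- A s₀`.
  set D : ℂ := 4 * b - γ ^ 2 with hD
  have hsq : ∀ v₀ y : ℂ, b * v₀ ^ 2 - I * γ * v₀ - 1 = y →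
      (2 * b * v₀ - I * γ) ^ 2 = D + 4 * b * y := fun v₀ y h => by
    rw [hD]
    linear_combination 4 * b * h + (γ : ℂ) ^ 2 * I_sq
  by_cases hD0 : D = 0
  -- Double root. The derivative is only of order `√A`, but its square is exactly `4 b A s₀`, which
  -- is still comparable with the admissible increments `h`. The cofactor `b (v₀ + q) - iγ` is half
  -- the derivative.
  · have hb : 4 * b = γ ^ 2 := by linear_combination hD0
    have hb0 : b ≠ 0 := fun h => by
      rw [h, mul_zero] at hb
      exact pow_ne_zero 2 (by exact_mod_cast hγ.ne' : (γ : ℂ) ≠ 0) hb.symm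
    refine ⟨1, one_pos, 1 / 2, by norm_num, fun A hA _ v₀ s₀ hl' _ h => ?_⟩
    have hA0 : (A : ℂ) ≠ 0 := by exact_mod_cast hA.ne'
    have hs0 : s₀ ≠ 0 := norm_pos_iff.1 (hl.trans_le hl')
    have hm2 : (2 * b * v₀ - I * γ) ^ 2 = 4 * b * (A * s₀) := by rw [hsq v₀ _ h, hD0, zero_add]
    have hm : 2 * b * v₀ - I * γ ≠ 0 := fun h0 => by
      rw [h0] at hm2
      have : 4 * b * (A * s₀) ≠ 0 :=
        mul_ne_zero (mul_ne_zero (by norm_num) hb0) (mul_ne_zero hA0 hs0)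
      exact this (by rw [← hm2]; ring)
    refine ⟨hm, fun y hy => ?_, fun q hq => ?_⟩
    · have hs : 0 < ‖s₀‖ := norm_pos_iff.2 hs0
      rw [hm2, mul_div_mul_left _ _ (mul_ne_zero (by norm_num) hb0), norm_div, norm_mul,
        Complex.norm_real, Real.norm_of_nonneg hA.le, div_le_iff₀ (by positivity)]
      calc ‖y‖ ≤ A * (ε * l) := hy
        _ ≤ A * (ε * ‖s₀‖) := by gcongr
        _ = ε * (A * ‖s₀‖) := by ring
    · have h1 : 2 * b * q - I * γ = 0 := by
        have := hsq q 0 hq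
        rw [hD0, mul_zero, add_zero] at this
        exact pow_eq_zero_iff two_ne_zero |>.1 this
      have h2 : b * (v₀ + q) - I * γ = 1 / 2 * (2 * b * v₀ - I * γ) := by
        linear_combination (1 / 2) * h1
      rw [h2, norm_mul]
      simp
  -- Simple roots. For small `A` the derivative is bounded below by `√(‖D‖ / 2)`, and the cofactor
  -- is bounded above.
  · have hDp : 0 < ‖D‖ := norm_pos_iff.2 hD0
    set X := 2 * γ + 1 + 4 * ‖b‖ with hX
    have hXp : 0 < X := by positivity
    refine ⟨min (1 / L) (‖D‖ / (8 * (‖b‖ + 1) * (L + l))), by positivity,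
      (2 * X + γ) / Real.sqrt (‖D‖ / 2), by positivity, fun A hA hAa v₀ s₀ hl' hL' h => ?_⟩
    have hA1 : A * L ≤ 1 := by
      have := hAa.trans (min_le_left _ _)
      rwa [le_div_iff₀ hL] at this
    have hA2 : A * (8 * (‖b‖ + 1) * (L + l)) ≤ ‖D‖ := by
      have := hAa.trans (min_le_right _ _)
      rwa [le_div_iff₀ (by positivity)] at this
    have hy : ‖(A : ℂ) * s₀‖ ≤ A * L := by
      rw [norm_mul, Complex.norm_real, Real.norm_of_nonneg hA.le]
      gcongr
    have hbA : 8 * ‖b‖ * (A * L) ≤ ‖D‖ := by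
      refine le_trans ?_ hA2
      have : 0 ≤ A * (8 * (‖b‖ * l + L + l)) := by positivity
      linarith
    have hbA' : 8 * ‖b‖ * (A * l) ≤ ‖D‖ := by
      refine le_trans ?_ hA2
      have : 0 ≤ A * (8 * (‖b‖ * L + L + l)) := by positivity
      linarith
    have hm2 : ‖D‖ / 2 ≤ ‖2 * b * v₀ - I * γ‖ ^ 2 := by
      rw [← norm_pow, hsq v₀ _ h]
      have h1 : ‖4 * b * (A * s₀)‖ ≤ ‖D‖ / 2 := by
        rw [norm_mul, norm_mul, Complex.norm_ofNat]
        calc 4 * ‖b‖ * ‖(A : ℂ) * s₀‖ ≤ 4 * ‖b‖ * (A * L) := by gcongr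
          _ ≤ ‖D‖ / 2 := by linarith
      have := norm_sub_le_norm_add D (4 * b * (A * s₀))
      linarith
    have hm : Real.sqrt (‖D‖ / 2) ≤ ‖2 * b * v₀ - I * γ‖ := by
      rw [← Real.sqrt_sq (norm_nonneg (2 * b * v₀ - I * γ))]
      exact Real.sqrt_le_sqrt hm2
    have hs : 0 < Real.sqrt (‖D‖ / 2) := by positivity
    refine ⟨norm_pos_iff.1 (hs.trans_le hm), fun y hy => ?_, fun q hq => ?_⟩
    · rw [norm_div, norm_pow, div_le_iff₀ (pow_pos (hs.trans_le hm) 2), norm_mul, norm_mul,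
        Complex.norm_ofNat]
      calc 4 * ‖b‖ * ‖y‖ ≤ 4 * ‖b‖ * (A * (ε * l)) := by gcongr
        _ = ε * (8 * ‖b‖ * (A * l) / 2) := by ring
        _ ≤ ε * (‖D‖ / 2) := by gcongr
        _ ≤ _ := by gcongr
    · have h1 := norm_mul_le_of_quadratic hγ (y := 0) (by simp) hq
      have h2 := norm_mul_le_of_quadratic hγ (hy.trans hA1) h
      calc ‖b * (v₀ + q) - I * γ‖ ≤ ‖b * v₀‖ + ‖b * q‖ + γ := by
            rw [mul_add]
            refine (norm_sub_le _ _).trans (add_le_add (norm_add_le _ _) (le_of_eq ?_))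
            rw [norm_mul, norm_I, one_mul, Complex.norm_real, Real.norm_of_nonneg hγ.le]
        _ ≤ 2 * X + γ := by linarith
        _ = (2 * X + γ) / Real.sqrt (‖D‖ / 2) * Real.sqrt (‖D‖ / 2) := by field_simp
        _ ≤ _ := by gcongr

/-- A continuous local inverse of `v ↦ (b v² - iγ v - 1) / A`. -/
theorem exists_quadratic_branch (b : ℂ) (hγ : 0 < γ) {c l L : ℝ} (hc : 0 < c) (hl : 0 < l)
    (hL : 0 < L) : ∃ a₀ > 0, ∃ C > 0, ∃ c₀ > 0, ∀ A ρ : ℝ, 0 < A → A ≤ a₀ → 0 < ρ → ρ ≤ a₀ →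
      (∀ v s : ℂ, ‖s‖ ≤ 2 * L → b * v ^ 2 - I * γ * v - 1 = A * s → c₀ ≤ ‖v‖) ∧
      ∀ v₀ s₀ : ℂ, l ≤ ‖s₀‖ → ‖s₀‖ ≤ L → b * v₀ ^ 2 - I * γ * v₀ - 1 = A * s₀ →
        ∃ V : ℂ → ℂ, V s₀ = v₀ ∧ ContinuousOn V (Metric.closedBall s₀ (c * ρ ^ 2)) ∧
          ∀ s ∈ Metric.closedBall s₀ (c * ρ ^ 2),
            ‖s‖ ≤ 2 * L ∧ s ≠ 0 ∧ b * V s ^ 2 - I * γ * V s - 1 = A * s ∧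
            (∀ q : ℂ, b * q ^ 2 - I * γ * q - 1 = 0 →
              ‖V s - v₀‖ * ‖q‖ ≤ C * ρ ^ 2 * (‖V s‖ * ‖v₀ - q‖)) ∧
            (b = 0 → ‖V s - v₀‖ ≤ C * ρ ^ 2 * ‖V s‖) := by
  obtain ⟨a₁, ha₁, Q, hQ, hder⟩ := exists_derivative_bounds b hγ hl hL
    (by norm_num : (0 : ℝ) < 1 / 2)
  set c₀ := min 1 (1 / (2 * (‖b‖ + γ))) with hc₀
  have hc₀p : 0 < c₀ := by positivity
  set Q₀ := 2 / γ + (2 * γ + 1 + 4 * ‖b‖) / ‖b‖ with hQ₀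
  have hQ₀p : 0 < Q₀ := by positivity
  set C₁ := 2 * c / l * Q * Q₀ / c₀ with hC₁
  set C₂ := 2 * c / γ / c₀ with hC₂
  have hC₁p : 0 < C₁ := by positivity
  have hC₂p : 0 < C₂ := by positivity
  set a₂ := min 1 (min (1 / (4 * L)) (min (L / c) (l / (2 * c)))) with ha₂
  have ha₂p : 0 < a₂ := by positivity
  refine ⟨min a₁ a₂, by positivity, C₁ + C₂, by positivity, c₀, hc₀p,
    fun A ρ hA hAa hρ hρa => ?_⟩
  have hA1 : A ≤ 1 := hAa.trans ((min_le_right _ _).trans (min_le_left _ _))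
  have hA2 : A * (4 * L) ≤ 1 := by
    have := hAa.trans ((min_le_right _ _).trans ((min_le_right _ _).trans (min_le_left _ _)))
    rwa [le_div_iff₀ (by positivity)] at this
  have hρ1 : ρ ≤ 1 := hρa.trans ((min_le_right _ _).trans (min_le_left _ _))
  have hρ2 : ρ * c ≤ L := by
    have := hρa.trans ((min_le_right _ _).trans ((min_le_right _ _).trans
      ((min_le_right _ _).trans (min_le_left _ _))))
    rwa [le_div_iff₀ hc] at this
  have hρ3 : ρ * (2 * c) ≤ l := by
    have := hρa.trans ((min_le_right _ _).trans ((min_le_right _ _).trans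
      ((min_le_right _ _).trans (min_le_right _ _))))
    rwa [le_div_iff₀ (by positivity)] at this
  have hcρ : c * ρ ^ 2 ≤ ρ * c := by
    calc c * ρ ^ 2 = ρ * c * ρ := by ring
      _ ≤ ρ * c * 1 := by gcongr
      _ = ρ * c := mul_one _
  have hlow : ∀ v s : ℂ, ‖s‖ ≤ 2 * L → b * v ^ 2 - I * γ * v - 1 = A * s → c₀ ≤ ‖v‖ :=
    fun v s hs h => by
      refine le_norm_of_quadratic hγ ?_ h
      rw [norm_mul, Complex.norm_real, Real.norm_of_nonneg hA.le]
      calc A * ‖s‖ ≤ A * (2 * L) := by gcongr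
        _ ≤ 1 / 2 := by linarith
  refine ⟨hlow, fun v₀ s₀ hls hLs h₀ => ?_⟩
  obtain ⟨hm, hx, hq⟩ := hder A hA (hAa.trans (min_le_left _ _)) v₀ s₀ hls hLs h₀
  set m := 2 * b * v₀ - I * γ with hmdef
  have hmp : 0 < ‖m‖ := norm_pos_iff.2 hm
  have hsp : 0 < ‖s₀‖ := hl.trans_le hls
  have hx' : ∀ s ∈ Metric.closedBall s₀ (c * ρ ^ 2),
      ‖4 * b * (A * (s - s₀)) / m ^ 2‖ < 1 := fun s hs => by
    rw [mem_closedBall_iff_norm] at hs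
    refine (hx _ ?_).trans_lt (by norm_num)
    rw [norm_mul, Complex.norm_real, Real.norm_of_nonneg hA.le]
    gcongr
    linarith
  -- The increment `t` of `v` solves `b t² + m t = A (s - s₀)`, and the small root is continuous in
  -- `s` and vanishes at `s₀`.
  refine ⟨fun s => v₀ + smallRoot b m (A * (s - s₀)), by simp [smallRoot], ?_, fun s hs => ?_⟩
  · have h1 : ContinuousOn (fun s : ℂ => 4 * b * (A * (s - s₀)) / m ^ 2)
        (Metric.closedBall s₀ (c * ρ ^ 2)) := by fun_prop
    have h2 := continuousOn_sqrtOneAdd.comp h1 fun s hs => mem_ball_zero_iff.2 (hx' s hs)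
    refine continuousOn_const.add (ContinuousOn.div (by fun_prop) (continuousOn_const.add h2)
      fun s _ => one_add_sqrtOneAdd_ne_zero _)
  · have ht := smallRoot_eq hm (hx' s hs)
    have htn := norm_smallRoot_le b m (A * (s - s₀))
    set t := smallRoot b m (A * (s - s₀)) with htdef
    rw [mem_closedBall_iff_norm] at hs
    have hnorm := norm_le_norm_add_norm_sub' s s₀
    have hV : b * (v₀ + t) ^ 2 - I * γ * (v₀ + t) - 1 = A * s := by
      rw [hmdef] at ht
      linear_combination ht + h₀
    have hs2 : ‖s‖ ≤ 2 * L := by linarith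
    have hlowV := hlow _ _ hs2 hV
    rw [norm_mul, Complex.norm_real, Real.norm_of_nonneg hA.le] at htn
    refine ⟨hs2, fun h0 => ?_, hV, fun q hq0 => ?_, fun hb => ?_⟩
    · rw [h0, zero_sub, norm_neg] at hs
      linarith
    · have hbq := hq q hq0
      -- As `q` is a root, the value `A s₀` at `v₀` splits off the factor `v₀ - q`. Comparing the
      -- cofactor with `m` turns `‖t‖ = O(A ρ² / ‖m‖)` into `O(ρ² ‖v₀ - q‖)`.
      have hw : A * ‖s₀‖ = ‖v₀ - q‖ * ‖b * (v₀ + q) - I * γ‖ := by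
        rw [← norm_mul, show (v₀ - q) * (b * (v₀ + q) - I * γ) = A * s₀ by
          linear_combination h₀ - hq0, norm_mul, Complex.norm_real, Real.norm_of_nonneg hA.le]
      have hqQ : ‖q‖ ≤ Q₀ := norm_root_le hγ hq0
      have ht2 : ‖t‖ ≤ 2 * c / l * Q * ρ ^ 2 * ‖v₀ - q‖ := by
        calc ‖t‖ ≤ 2 * (A * ‖s - s₀‖) / ‖m‖ := htn
          _ ≤ 2 * (A * (c * ρ ^ 2)) / ‖m‖ := by gcongr
          _ = 2 * c * ρ ^ 2 / ‖m‖ / l * (A * l) := by field_simp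
          _ ≤ 2 * c * ρ ^ 2 / ‖m‖ / l * (A * ‖s₀‖) := by gcongr
          _ ≤ 2 * c * ρ ^ 2 / ‖m‖ / l * (‖v₀ - q‖ * (Q * ‖m‖)) := by
            rw [hw]
            gcongr
          _ = _ := by field_simp
      rw [add_sub_cancel_left]
      calc ‖t‖ * ‖q‖ ≤ 2 * c / l * Q * ρ ^ 2 * ‖v₀ - q‖ * Q₀ := by gcongr
        _ = C₁ * ρ ^ 2 * (c₀ * ‖v₀ - q‖) := by
          rw [hC₁]
          field_simp
        _ ≤ (C₁ + C₂) * ρ ^ 2 * (‖v₀ + t‖ * ‖v₀ - q‖) := by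
          gcongr
          linarith
    · have hmγ : ‖m‖ = γ := by
        rw [hmdef, hb, mul_zero, zero_mul, zero_sub, norm_neg, norm_mul, norm_I, one_mul,
          Complex.norm_real, Real.norm_of_nonneg hγ.le]
      rw [add_sub_cancel_left]
      calc ‖t‖ ≤ 2 * (A * ‖s - s₀‖) / γ := by rwa [hmγ] at htn
        _ ≤ 2 * (1 * (c * ρ ^ 2)) / γ := by gcongr
        _ = C₂ * ρ ^ 2 * c₀ := by
          rw [hC₂]
          field_simp
        _ ≤ (C₁ + C₂) * ρ ^ 2 * ‖v₀ + t‖ := by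
          gcongr
          linarith

end Quadratic

/-- The spectral parameter of the rescaled problem. -/
def spectralParam (m : Medium) (k : ℂ) (δ ρ : ℝ) (ω : ℂ) : ℂ :=
  1 / (m.factor k δ ω * (ρ : ℂ) ^ 2)

theorem factor_eq (m : Medium) (k : ℂ) (δ : ℝ) (ω : ℂ) :
    m.factor k δ ω = (δ : ℂ) ^ 2 * ω ^ 2 * (m.mu0 * m.alpha / m.denom k ω) := by
  rw [Medium.factor, Medium.contrast, Medium.permittivity]
  ring

/-- In `v = 1/ω` the quotient `d(ω)/ω²` is a polynomial, and its roots are the reciprocals of the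
nonzero zeros of `d`. -/
theorem quadratic_inv_of_ne_zero (m : Medium) (k : ℂ) {ω : ℂ} (hω : ω ≠ 0) :
    (m.beta + m.eta * k ^ 2) * ω⁻¹ ^ 2 - I * m.gamma * ω⁻¹ - 1 = m.denom k ω * ω⁻¹ ^ 2 := by
  rw [Medium.denom]
  field_simp
  ring

theorem quadratic_of_factor_ne_zero (m : Medium) (k : ℂ) {δ ρ : ℝ} (hρ : 0 < ρ) {ω : ℂ}
    (hF : m.factor k δ ω ≠ 0) :
    ω ≠ 0 ∧ (m.beta + m.eta * k ^ 2) * ω⁻¹ ^ 2 - I * m.gamma * ω⁻¹ - 1 =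
      ((δ ^ 2 * ρ ^ 2 * m.mu0 * m.alpha : ℝ) : ℂ) * spectralParam m k δ ρ ω := by
  have hρ' : (ρ : ℂ) ≠ 0 := by exact_mod_cast hρ.ne'
  have hω : ω ≠ 0 := fun h => hF (by rw [factor_eq, h]; simp)
  have hd : m.denom k ω ≠ 0 := fun h => hF (by rw [factor_eq, h]; simp)
  have hδ : (δ : ℂ) ≠ 0 := fun h => hF (by rw [factor_eq, h]; simp)
  have hμ : (m.mu0 : ℂ) ≠ 0 := by exact_mod_cast m.mu0_pos.ne'
  have hα : (m.alpha : ℂ) ≠ 0 := by exact_mod_cast m.alpha_pos.ne'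
  refine ⟨hω, ?_⟩
  rw [quadratic_inv_of_ne_zero m k hω, spectralParam, factor_eq]
  push_cast
  field_simp

theorem factor_ne_zero_of_quadratic (m : Medium) (k : ℂ) {δ ρ : ℝ} (hδ : 0 < δ) (hρ : 0 < ρ)
    {v s : ℂ} (hv : v ≠ 0) (hs : s ≠ 0)
    (h : (m.beta + m.eta * k ^ 2) * v ^ 2 - I * m.gamma * v - 1 =
      ((δ ^ 2 * ρ ^ 2 * m.mu0 * m.alpha : ℝ) : ℂ) * s) :
    m.factor k δ v⁻¹ ≠ 0 ∧ spectralParam m k δ ρ v⁻¹ = s := by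
  have hρ' : (ρ : ℂ) ≠ 0 := by exact_mod_cast hρ.ne'
  have hδ' : (δ : ℂ) ≠ 0 := by exact_mod_cast hδ.ne'
  have hμ : (m.mu0 : ℂ) ≠ 0 := by exact_mod_cast m.mu0_pos.ne'
  have hα : (m.alpha : ℂ) ≠ 0 := by exact_mod_cast m.alpha_pos.ne'
  have h1 := quadratic_inv_of_ne_zero m k (inv_ne_zero hv)
  rw [inv_inv, h] at h1
  push_cast at h1
  have hd : m.denom k v⁻¹ ≠ 0 := fun h0 => by
    rw [h0, zero_mul] at h1
    have h2 : (δ : ℂ) ^ 2 * ρ ^ 2 * m.mu0 * m.alpha * s ≠ 0 := by positivity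
    exact h2 h1
  have hF : m.factor k δ v⁻¹ = (δ : ℂ) ^ 2 * m.mu0 * m.alpha / (m.denom k v⁻¹ * v ^ 2) := by
    rw [factor_eq]
    field_simp
  rw [spectralParam, hF, ← h1]
  constructor
  · positivity
  · field_simp

/-- A continuous local inverse of the spectral parameter, with control of the distance to the
poles of the permittivity. -/
theorem exists_frequency_branch (m : Medium) (k : ℂ) {κ : ℝ} (hκ : 0 < κ) {c l L : ℝ}
    (hc : 0 < c) (hl : 0 < l) (hL : 0 < L) : ∃ ρ₁ > 0, ∃ C > 0, ∃ C₃ > 0, ∀ ρ δ : ℝ, 0 < ρ →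
      ρ ≤ ρ₁ → δ ≤ κ * ρ → ρ ≤ κ * δ →
      (∀ ω : ℂ, m.factor k δ ω ≠ 0 → ‖spectralParam m k δ ρ ω‖ ≤ 2 * L →
        ‖δ * m.k0 ω‖ ≤ C₃ * ρ) ∧
      ∀ ω₀ : ℂ, m.factor k δ ω₀ ≠ 0 → l ≤ ‖spectralParam m k δ ρ ω₀‖ →
        ‖spectralParam m k δ ρ ω₀‖ ≤ L → ∃ W : ℂ → ℂ,
          W (spectralParam m k δ ρ ω₀) = ω₀ ∧
          ContinuousOn W (Metric.closedBall (spectralParam m k δ ρ ω₀) (c * ρ ^ 2)) ∧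
          ∀ s ∈ Metric.closedBall (spectralParam m k δ ρ ω₀) (c * ρ ^ 2),
            ‖s‖ ≤ 2 * L ∧ m.factor k δ (W s) ≠ 0 ∧ spectralParam m k δ ρ (W s) = s ∧
            ∀ p : ℂ, m.denom k p = 0 → ‖ω₀ - W s‖ ≤ C * ρ ^ 2 * ‖ω₀ - p‖ := by
  obtain ⟨a₀, ha₀, C, hC, c₀, hc₀, hbr⟩ :=
    exists_quadratic_branch (m.beta + m.eta * k ^ 2) m.gamma_pos hc hl hL
  have hμ := m.mu0_pos
  have hα := m.alpha_pos
  have hε := m.eps0_pos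
  -- The last bound uses `δ ≤ κ ρ` to make the coefficient `A = δ² ρ² μ₀ α` at most `a₀`. The
  -- wavenumber constant comes from `‖ω‖ ≤ 1 / c₀`.
  refine ⟨min 1 (min a₀ (a₀ / (κ ^ 2 * m.mu0 * m.alpha))), by positivity, C, hC,
    κ * (m.mu0 * m.eps0) / c₀, by positivity, fun ρ δ hρ hρ₁ hδρ hρδ => ?_⟩
  have hδ : 0 < δ := by
    by_contra! h
    have : κ * δ ≤ 0 := mul_nonpos_of_nonneg_of_nonpos hκ.le h
    linarith
  have hρ1 : ρ ≤ 1 := hρ₁.trans (min_le_left _ _)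
  have hA : 0 < δ ^ 2 * ρ ^ 2 * m.mu0 * m.alpha := by positivity
  have hAa : δ ^ 2 * ρ ^ 2 * m.mu0 * m.alpha ≤ a₀ := by
    have h1 := hρ₁.trans ((min_le_right _ _).trans (min_le_right _ _))
    rw [le_div_iff₀ (by positivity)] at h1
    calc δ ^ 2 * ρ ^ 2 * m.mu0 * m.alpha ≤ (κ * ρ) ^ 2 * ρ ^ 2 * m.mu0 * m.alpha := by gcongr
      _ = ρ ^ 4 * (κ ^ 2 * m.mu0 * m.alpha) := by ring
      _ ≤ ρ * (κ ^ 2 * m.mu0 * m.alpha) := by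
        gcongr
        exact pow_le_of_le_one hρ.le hρ1 (by norm_num)
      _ ≤ a₀ := h1
  obtain ⟨hlow, hbranch⟩ := hbr _ ρ hA hAa hρ (hρ₁.trans ((min_le_right _ _).trans
    (min_le_left _ _)))
  refine ⟨fun ω hF hs => ?_, fun ω₀ hF hls hLs => ?_⟩
  · obtain ⟨hω, hq⟩ := quadratic_of_factor_ne_zero m k hρ hF
    have h1 := hlow _ _ hs hq
    have hωp : 0 < ‖ω‖ := norm_pos_iff.2 hω
    rw [norm_inv] at h1
    have h2 : ‖ω‖ ≤ 1 / c₀ := by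
      rw [one_div]
      exact le_inv_of_le_inv₀ hc₀ h1
    rw [Medium.k0, norm_mul, norm_mul, norm_mul, Complex.norm_real, Complex.norm_real,
      Complex.norm_real, Real.norm_of_nonneg hδ.le, Real.norm_of_nonneg hμ.le,
      Real.norm_of_nonneg hε.le]
    calc δ * (m.mu0 * m.eps0 * ‖ω‖) ≤ κ * ρ * (m.mu0 * m.eps0 * (1 / c₀)) := by gcongr
      _ = _ := by ring
  · obtain ⟨hω, hq⟩ := quadratic_of_factor_ne_zero m k hρ hF
    obtain ⟨V, hV₀, hVc, hV⟩ := hbranch _ _ hls hLs hq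
    have hV0 : ∀ s ∈ Metric.closedBall (spectralParam m k δ ρ ω₀) (c * ρ ^ 2), V s ≠ 0 :=
      fun s hs => norm_pos_iff.1 (hc₀.trans_le (hlow _ _ (hV s hs).1 (hV s hs).2.2.1))
    refine ⟨fun s => (V s)⁻¹, by simp only [hV₀, inv_inv], hVc.inv₀ hV0, fun s hs => ?_⟩
    obtain ⟨h1, h2, h3, h4, h5⟩ := hV s hs
    have hVs := hV0 s hs
    obtain ⟨h6, h7⟩ := factor_ne_zero_of_quadratic m k hδ hρ hVs h2 h3
    refine ⟨h1, h6, h7, fun p hp => ?_⟩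
    have hVp : 0 < ‖V s‖ := norm_pos_iff.2 hVs
    have hωp : 0 < ‖ω₀‖ := norm_pos_iff.2 hω
    have e1 : ‖ω₀ - (V s)⁻¹‖ = ‖V s - ω₀⁻¹‖ * ‖ω₀‖ / ‖V s‖ := by
      rw [← norm_mul, ← norm_div]
      congr 1
      field_simp
    rw [e1, div_le_iff₀ hVp]
    -- A zero `p = 0` of `d` has no reciprocal. It occurs only for `b = 0`, where the relative bound
    -- on `V s` takes its place.
    by_cases hp0 : p = 0
    · subst hp0
      have hb : (m.beta : ℂ) + m.eta * k ^ 2 = 0 := by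
        rw [Medium.denom] at hp
        linear_combination hp
      rw [sub_zero]
      calc ‖V s - ω₀⁻¹‖ * ‖ω₀‖ ≤ C * ρ ^ 2 * ‖V s‖ * ‖ω₀‖ := by
            gcongr
            exact h5 hb
        _ = _ := by ring
    · have hpp : 0 < ‖p‖ := norm_pos_iff.2 hp0
      have h8 := h4 p⁻¹ (by rw [quadratic_inv_of_ne_zero m k hp0, hp, zero_mul])
      have e2 : ‖ω₀⁻¹ - p⁻¹‖ = ‖ω₀ - p‖ / (‖ω₀‖ * ‖p‖) := by
        rw [norm_sub_rev ω₀ p, ← norm_mul, ← norm_div]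
        congr 1
        field_simp
      rw [e2, norm_inv] at h8
      calc ‖V s - ω₀⁻¹‖ * ‖ω₀‖ = ‖V s - ω₀⁻¹‖ * ‖p‖⁻¹ * (‖p‖ * ‖ω₀‖) := by field_simp
        _ ≤ C * ρ ^ 2 * (‖V s‖ * (‖ω₀ - p‖ / (‖ω₀‖ * ‖p‖))) * (‖p‖ * ‖ω₀‖) := by gcongr
        _ = _ := by field_simp

end Resonators
end

/-! ### From the window of frequencies to the spectral parameter. -/

noncomputable section
namespace Resonators
open Complex Set

/-- `T` is replaced by `ρ R` and the vectors by phase multiples of the modes; the phases disappear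
in the norm. It transfers the nonvanishing of the leading interaction to `𝒦_ii`. -/
theorem le_norm_inner_of_near {H H' : Type*} [NormedAddCommGroup H] [InnerProductSpace ℂ H]
    [NormedAddCommGroup H'] [InnerProductSpace ℂ H'] {T R : H →L[ℂ] H'} {φ e : H} {φ' e' : H'}
    {a a' : ℂ} {ρ ε ε' C : ℝ} (hρ : 0 < ρ) (ha : ‖a‖ = 1) (ha' : ‖a'‖ = 1) (hφ : ‖φ‖ = 1)
    (hφ' : ‖φ'‖ = 1) (he' : ‖e'‖ = 1) (hd : ‖φ - a • e‖ ≤ ε) (hd' : ‖φ' - a' • e'‖ ≤ ε)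
    (hT : ‖T - (ρ : ℂ) • R‖ ≤ ε') (hR : ‖R‖ ≤ C) :
    ρ * ‖(inner ℂ e' (R e) : ℂ)‖ ≤ ‖(inner ℂ φ' (T φ) : ℂ)‖ + ε' + ρ * (C * ε + C * ε) := by
  have hC : 0 ≤ C := (norm_nonneg _).trans hR
  have h1 : inner ℂ (a' • e') ((ρ : ℂ) • R (a • e)) =
      inner ℂ φ' (T φ) - inner ℂ φ' ((T - (ρ : ℂ) • R) φ) -
        (ρ : ℂ) * (inner ℂ (φ' - a' • e') (R φ) + inner ℂ (a' • e') (R (φ - a • e))) := by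
    simp only [_root_.sub_apply, _root_.smul_apply, map_sub, map_smul, inner_sub_left,
      inner_sub_right, inner_smul_left, inner_smul_right]
    ring
  have h2 : ‖(inner ℂ (a' • e') ((ρ : ℂ) • R (a • e)) : ℂ)‖ = ρ * ‖(inner ℂ e' (R e) : ℂ)‖ := by
    simp only [map_smul, inner_smul_left, inner_smul_right, norm_mul, RCLike.norm_conj, ha, ha',
      Complex.norm_real, Real.norm_of_nonneg hρ.le, one_mul]
  have h3 : ‖(inner ℂ φ' ((T - (ρ : ℂ) • R) φ) : ℂ)‖ ≤ ε' := by
    refine (norm_inner_le_norm _ _).trans ?_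
    rw [hφ', one_mul]
    exact (ContinuousLinearMap.le_of_opNorm_le _ hT φ).trans (by rw [hφ, mul_one])
  have h4 : ‖(inner ℂ (φ' - a' • e') (R φ) : ℂ)‖ ≤ C * ε := by
    refine (norm_inner_le_norm _ _).trans ?_
    rw [mul_comm]
    have := ContinuousLinearMap.le_of_opNorm_le _ hR φ
    rw [hφ, mul_one] at this
    gcongr
  have h5 : ‖(inner ℂ (a' • e') (R (φ - a • e)) : ℂ)‖ ≤ C * ε := by
    refine (norm_inner_le_norm _ _).trans ?_
    rw [norm_smul, ha', he', one_mul, one_mul]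
    exact (ContinuousLinearMap.le_of_opNorm_le _ hR _).trans (by gcongr)
  rw [← h2, h1]
  refine (norm_sub_le _ _).trans (add_le_add ((norm_sub_le _ _).trans (by gcongr)) ?_)
  rw [norm_mul, Complex.norm_real, Real.norm_of_nonneg hρ.le]
  gcongr
  exact (norm_add_le _ _).trans (add_le_add h4 h5)

/-- The window in terms of the spectral parameter. -/
theorem spectralParam_bounds (m : Medium) (k : ℂ) {δ ρ : ℝ} (hρ : 0 < ρ) {ω : ℂ} {r lam : ℝ}
    (hr : r ≤ 1 / 2) (h : ‖m.factor k δ ω * ((ρ : ℂ) ^ 2 * lam) - 1‖ ≤ r) :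
    m.factor k δ ω ≠ 0 ∧ |lam| / 2 ≤ ‖spectralParam m k δ ρ ω‖ ∧
      ‖spectralParam m k δ ρ ω‖ ≤ 2 * |lam| ∧ ‖spectralParam m k δ ρ ω - lam‖ ≤ 2 * r * |lam| := by
  have hρ' : (ρ : ℂ) ≠ 0 := by exact_mod_cast hρ.ne'
  have hr0 : 0 ≤ r := (norm_nonneg _).trans h
  have hF : m.factor k δ ω ≠ 0 := fun h0 => by
    rw [h0, zero_mul, zero_sub, norm_neg, norm_one] at h
    linarith
  set s := spectralParam m k δ ρ ω with hs
  -- The window condition times `s`. With `r ≤ 1/2` it makes `‖s‖` and `|lam|` comparable.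
  have h1 : lam - s = s * (m.factor k δ ω * ((ρ : ℂ) ^ 2 * lam) - 1) := by
    rw [hs, spectralParam]
    field_simp
  have h2 : ‖s - lam‖ ≤ ‖s‖ * r := by
    rw [norm_sub_rev, h1, norm_mul]
    gcongr
  have h3 := norm_le_norm_add_norm_sub' s lam
  have h4 := norm_le_norm_add_norm_sub s (lam : ℂ)
  rw [Complex.norm_real, Real.norm_eq_abs] at h3 h4
  have h5 : ‖s‖ * r ≤ ‖s‖ * (1 / 2) := by gcongr
  have h6 : ‖s‖ ≤ 2 * |lam| := by linarith
  refine ⟨hF, by linarith [norm_nonneg s], h6, h2.trans ?_⟩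
  calc ‖s‖ * r ≤ 2 * |lam| * r := by gcongr
    _ = _ := by ring

theorem norm_factor_mul_sub_one_le (m : Medium) (k : ℂ) {δ ρ : ℝ} (hρ : 0 < ρ) {ω : ℂ}
    {r lam : ℝ} (hF : m.factor k δ ω ≠ 0)
    (h : ‖spectralParam m k δ ρ ω - lam‖ ≤ r * ‖spectralParam m k δ ρ ω‖) :
    ‖m.factor k δ ω * ((ρ : ℂ) ^ 2 * lam) - 1‖ ≤ r := by
  have hρ' : (ρ : ℂ) ≠ 0 := by exact_mod_cast hρ.ne'
  set s := spectralParam m k δ ρ ω with hs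
  have hs0 : s ≠ 0 := by
    rw [hs, spectralParam]
    exact one_div_ne_zero (mul_ne_zero hF (pow_ne_zero 2 hρ'))
  have h1 : m.factor k δ ω * ((ρ : ℂ) ^ 2 * lam) - 1 = (lam - s) / s := by
    rw [hs, spectralParam]
    field_simp
  rw [h1, norm_div, div_le_iff₀ (norm_pos_iff.2 hs0), norm_sub_rev]
  exact h

variable {N : ℕ} {B : Fin N → Set E3} (hB : ∀ i, IsOpen (B i) ∧ Bornology.IsBounded (B i))
  (z : Fin N → E3)

theorem calK_self {ρ : ℝ} (hρ : 0 < ρ) (m : Medium) (k : ℂ) (δ : ℝ) (ω : ℂ) (lam : Fin N → ℂ)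
    (φ : (i : Fin N) → L2 (particle B z ρ i)) (i : Fin N) :
    calK m k (particle B z ρ) δ ω lam φ i i =
      (ρ : ℂ) ^ 2 * inner ℂ (toShape B z hρ (finRotate N i) (φ (finRotate N i)))
        (scatterOp hB z ρ (δ * m.k0 ω) (finRotate N i) i (toShape B z hρ i (φ i))) := by
  rw [calK, Matrix.of_apply, if_pos rfl, pairing_particle hB z hρ]

/-- Eigenpairs on the particles from eigenpairs of the rescaled operators. -/
theorem exists_eigenpairNear_of_isUnitPair {ρ : ℝ} (hρ : 0 < ρ) (m : Medium) {r ε : ℝ}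
    (hε : ε ≤ r) (δ : ℝ) (ω : ℂ) {lam0 : Fin N → ℝ} {μ : Fin N → ℂ}
    {φ : (i : Fin N) → L2 (B i)}
    (h : ∀ i, IsUnitPair (scatterOp hB z ρ (δ * m.k0 ω) i i) (lam0 i) ε (μ i) (φ i)) :
    ∃ (lam : Fin N → ℂ) (ψ : (i : Fin N) → L2 (particle B z ρ i)),
      (∀ i, IsEigenpairNear m r ρ (lam0 i) (particle B z ρ i) δ ω (lam i) (ψ i)) ∧
        (∀ i, lam i / (ρ : ℂ) ^ 2 = μ i) ∧ ∀ i, toShape B z hρ i (ψ i) = φ i := by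
  have hρ' : (ρ : ℂ) ≠ 0 := by exact_mod_cast hρ.ne'
  have hψ : ∀ i, ∃ ψ : L2 (particle B z ρ i), toShape B z hρ i ψ = φ i := fun i =>
    (toShape B z hρ i).surjective _
  choose ψ hψ using hψ
  have hμ : ∀ i, (ρ : ℂ) ^ 2 * μ i / (ρ : ℂ) ^ 2 = μ i := fun i => by field_simp
  refine ⟨fun i => (ρ : ℂ) ^ 2 * μ i, ψ, fun i => ?_, hμ, hψ⟩
  rw [isEigenpairNear_iff hB z hρ, hμ, hψ]
  exact ⟨(h i).1, (h i).2.1, (h i).2.2.trans hε⟩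

end Resonators
end

/-! ### Assembly of the theorem. -/

open Resonators MeasureTheory in
theorem theoremA2 (N : ℕ) (m : Medium) (k : ℂ)
    -- shapes `B i` and distinct centres `z i` of the particles `D_i = z_i + ρ B_i`
    (B : Fin N → Set E3) (hBo : ∀ i, IsOpen (B i)) (hBb : ∀ i, Bornology.IsBounded (B i))
    (z : Fin N → E3) (hz : Function.Injective z)
    -- the mode associated to each particle: a simple nonzero eigenvalue of the static operator
    -- of its shape, with eigenfunction `e i`
    (lam0 : Fin N → ℝ) (hlam0 : ∀ i, lam0 i ≠ 0)
    (e : (i : Fin N) → L2 (B i)) (he0 : ∀ i, e i ≠ 0)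
    (he : ∀ i, EigenEq 0 (B i) (lam0 i) (e i))
    (hsimple : ∀ i, ∀ f : L2 (B i), EigenEq 0 (B i) (lam0 i) f → ∃ c : ℂ, f = c • e i)
    -- a chosen eigenvalue is shared by another particle only as that particle's chosen eigenvalue
    (hsep : ∀ i j, IsEigenvalue 0 (B j) (lam0 i) → lam0 j = lam0 i)
    -- `δ = O(ρ)` and `ρ = O(δ)` with constant `κ`
    (κ : ℝ) (hκ : 0 < κ) :
    ∃ r > (0 : ℝ), ∃ ρ₀ > (0 : ℝ), ∃ C > (0 : ℝ),
      ∀ ρ δ : ℝ, 0 < ρ → ρ ≤ ρ₀ → δ ≤ κ * ρ → ρ ≤ κ * δ →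
        -- existence and uniqueness of the eigenpairs `(λ_i, φ_i)` of `K^{δ k₀}_{D_i}`
        (∀ ω ∈ window m k r ρ δ lam0, ∀ i,
          ∃ (lam : ℂ) (φ : L2 (particle B z ρ i)),
            IsEigenpairNear m r ρ (lam0 i) (particle B z ρ i) δ ω lam φ ∧
            ∀ (lam' : ℂ) (φ' : L2 (particle B z ρ i)),
              IsEigenpairNear m r ρ (lam0 i) (particle B z ρ i) δ ω lam' φ' →
                lam' = lam ∧ ∃ c : ℂ, ‖c‖ = 1 ∧ φ' = c • φ) ∧
        -- every resonance is approximated by a zero of `det 𝒦`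
        (∀ ω ∈ window m k r ρ δ lam0, IsResonance m k (particle B z ρ) δ ω →
          ∃ ω' ∈ window m k r ρ δ lam0,
            (∃ (lam : Fin N → ℂ) (φ : (i : Fin N) → L2 (particle B z ρ i)),
              (∀ i, IsEigenpairNear m r ρ (lam0 i) (particle B z ρ i) δ ω' (lam i) (φ i)) ∧
              DetVanishes m k (particle B z ρ) δ ω' lam φ) ∧
            ∀ p : ℂ, m.denom k p = 0 → ‖ω - ω'‖ ≤ C * ρ ^ 2 * ‖ω - p‖) ∧
        -- every zero of `det 𝒦` approximates a resonance
        (∀ ω' ∈ window m k r ρ δ lam0,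
          ∀ (lam : Fin N → ℂ) (φ : (i : Fin N) → L2 (particle B z ρ i)),
            (∀ i, IsEigenpairNear m r ρ (lam0 i) (particle B z ρ i) δ ω' (lam i) (φ i)) →
            (∀ i, calK m k (particle B z ρ) δ ω' lam φ i i ≠ 0) →
            DetVanishes m k (particle B z ρ) δ ω' lam φ →
            ∃ ω ∈ window m k r ρ δ lam0, IsResonance m k (particle B z ρ) δ ω ∧
              ∀ p : ℂ, m.denom k p = 0 → ‖ω - ω'‖ ≤ C * ρ ^ 2 * ‖ω' - p‖) ∧
        -- the diagonal of `𝒦` does not vanish if the chosen modes have nonzero mean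
        ((∀ i, (∫ x in B i, e i x) ≠ 0) →
          ∀ ω ∈ window m k r ρ δ lam0,
            ∀ (lam : Fin N → ℂ) (φ : (i : Fin N) → L2 (particle B z ρ i)),
              (∀ i, IsEigenpairNear m r ρ (lam0 i) (particle B z ρ i) δ ω (lam i) (φ i)) →
              ∀ i, calK m k (particle B z ρ) δ ω lam φ i i ≠ 0) := by
  have hB : ∀ i, IsOpen (B i) ∧ Bornology.IsBounded (B i) := fun i => ⟨hBo i, hBb i⟩
  obtain ⟨l, hl, hll⟩ := exists_pos_forall_le (f := fun i => |lam0 i|)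
    fun i => abs_pos.2 (hlam0 i)
  obtain ⟨L, hL, hlL⟩ := exists_pos_forall_ge fun i => |lam0 i|
  -- Only the wavenumber bound is taken from this instance, whose ball size `1` is arbitrary. `C₃`
  -- has to be known before `C` and `c`, and the branch itself is obtained below with the final `c`.
  obtain ⟨ρ₁, hρ₁, _, -, C₃, hC₃, hwave⟩ := exists_frequency_branch m k hκ one_pos
    (half_pos hl) (mul_pos two_pos hL)
  obtain ⟨C₁, -, ρ₂, hρ₂, hnear⟩ := exists_isNear hB z hz hC₃
  obtain ⟨M, C, hC₁C, hmode⟩ := exists_isModeFamily hB z C₁ hlam0 he0 he hsimple hsep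
  have hC := hmode.C_pos
  obtain ⟨r₀, hr₀, ρ₃, hρ₃, c, hc, -, hr₀l, hmain⟩ := hmode.exists_constants
  obtain ⟨ρ₄, hρ₄, C₄, hC₄, _, -, hbranch⟩ := exists_frequency_branch m k hκ hc
    (half_pos hl) (mul_pos two_pos hL)
  -- A lower bound for the leading interactions that do not vanish; restricting to these pairs makes
  -- `g` available before the means are known to be nonzero.
  obtain ⟨g, hg, hgle⟩ := exists_pos_forall_le
    (f := fun p : {p : Fin N × Fin N //
      (inner ℂ (unitMode e p.1) (leadOp hB z p.1 p.2 (unitMode e p.2)) : ℂ) ≠ 0} =>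
        ‖(inner ℂ (unitMode e p.1.1) (leadOp hB z p.1.1 p.1.2 (unitMode e p.1.2)) : ℂ)‖)
    fun p => norm_pos_iff.2 p.2
  set r := min (1 / 2) (min r₀ (r₀ / (2 * L))) with hr
  have hrp : 0 < r := by positivity
  have hr1 : r ≤ 1 / 2 := min_le_left _ _
  have hr2 : r ≤ r₀ := (min_le_right _ _).trans (min_le_left _ _)
  have hr3 : 2 * r * L ≤ r₀ := by
    have : r ≤ r₀ / (2 * L) := (min_le_right _ _).trans (min_le_right _ _)
    rw [le_div_iff₀ (by positivity)] at this
    linarith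
  -- In order: the eigenpairs found lie in the discs of radius `r`, the frequencies found return to
  -- the window, wavenumbers stay below one, and the leading interaction dominates its error.
  set ρ₅ := min 1 (min (r / (12 * C)) (min (r * l / (8 * c)) (min (1 / C₃)
    (g / (2 * (C + C * c + C * c)))))) with hρ₅
  have hρ₅p : 0 < ρ₅ := by positivity
  refine ⟨r, hrp, min ρ₁ (min ρ₂ (min ρ₃ (min ρ₄ ρ₅))), by positivity, C₄, hC₄,
    fun ρ δ hρ hρ₀ hδρ hρδ => ?_⟩
  simp only [hρ₅, le_min_iff] at hρ₀
  obtain ⟨hρ1, hρ2, hρ3, hρ4, hρ5, hρ6, hρ7, hρ8, hρ9⟩ := hρ₀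
  rw [le_div_iff₀ (by positivity)] at hρ6 hρ7 hρ8 hρ9
  have hρsq : ρ ^ 2 ≤ ρ := by nlinarith
  have hCr : 12 * (C * ρ ^ 2) ≤ r := by
    calc 12 * (C * ρ ^ 2) ≤ 12 * (C * ρ) := by gcongr
      _ ≤ r := by linarith
  obtain ⟨hcr₀, hCr₀, hpair, hmodes, hdet⟩ := hmain ρ hρ hρ3
  obtain ⟨hwave', -⟩ := hwave ρ δ hρ hρ1 hδρ hρδ
  obtain ⟨-, hbranch'⟩ := hbranch ρ δ hρ hρ4 hδρ hρδ
  have hρ' : (ρ : ℂ) ≠ 0 := by exact_mod_cast hρ.ne'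
  have hsmall : ∀ ω : ℂ, m.factor k δ ω ≠ 0 → ‖spectralParam m k δ ρ ω‖ ≤ 2 * (2 * L) →
      IsNear (shapeOp hB) (leadOp hB z) (scatterOp hB z ρ (δ * m.k0 ω)) C ρ :=
    fun ω hF hs i j => (hnear ρ hρ hρ2 _ (hwave' ω hF hs) i j).trans (by gcongr)
  have hwin : ∀ ω ∈ window m k r ρ δ lam0, m.factor k δ ω ≠ 0 ∧
      l / 2 ≤ ‖spectralParam m k δ ρ ω‖ ∧ ‖spectralParam m k δ ρ ω‖ ≤ 2 * L ∧
      ∃ i, ‖spectralParam m k δ ρ ω - lam0 i‖ ≤ r₀ := by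
    rintro ω ⟨i, hi⟩
    obtain ⟨h1, h2, h3, h4⟩ := spectralParam_bounds m k hρ hr1 hi
    have h5 := hll i
    have h6 := hlL i
    refine ⟨h1, by linarith, by linarith, i, h4.trans (le_trans ?_ hr3)⟩
    gcongr
  -- Near the rim of the window a shift could leave it. But zeros and eigenvalues lie within `c ρ`
  -- of some `lam0 i`, so the shifted parameter is within `2 c ρ` of it, far inside the window.
  have hwin' : ∀ s₀ : ℂ, l / 2 ≤ ‖s₀‖ → (∃ i, ‖s₀ - lam0 i‖ ≤ c * ρ) →
      ∀ ω : ℂ, m.factor k δ ω ≠ 0 →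
        spectralParam m k δ ρ ω ∈ Metric.closedBall s₀ (c * ρ ^ 2) →
        ω ∈ window m k r ρ δ lam0 := by
    rintro s₀ hs₀ ⟨i, hi⟩ ω hF hω
    refine ⟨i, norm_factor_mul_sub_one_le m k hρ hF ?_⟩
    rw [mem_closedBall_iff_norm] at hω
    set s := spectralParam m k δ ρ ω
    have h1 : c * ρ ^ 2 ≤ c * ρ := by gcongr
    have h2 : ‖s - lam0 i‖ ≤ 2 * (c * ρ) := by
      have := norm_sub_le_norm_sub_add_norm_sub s s₀ (lam0 i)
      linarith
    have h3 : r * l ≤ 1 / 2 * l := by gcongr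
    have h4 : l / 4 ≤ ‖s‖ := by
      have := norm_sub_norm_le s₀ s
      rw [norm_sub_rev] at this
      linarith
    calc ‖s - lam0 i‖ ≤ 2 * (c * ρ) := h2
      _ ≤ r * (l / 4) := by linarith
      _ ≤ r * ‖s‖ := by gcongr
  have hfam : ∀ ω ∈ window m k r ρ δ lam0, ∃ W : ℂ → ℂ,
      W (spectralParam m k δ ρ ω) = ω ∧
      (∀ i j, ContinuousOn (fun s => scatterOp hB z ρ (δ * m.k0 (W s)) i j)
        (Metric.closedBall (spectralParam m k δ ρ ω) (c * ρ ^ 2))) ∧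
      (∀ s ∈ Metric.closedBall (spectralParam m k δ ρ ω) (c * ρ ^ 2),
        IsNear (shapeOp hB) (leadOp hB z) (scatterOp hB z ρ (δ * m.k0 (W s))) C ρ) ∧
      ∀ s ∈ Metric.closedBall (spectralParam m k δ ρ ω) (c * ρ ^ 2),
        m.factor k δ (W s) ≠ 0 ∧ spectralParam m k δ ρ (W s) = s ∧
          ∀ p : ℂ, m.denom k p = 0 → ‖ω - W s‖ ≤ C₄ * ρ ^ 2 * ‖ω - p‖ := by
    intro ω hω
    obtain ⟨hF, h1, h2, -⟩ := hwin ω hω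
    obtain ⟨W, hW, hWc, hWs⟩ := hbranch' ω hF h1 h2
    refine ⟨W, hW, fun i j => ?_, fun s hs => ?_, fun s hs => (hWs s hs).2⟩
    · refine (continuousOn_scatterOp hB z hρ i j).comp
        (f := fun s => (δ : ℂ) * m.k0 (W s)) ?_ fun s hs => ?_
      · simp only [Medium.k0]
        exact continuousOn_const.mul (continuousOn_const.mul hWc)
      · obtain ⟨h3, h4, h5, -⟩ := hWs s hs
        rw [mem_closedBall_zero_iff]
        refine (hwave' (W s) h4 (by rwa [h5])).trans ?_
        linarith
    · obtain ⟨h3, h4, h5, -⟩ := hWs s hs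
      exact hsmall (W s) h4 (by rwa [h5])
  have hdiag : ∀ ω ∈ window m k r ρ δ lam0, ∀ i,
      ‖scatterOp hB z ρ (δ * m.k0 ω) i i - shapeOp hB i‖ ≤ C * ρ ^ 2 := by
    intro ω hω i
    obtain ⟨hF, -, h2, -⟩ := hwin ω hω
    have := hsmall ω hF (by linarith) i i
    rwa [if_pos rfl, diagFamily_self] at this
  have hunit : ∀ (ω : ℂ) (i : Fin N) (lam : ℂ) (φ : L2 (particle B z ρ i)),
      IsEigenpairNear m r ρ (lam0 i) (particle B z ρ i) δ ω lam φ →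
      IsUnitPair (scatterOp hB z ρ (δ * m.k0 ω) i i) (lam0 i) r₀ (lam / (ρ : ℂ) ^ 2)
        (toShape B z hρ i φ) := by
    intro ω i lam φ h
    obtain ⟨h1, h2, h3⟩ := (isEigenpairNear_iff hB z hρ m r _ i δ ω lam φ).1 h
    exact ⟨h1, h2, h3.trans hr2⟩
  refine ⟨fun ω hω i => ?_, fun ω hω hres => ?_, fun ω hω lam φ hpairs hP hdv => ?_,
    fun hmean ω hω lam φ hpairs i => ?_⟩
  · obtain ⟨μ, ψ, hμ, huniq⟩ := hpair i _ (hdiag ω hω i)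
    obtain ⟨φ, rfl⟩ := (toShape B z hρ i).surjective ψ
    have hcancel : (ρ : ℂ) ^ 2 * μ / (ρ : ℂ) ^ 2 = μ := by field_simp
    refine ⟨(ρ : ℂ) ^ 2 * μ, φ, ?_, fun lam' φ' h' => ?_⟩
    · rw [isEigenpairNear_iff hB z hρ, hcancel]
      exact ⟨hμ.1, hμ.2.1, hμ.2.2.trans hCr⟩
    · obtain ⟨h1, a, ha, h2⟩ := huniq _ _ (hunit ω i lam' φ' h')
      refine ⟨?_, a, ha, (toShape B z hρ i).injective (by rw [h2, map_smul])⟩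
      rw [← h1]
      field_simp
  · obtain ⟨hF, h1, h2, h3⟩ := hwin ω hω
    obtain ⟨W, hW, hWc, hWn, hWs⟩ := hfam ω hω
    -- Along the branch `W` the blocks become functions of `s` alone, as the abstract comparison
    -- requires. Any zero `s` that it yields comes back as the frequency `W s`.
    obtain ⟨hnr, s, hs, μ, φ, hμφ, hdet0⟩ :=
      (hdet _ (fun s => scatterOp hB z ρ (δ * m.k0 (W s))) h3 hWc hWn).1 (by
        rw [hW]
        exact (isResonance_iff hB z hρ m k δ ω hF).1 hres)
    obtain ⟨h4, h5, h6⟩ := hWs s hs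
    obtain ⟨lam, ψ, h7, h8, h9⟩ := exists_eigenpairNear_of_isUnitPair hB z hρ m hCr δ (W s) hμφ
    refine ⟨W s, hwin' _ h1 hnr _ h4 (by rwa [h5]), ⟨lam, ψ, h7, ?_⟩, h6⟩
    rw [detVanishes_iff, det_calKCleared_eq hB z hρ m k δ _ h4, funext h8, funext h9]
    rw [spectralParam] at h5
    rw [h5, hdet0, mul_zero, mul_zero]
  · obtain ⟨hF, h1, h2, h3⟩ := hwin ω hω
    obtain ⟨W, hW, hWc, hWn, hWs⟩ := hfam ω hω
    rw [detVanishes_iff, det_calKCleared_eq hB z hρ m k δ _ hF] at hdv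
    have hdet0 := ((mul_eq_zero.1 hdv).resolve_left
      (Finset.prod_ne_zero_iff.2 fun i _ => hP i))
    have hdet1 := (mul_eq_zero.1 hdet0).resolve_left
      (pow_ne_zero N (mul_ne_zero hF (pow_ne_zero 2 hρ')))
    obtain ⟨hnr, s, hs, hu⟩ :=
      (hdet _ (fun s => scatterOp hB z ρ (δ * m.k0 (W s))) h3 hWc hWn).2
        (fun i => lam i / (ρ : ℂ) ^ 2) (fun i => toShape B z hρ i (φ i))
        (by
          rw [hW]
          exact fun i => hunit ω i _ _ (hpairs i))
        (by
          rw [hW]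
          exact hdet1)
    obtain ⟨h4, h5, h6⟩ := hWs s hs
    refine ⟨W s, hwin' _ h1 hnr _ h4 (by rwa [h5]),
      (isResonance_iff hB z hρ m k δ _ h4).2 ?_, fun p hp => ?_⟩
    · rw [spectralParam] at h5
      rwa [h5]
    · rw [norm_sub_rev]
      exact h6 p hp
  · obtain ⟨hF, -, h2, -⟩ := hwin ω hω
    rw [calK_self hB z hρ]
    refine mul_ne_zero (pow_ne_zero 2 hρ') ?_
    have hi := hunit ω i _ _ (hpairs i)
    -- This happens only for a single particle. The pairing is then `ρ²` times the rescaled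
    -- eigenvalue, which stays away from zero.
    by_cases hσ : finRotate N i = i
    · rw [hσ, hi.2.1, inner_smul_right, inner_self_eq_norm_sq_to_K, hi.1]
      simp only [RCLike.ofReal_one, one_pow, mul_one]
      intro h0
      have h3 := hi.2.2
      rw [h0, zero_sub, norm_neg, Complex.norm_real, Real.norm_eq_abs] at h3
      linarith [hr₀l i]
    · generalize finRotate N i = j at hσ
      have hj := hunit ω j _ _ (hpairs j)
      obtain ⟨a, ha, hda⟩ := hmodes i _ (hdiag ω hω i) _ _ hi
      obtain ⟨a', ha', hda'⟩ := hmodes j _ (hdiag ω hω j) _ _ hj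
      have hT := hsmall ω hF (by linarith) j i
      rw [if_neg hσ] at hT
      have hin : (inner ℂ (unitMode e j) (leadOp hB z j i (unitMode e i)) : ℂ) ≠ 0 := by
        have hn : ∀ i, ((‖e i‖⁻¹ : ℝ) : ℂ) ≠ 0 := fun i => by
          exact_mod_cast inv_ne_zero (norm_ne_zero_iff.2 (he0 i))
        rw [unitMode, unitMode, map_smul, inner_smul_left, inner_smul_right, Complex.conj_ofReal,
          inner_leadOp]
        refine mul_ne_zero (hn j) (mul_ne_zero (hn i) (mul_ne_zero (mul_ne_zero ?_ (hmean i)) ?_))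
        · have hzz : (‖z j - z i‖ : ℂ) ≠ 0 := by
            exact_mod_cast norm_ne_zero_iff.2 (sub_ne_zero.2 (hz.ne hσ))
          have hpi : (Real.pi : ℂ) ≠ 0 := by exact_mod_cast Real.pi_pos.ne'
          rw [gk_zero]
          exact one_div_ne_zero (mul_ne_zero (mul_ne_zero (by norm_num) hpi) hzz)
        · exact (map_ne_zero _).2 (hmean j)
      have hgi := hgle ⟨(j, i), hin⟩
      have hfin := le_norm_inner_of_near hρ ha ha' hi.1 hj.1 (norm_unitMode he0 j) hda hda' hT
        (hmode.norm_le j i)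
      intro h0
      -- A vanishing pairing would leave `ρ g ≤ ρ² (C + 2 C c)`, while the last bound in `ρ₅` makes
      -- the right side at most `ρ g / 2`.
      rw [h0, norm_zero, zero_add] at hfin
      have h3 : ρ * g ≤ C * ρ ^ 2 + ρ * (C * (c * ρ ^ 2) + C * (c * ρ ^ 2)) :=
        le_trans (by gcongr) hfin
      have h4 : C * ρ ^ 2 + ρ * (C * (c * ρ ^ 2) + C * (c * ρ ^ 2)) ≤
          ρ * (ρ * (C + C * c + C * c)) := by
        have : C * (c * ρ ^ 2) ≤ C * (c * ρ) := by gcongr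
        have : ρ * (C * (c * ρ ^ 2) + C * (c * ρ ^ 2)) ≤ ρ * (C * (c * ρ) + C * (c * ρ)) := by
          gcongr
        linarith
      have h5 := le_of_mul_le_mul_left (h3.trans h4) hρ
      linarith
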